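/- **Setting.** Let $C_1,\dots,C_n$ be pairwise disjoint unit circles (trajectories) in the plane, $\varepsilon<1/2$, and let $G=(V,E)$ be a connected graph on $\{1,\dots,n\}$ such that the centers of $C_i$ and $C_j$ are at distance at most $2+\varepsilon$ whenever $\{i,j\}\in E$. For $\{i,j\}\in E$ let $\phi_{ij}$ be the point of $C_i$ closest to $C_j$. A *synchronized communication system* (SCS) of $n$ robots consists of such data together with starting angles $f(C_i)\in[0,2\pi)$ and directions $g(C_i)\in\{1,-1\}$, so that at time $t$ a robot following the schedule of $C_i$ is at the angle $f(C_i)+2\pi g(C_i)t$ of $C_i$, where for every $\{i,j\}\in E$ one has $g(C_i)=-g(C_j)$ and the schedule of $C_i$ is at $\phi_{ij}$ exactly at the times at which the schedule of $C_j$ is at $\phi_{ji}$. Robot $i$ starts on $C_i$. After some robots have been removed, the others apply the shifting protocol: a robot that arrives on $C_i$ at a link position $\phi_{ij}$ when there is no robot at $\phi_{ji}$ shifts (instantaneously) to $C_j$ and follows the schedule of $C_j$; otherwise it stays on $C_i$. A surviving robot *starves* if, every time it arrives at a link position, the corresponding neighbor is not there. The *1-resilience* of the SCS is the minimum number of robots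 whose removal causes at least one surviving robot to starve. **Model.** A unit-cost random access machine with words of $O(\log n)$ bits, with exact real numbers that can be added, subtracted, multiplied, divided and compared and for which the polar angle in $[0,2\pi)$ of a vector can be taken (there is no rounding of reals to words), and with subroutine calls, where the steps made in the subroutine are counted. An SCS is presented by $n$, the coordinates of the centers, the numbers $f(C_i)$ and $g(C_i)$, and a list of the edges of $G$ in arbitrary order. Let $T_{\gcd}(n)$ denote a bound on the time in which some program for this machine computes the greatest common divisor of any two positive integers that are at most $n$. **Theorem.** The 1-resilience of an SCS of $n$ robots can be computed in $O(n\,T_{\gcd}(n))=\tilde O(n)$ time. That is: 1. for every program that computes the greatest common divisor of any two positive integers at most $n$ in time at most $T_{\gcd}(n)$, for all $n$, there are a program and a constant $C$ such that the program computes the 1-resilience of every SCS of $n$ robots in time at most $C\,n\,T_{\gcd}(n)$, for all $n\ge 1$; 2. there is a program for the greatest common divisor with $T_{\gcd}(n)=O(\log^k (n+2))$ for some constant $k$; 3. consequently there are a program and constants $C,k$ such that the program computes the 1-resilience of every SCS of $n$ robots in time at most $C\,n\log^k(n+2)$, for all $n\ge 1$. -/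

import Mathlib

/-! ### Synchronized communication systems -/

/-- The link position of trajectory `i` with respect to trajectory `j`, as an angle: the point of
the unit circle around `center i` closest to the unit circle around `center j` lies in the
direction of `center j`. -/
noncomputable def linkPosition {n : ℕ} (center : Fin n → ℂ) (i j : Fin n) : Real.Angle :=
  ((Complex.arg (center j - center i) : ℝ) : Real.Angle)

/-- The position at time `t` of a robot that follows the schedule `(f, g)` in trajectory `i`:
the angle `f i + 2π · g i · t`; a tour of a trajectory takes one time unit. -/
noncomputable def schedulePosition {n : ℕ} (f : Fin n → ℝ) (g : Fin n → ℤ) (i : Fin n) (t : ℝ) :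
    Real.Angle :=
  ((f i + 2 * Real.pi * (g i : ℝ) * t : ℝ) : Real.Angle)

/-- A synchronized communication system (SCS) of `n` robots, one per trajectory. The plane is `ℂ`,
and the trajectories are the unit circles around the points `center i`. -/
structure SCS (n : ℕ) where
  center : Fin n → ℂ
  /-- the trajectories are pairwise disjoint circles -/
  disjoint_trajectories :
    Pairwise fun i j => Disjoint (Metric.sphere (center i) 1) (Metric.sphere (center j) 1)
  /-- the communication range -/
  range : ℝ
  range_lt : range < 1 / 2
  /-- the communication graph -/
  graph : SimpleGraph (Fin n)
  connected : graph.Connected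
  /-- every link is a potential link -/
  dist_le : ∀ i j, graph.Adj i j → dist (center i) (center j) ≤ 2 + range
  /-- starting positions -/
  f : Fin n → ℝ
  f_mem : ∀ i, f i ∈ Set.Ico 0 (2 * Real.pi)
  /-- movement directions, `1` is counterclockwise and `-1` is clockwise -/
  g : Fin n → ℤ
  g_eq : ∀ i, g i = 1 ∨ g i = -1
  /-- the schedule is synchronized: neighbors are at their common link at the same times -/
  synchronized : ∀ i j, graph.Adj i j → ∀ t : ℝ,
    (schedulePosition f g i t = linkPosition center i j ↔
      schedulePosition f g j t = linkPosition center j i)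
  /-- neighbors move in opposite directions -/
  opposite : ∀ i j, graph.Adj i j → g i = -g j

namespace SCS

variable {n : ℕ} (S : SCS n)

/-- The link position `φ i j`. -/
noncomputable def link (i j : Fin n) : Real.Angle := linkPosition S.center i j

/-- The position at time `t` of a robot that is in trajectory `i` at that time. -/
noncomputable def pos (i : Fin n) (t : ℝ) : Real.Angle := schedulePosition S.f S.g i t

/-- At time `t` the schedule of some trajectory is at one of its link positions. -/
def IsEvent (t : ℝ) : Prop := ∃ i j, S.graph.Adj i j ∧ S.pos i t = S.link i j

/-- The times `t ≥ 0` with `IsEvent t`, in increasing order. -/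
noncomputable def eventTime : ℕ → ℝ
  | 0 => sInf {t : ℝ | 0 ≤ t ∧ S.IsEvent t}
  | k + 1 => sInf {t : ℝ | eventTime k < t ∧ S.IsEvent t}

open Classical in
/-- The motion of a partial SCS under the shifting protocol, after the robots outside `live` have
left at time `0` (robots are named after their starting trajectories): `S.loc live k u` is the
trajectory in which robot `u` is when the `k`-th event time is reached, before any shift made at
that time. At an event time, a robot in trajectory `i` that is at the link position `φ i j` shifts
to trajectory `j` if there is no robot at `φ j i`, and otherwise stays in trajectory `i`. There are
no shifts between event times. -/
noncomputable def loc (live : Finset (Fin n)) : ℕ → Fin n → Fin n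
  | 0, u => u
  | k + 1, u =>
      if h : ∃ j, (S.graph.Adj (loc live k u) j ∧
            S.pos (loc live k u) (S.eventTime k) = S.link (loc live k u) j) ∧
          ¬ ∃ v ∈ live, loc live k v = j ∧
            S.pos j (S.eventTime k) = S.link j (loc live k u)
      then h.choose
      else loc live k u

/-- At the `k`-th event time, robot `u` arrives at its link position towards trajectory `j`. -/
def Arrives (live : Finset (Fin n)) (k : ℕ) (u j : Fin n) : Prop :=
  S.graph.Adj (S.loc live k u) j ∧
    S.pos (S.loc live k u) (S.eventTime k) = S.link (S.loc live k u) j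

/-- At the `k`-th event time, some live robot is in trajectory `j`, at the link position of `j`
towards the trajectory of robot `u`. -/
def NeighborPresent (live : Finset (Fin n)) (k : ℕ) (u j : Fin n) : Prop :=
  ∃ v ∈ live, S.loc live k v = j ∧ S.pos j (S.eventTime k) = S.link j (S.loc live k u)

/-- Robot `u` starves in the partial SCS with set of live robots `live`: whenever it arrives at a
link position, the corresponding neighbor is not there. -/
def Starves (live : Finset (Fin n)) (u : Fin n) : Prop :=
  ∀ k j, S.Arrives live k u j → ¬ S.NeighborPresent live k u j

/-- The `k`-resilience: the minimum number of robots whose removal causes the starvation of at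
least `k` surviving robots, `⊤` if there is no such set of robots. -/
noncomputable def kResilience (k : ℕ) : ℕ∞ :=
  ⨅ (removed : Finset (Fin n)) (_ : k ≤ Set.ncard {u | u ∉ removed ∧ S.Starves removedᶜ u}),
    (removed.card : ℕ∞)

end SCS

/-! ### Random access machines

A unit-cost random access machine with integer words and real numbers, programmed with structured
control flow. Word magnitudes are bounded by a parameter of the execution. Reals can be
added, subtracted, multiplied, divided, compared, and one can take the polar angle of a vector; there
is no conversion from reals to words. -/

namespace RAM

/-- A machine state: word registers and word memory, real registers and real memory. -/
structure State where
  reg : ℕ → ℕ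
  mem : ℕ → ℕ
  rreg : ℕ → ℝ
  rmem : ℕ → ℝ

inductive WordOp
  | add | sub | mul | div | mod

/-- Word operations; subtraction is truncated, division by zero gives zero. -/
def WordOp.eval : WordOp → ℕ → ℕ → ℕ
  | .add, a, b => a + b
  | .sub, a, b => a - b
  | .mul, a, b => a * b
  | .div, a, b => a / b
  | .mod, a, b => a % b

inductive RealOp
  | add | sub | mul | div | angle

/-- Real operations; `angle` is the angle in `[0, 2π)` of the vector `(a, b)`. -/
noncomputable def RealOp.eval : RealOp → ℝ → ℝ → ℝ
  | .add, a, b => a + b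
  | .sub, a, b => a - b
  | .mul, a, b => a * b
  | .div, a, b => a / b
  | .angle, a, b => toIcoMod Real.two_pi_pos 0 (Complex.arg ⟨a, b⟩)

/-- Tests: two words are equal, a word is less than another, a real is less than another. -/
inductive Test
  | weq (x y : ℕ)
  | wlt (x y : ℕ)
  | rlt (x y : ℕ)

def Test.Holds : Test → State → Prop
  | .weq x y, s => s.reg x = s.reg y
  | .wlt x y, s => s.reg x < s.reg y
  | .rlt x y, s => s.rreg x < s.rreg y

/-- Programs. The arguments `x y z` are register numbers. -/
inductive Program
  | skip
  /-- word register `x` becomes the constant `a` -/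
  | const (x a : ℕ)
  /-- word register `x` becomes the result of `op` on word registers `y` and `z` -/
  | word (op : WordOp) (x y z : ℕ)
  /-- word register `x` becomes the content of the word memory cell whose address is in `y` -/
  | load (x y : ℕ)
  /-- the word memory cell whose address is in `x` receives the content of word register `y` -/
  | store (x y : ℕ)
  /-- real register `x` becomes the integer constant `a` -/
  | rconst (x : ℕ) (a : ℤ)
  /-- real register `x` becomes the result of `op` on real registers `y` and `z` -/
  | real (op : RealOp) (x y z : ℕ)
  /-- real register `x` becomes the content of the real memory cell whose address is in `y` -/
  | rload (x y : ℕ)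
  /-- the real memory cell whose address is in `x` receives the content of real register `y` -/
  | rstore (x y : ℕ)
  | seq (p q : Program)
  | ite (b : Test) (p q : Program)
  | while (b : Test) (p : Program)
  /-- word register `x` becomes the value returned by the subroutine `p` on the contents of word
  registers `y` and `z` -/
  | call (p : Program) (x y z : ℕ)

/-- The state in which a program with two word arguments starts: the arguments are in word
registers `0` and `1`, everything else is cleared. -/
def argState (a b : ℕ) : State where
  reg := fun r => if r = 0 then a else if r = 1 then b else 0
  mem := fun _ => 0
  rreg := fun _ => 0
  rmem := fun _ => 0

/-- `Exec B p s t s'`: started in state `s`, program `p` halts in state `s'` after `t` steps, and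
never writes a word greater than `B`. Each elementary instruction, each test and each call counts
as one step, and the steps made inside a subroutine are counted. A subroutine works in a frame of
its own (on a machine with a single memory, clearing the cells that it has used costs a constant
factor) and returns the content of its word register `0`. -/
inductive Exec (B : ℕ) : Program → State → ℕ → State → Prop
  | skip (s : State) : Exec B .skip s 1 s
  | const (s : State) (x a : ℕ) (h : a ≤ B) :
      Exec B (.const x a) s 1 { s with reg := Function.update s.reg x a }
  | word (s : State) (op : WordOp) (x y z : ℕ) (h : op.eval (s.reg y) (s.reg z) ≤ B) :
      Exec B (.word op x y z) s 1
        { s with reg := Function.update s.reg x (op.eval (s.reg y) (s.reg z)) }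
  | load (s : State) (x y : ℕ) (h : s.mem (s.reg y) ≤ B) :
      Exec B (.load x y) s 1 { s with reg := Function.update s.reg x (s.mem (s.reg y)) }
  | store (s : State) (x y : ℕ) (h : s.reg y ≤ B) :
      Exec B (.store x y) s 1 { s with mem := Function.update s.mem (s.reg x) (s.reg y) }
  | rconst (s : State) (x : ℕ) (a : ℤ) :
      Exec B (.rconst x a) s 1 { s with rreg := Function.update s.rreg x (a : ℝ) }
  | real (s : State) (op : RealOp) (x y z : ℕ) :
      Exec B (.real op x y z) s 1
        { s with rreg := Function.update s.rreg x (op.eval (s.rreg y) (s.rreg z)) }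
  | rload (s : State) (x y : ℕ) :
      Exec B (.rload x y) s 1 { s with rreg := Function.update s.rreg x (s.rmem (s.reg y)) }
  | rstore (s : State) (x y : ℕ) :
      Exec B (.rstore x y) s 1 { s with rmem := Function.update s.rmem (s.reg x) (s.rreg y) }
  | seq {p q : Program} {s s₁ s₂ : State} {t₁ t₂ : ℕ}
      (h₁ : Exec B p s t₁ s₁) (h₂ : Exec B q s₁ t₂ s₂) : Exec B (.seq p q) s (t₁ + t₂) s₂
  | ite_true {b : Test} {p q : Program} {s s' : State} {t : ℕ}
      (hb : b.Holds s) (h : Exec B p s t s') : Exec B (.ite b p q) s (t + 1) s'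
  | ite_false {b : Test} {p q : Program} {s s' : State} {t : ℕ}
      (hb : ¬ b.Holds s) (h : Exec B q s t s') : Exec B (.ite b p q) s (t + 1) s'
  | while_true {b : Test} {p : Program} {s s₁ s₂ : State} {t₁ t₂ : ℕ}
      (hb : b.Holds s) (h₁ : Exec B p s t₁ s₁) (h₂ : Exec B (.while b p) s₁ t₂ s₂) :
      Exec B (.while b p) s (t₁ + t₂ + 1) s₂
  | while_false {b : Test} {p : Program} {s : State} (hb : ¬ b.Holds s) :
      Exec B (.while b p) s 1 s
  | call {p : Program} {s s' : State} {x y z t : ℕ}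
      (h : Exec B p (argState (s.reg y) (s.reg z)) t s') (hr : s'.reg 0 ≤ B) :
      Exec B (.call p x y z) s (t + 1) { s with reg := Function.update s.reg x (s'.reg 0) }

/-- On words of `O(log n)` bits, the program `p` computes the greatest common divisor of any two
positive integers that are at most `n` in time at most `T n`. -/
def ComputesGcd (p : Program) (T : ℕ → ℝ) : Prop :=
  ∃ c : ℕ, ∀ n a b : ℕ, 1 ≤ a → a ≤ n → 1 ≤ b → b ≤ n →
    ∃ (t : ℕ) (s' : State), Exec ((n + 2) ^ c) p (argState a b) t s' ∧
      (t : ℝ) ≤ T n ∧ s'.reg 0 = Nat.gcd a b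

/-- `es` lists every edge of the communication graph exactly once, in any order and orientation. -/
def ListsEdges {n : ℕ} (S : SCS n) (es : List (Fin n × Fin n)) : Prop :=
  (es.map fun e : Fin n × Fin n => s(e.1, e.2)).Nodup ∧
    ∀ i j, S.graph.Adj i j ↔ s(i, j) ∈ es.map fun e : Fin n × Fin n => s(e.1, e.2)

/-- The machine state that presents an SCS. Word registers `0` and `1` hold the number of
trajectories and the number of links. The word memory holds the directions (`1` for CCW, `0` for
CW), followed by the pairs of trajectories that are linked. The real memory holds, for each
trajectory, the two coordinates of its center and the starting position of its robot. -/
noncomputable def inputState {n : ℕ} (S : SCS n) (es : List (Fin n × Fin n)) : State where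
  reg := fun r => if r = 0 then n else if r = 1 then es.length else 0
  mem := fun a => (List.ofFn (fun i : Fin n => if S.g i = 1 then 1 else 0) ++
    es.flatMap fun e : Fin n × Fin n => [(e.1 : ℕ), (e.2 : ℕ)]).getD a 0
  rreg := fun _ => 0
  rmem := fun a => ((List.ofFn fun i : Fin n =>
    [(S.center i).re, (S.center i).im, S.f i]).flatten).getD a 0

/-- On words of `O(log n)` bits, the program `p` computes the 1-resilience of every SCS of `n`
robots in time at most `T n`. -/
def ComputesOneResilience (p : Program) (T : ℕ → ℝ) : Prop :=
  ∃ c : ℕ, ∀ (n : ℕ) (S : SCS n) (es : List (Fin n × Fin n)), ListsEdges S es →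
    ∃ (t : ℕ) (s' : State), Exec ((n + 2) ^ c) p (inputState S es) t s' ∧
      (t : ℝ) ≤ T n ∧ ((s'.reg 0 : ℕ) : ℕ∞) = S.kResilience 1

end RAM

/-! Let a token start in every trajectory and cross over at every link it reaches. When two robots
meet they stay where two tokens would trade places, and this does not change which trajectories are
occupied. So at each event time the live robots and the live tokens occupy the same trajectories
(`image_loc`). A starving robot shifts at every link, so it moves exactly like its token; it starves
iff its token never meets a live token (`starves_iff`). The 1-resilience is therefore the minimum
over `u` of the number of tokens that meet `u` (`kResilience_one_eq`).

Linear time rests on a geometric fact. The neighbors of a center lie at distance between 2 and 2.5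
from it and more than 2 from each other, so two links of one trajectory are more than 1/16 of a
period apart (`bucket_injective`). Cut the period into 16 intervals: the links in one interval form
a matching, so their order within the interval is immaterial and no sorting is needed. The motion
during a period is a product of 16 involutions, a permutation `period`, and there are at most `16 *
n` oriented links (darts).

Two tokens meet iff some power of `period` takes their pair to a pair that crosses at a dart in the
first period (`meets_iff`). By the Chinese remainder theorem, the orbit of a pair under the diagonal
action is given by the two cycles and by the difference of the positions in them modulo the gcd of
the two lengths (`exists_pow_eq_iff`). For a fixed first token, such an orbit contains (second
length) / gcd second tokens (`card_pairKey_eq`). So the number of tokens met is constant on a cycle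
and is a sum of these weights over the distinct keys of darts (`ncard_meets`), at the price of one
gcd per dart. Repeated keys are detected in a table with `n ^ 3` cells, which needs no
initialization because memory starts at zero and addresses of polynomial size are words of `O(log
n)` bits.

On the machine, code without loops is verified by weakest preconditions, and each of the five loops
by an invariant indexed by the iteration (`Runs.of_wp`, `Runs.loop`). Every loop makes at most `16 *
n` iterations, and each of them costs a constant times one gcd. Euclid's algorithm provides a
logarithmic gcd. -/

namespace SCS

variable {n : ℕ} (S : SCS n)

/-! ### Times of links in a period, and their separation -/

/-- The time in `[0, 1)` at which the schedule of trajectory `i` is at its link position towards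
trajectory `j`. -/
noncomputable def phase (i j : Fin n) : ℝ :=
  Int.fract ((S.g i : ℝ) * (Complex.arg (S.center j - S.center i) - S.f i) / (2 * Real.pi))

theorem phase_nonneg (i j : Fin n) : 0 ≤ S.phase i j := Int.fract_nonneg _

theorem phase_lt_one (i j : Fin n) : S.phase i j < 1 := Int.fract_lt_one _

theorem fract_phase (i j : Fin n) : Int.fract (S.phase i j) = S.phase i j := Int.fract_fract _

/-- Since `g i = ±1` is its own inverse, the equation of angles modulo `2π` can be solved for `t`
modulo 1; for clockwise motion the integer witness changes sign. -/
theorem pos_eq_link_iff (i j : Fin n) (t : ℝ) :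
    S.pos i t = S.link i j ↔ Int.fract t = S.phase i j := by
  unfold pos link schedulePosition linkPosition phase
  rw [Real.Angle.angle_eq_iff_two_pi_dvd_sub, Int.fract_eq_fract]
  have hpi := Real.pi_pos
  rcases S.g_eq i with hg | hg <;> rw [hg] <;> push_cast
  · refine exists_congr fun k => ?_
    rw [mul_comm (2 * Real.pi) (k : ℝ), ← div_eq_iff (by positivity : 2 * Real.pi ≠ 0)]
    refine Eq.congr ?_ rfl
    field_simp
    ring
  · constructor
    · rintro ⟨k, hk⟩
      refine ⟨-k, ?_⟩
      field_simp
      push_cast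
      linear_combination -hk
    · rintro ⟨k, hk⟩
      refine ⟨-k, ?_⟩
      field_simp at hk
      push_cast
      linear_combination -hk

theorem phase_comm {i j : Fin n} (h : S.graph.Adj i j) : S.phase i j = S.phase j i := by
  have h1 := (S.synchronized i j h (S.phase i j)).1
    ((S.pos_eq_link_iff i j _).2 (S.fract_phase i j))
  have h2 := (S.pos_eq_link_iff j i _).1 h1
  rwa [S.fract_phase] at h2

/-- A period is divided into 16 intervals of equal length, such that no trajectory has two links
in the same interval. -/
noncomputable def bucket (i j : Fin n) : ℕ := ⌊16 * S.phase i j⌋₊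

theorem bucket_lt (i j : Fin n) : S.bucket i j < 16 := by
  rw [bucket, Nat.floor_lt (by have := S.phase_nonneg i j; positivity)]
  have := S.phase_lt_one i j
  push_cast
  linarith

theorem bucket_le_phase (i j : Fin n) : (S.bucket i j : ℝ) ≤ 16 * S.phase i j :=
  Nat.floor_le (by have := S.phase_nonneg i j; positivity)

theorem phase_lt_bucket (i j : Fin n) : 16 * S.phase i j < S.bucket i j + 1 :=
  Nat.lt_floor_add_one _

theorem bucket_comm {i j : Fin n} (h : S.graph.Adj i j) : S.bucket i j = S.bucket j i := by
  rw [bucket, bucket, S.phase_comm h]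

/-- Circles of equal radius cannot be nested: if the centers were at distance at most 2, the circles
would intersect or coincide. -/
theorem two_lt_dist {i j : Fin n} (h : i ≠ j) : 2 < dist (S.center i) (S.center j) := by
  by_contra! hle
  have hd := S.disjoint_trajectories h
  obtain ⟨c, d, hc, hdd⟩ : ∃ c d : ℂ, S.center i = c - d ∧ S.center j = c + d :=
    ⟨(S.center i + S.center j) / 2, (S.center j - S.center i) / 2, by ring, by ring⟩
  have hd1 : ‖d‖ ≤ 1 := by
    rw [hc, hdd, dist_eq_norm, show c - d - (c + d) = -(2 * d) by ring, norm_neg, norm_mul] at hle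
    norm_num at hle
    linarith
  -- With `c` the midpoint of the centers and `d` half their difference, the common point is `c +
  -- w`, where `w` is orthogonal to `d` and `‖w‖ ^ 2 + ‖d‖ ^ 2 = 1`.
  obtain ⟨w, hw1, hw2⟩ : ∃ w : ℂ, ‖w + d‖ = 1 ∧ ‖w - d‖ = 1 := by
    by_cases h0 : d = 0
    · exact ⟨1, by simp [h0], by simp [h0]⟩
    have hdn : 0 < ‖d‖ := norm_pos_iff.2 h0
    set r : ℝ := Real.sqrt (1 - ‖d‖ ^ 2) / ‖d‖ with hr
    have hsq : Real.sqrt (1 - ‖d‖ ^ 2) ^ 2 = 1 - ‖d‖ ^ 2 := Real.sq_sqrt (by nlinarith)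
    have hrr : r ^ 2 * ‖d‖ ^ 2 = 1 - ‖d‖ ^ 2 := by
      rw [hr, div_pow, hsq]
      field_simp
    have key : ∀ e : ℝ, e ^ 2 = 1 → ‖(r * Complex.I + e : ℂ) * d‖ = 1 := by
      intro e he
      have h1 : ‖(r * Complex.I + e : ℂ)‖ ^ 2 = r ^ 2 + 1 := by
        rw [← Complex.normSq_eq_norm_sq, Complex.normSq_apply]
        simp
        nlinarith
      have h2 : ‖(r * Complex.I + e : ℂ) * d‖ ^ 2 = 1 := by
        rw [norm_mul, mul_pow, h1]
        linarith
      have h3 := norm_nonneg ((r * Complex.I + e : ℂ) * d)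
      nlinarith
    refine ⟨r * Complex.I * d, ?_, ?_⟩
    · have := key 1 (by norm_num)
      rw [add_mul] at this
      simpa using this
    · have := key (-1) (by norm_num)
      rw [add_mul] at this
      simpa [sub_eq_add_neg] using this
  have h1 : c + w ∈ Metric.sphere (S.center i) 1 := by
    rw [mem_sphere_iff_norm, hc, show c + w - (c - d) = w + d by ring, hw1]
  have h2 : c + w ∈ Metric.sphere (S.center j) 1 := by
    rw [mem_sphere_iff_norm, hdd, show c + w - (c + d) = w - d by ring, hw2]
  exact Set.disjoint_left.1 hd h1 h2

/-- Go from `w` to `z` by a rotation and then a radial move; the chord of the rotation is at most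
its arc. The integer `k` allows any representative of the angle. -/
theorem norm_sub_le_of_arg (z w : ℂ) (k : ℤ) :
    ‖z - w‖ ≤ |‖z‖ - ‖w‖| + ‖w‖ * |Complex.arg z - Complex.arg w - 2 * Real.pi * k| := by
  have hz : z = ‖z‖ * Complex.exp (Complex.I * (Complex.arg z : ℝ)) := by
    conv_lhs => rw [← Complex.norm_mul_exp_arg_mul_I z]
    rw [mul_comm Complex.I]
  have hw : w = ‖w‖ * Complex.exp (Complex.I * (Complex.arg w : ℝ)) := by
    conv_lhs => rw [← Complex.norm_mul_exp_arg_mul_I w]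
    rw [mul_comm Complex.I]
  set a := Complex.arg z
  set b := Complex.arg w
  set c : ℝ := a - b - 2 * Real.pi * k with hc
  have hac : Complex.exp (Complex.I * (a : ℝ)) =
      Complex.exp (Complex.I * (b : ℝ)) * Complex.exp (Complex.I * (c : ℝ)) := by
    rw [← Complex.exp_add, Complex.exp_eq_exp_iff_exists_int]
    refine ⟨k, ?_⟩
    rw [hc]
    push_cast
    ring
  have e1 : z - w = ((‖z‖ - ‖w‖ : ℝ) : ℂ) * Complex.exp (Complex.I * (a : ℝ)) +
      ‖w‖ * Complex.exp (Complex.I * (b : ℝ)) * (Complex.exp (Complex.I * (c : ℝ)) - 1) := by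
    rw [mul_sub, mul_assoc, ← hac, mul_one]
    nth_rewrite 1 [hz, hw]
    push_cast
    ring
  have hn : ∀ x : ℝ, ‖Complex.exp (Complex.I * (x : ℝ))‖ = 1 := fun x => by
    rw [mul_comm, Complex.norm_exp_ofReal_mul_I]
  rw [e1]
  refine (norm_add_le _ _).trans ?_
  rw [norm_mul, norm_mul, norm_mul, hn, hn, Complex.norm_real, Complex.norm_real, mul_one, mul_one,
    Real.norm_eq_abs, Real.norm_eq_abs, abs_norm]
  gcongr
  simpa using Real.norm_exp_I_mul_ofReal_sub_one_le (x := c)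

/-- Seen from `i`, two neighbors in one interval have radii that differ by at most 1/2 and
directions that differ by at most `2π / 16`. They would then be at distance at most `1/2 + 2.5 * 6.3
/ 16 < 2`, which `two_lt_dist` forbids. -/
theorem bucket_injective {i j k : Fin n} (hj : S.graph.Adj i j) (hk : S.graph.Adj i k)
    (h : S.bucket i j = S.bucket i k) : j = k := by
  by_contra hne
  have hsep := S.two_lt_dist hne
  have hji := S.two_lt_dist hj.ne
  have hki := S.two_lt_dist hk.ne
  have hj2 := S.dist_le i j hj
  have hk2 := S.dist_le i k hk
  have hr := S.range_lt
  rw [dist_comm, dist_eq_norm] at hji hki hj2 hk2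
  set z := S.center j - S.center i with hz
  set w := S.center k - S.center i with hw
  rw [dist_eq_norm, show S.center j - S.center k = z - w by rw [hz, hw]; ring] at hsep
  have hph : |S.phase i j - S.phase i k| ≤ 1 / 16 := by
    have h1 := S.bucket_le_phase i j
    have h2 := S.phase_lt_bucket i j
    have h3 := S.bucket_le_phase i k
    have h4 := S.phase_lt_bucket i k
    rw [h] at h1 h2
    rw [abs_le]
    constructor <;> linarith
  -- Both phases are fractional parts of `± (arg - f i) / (2π)` with the same sign and the same `f
  -- i`, so their difference gives that of the arguments up to sign and whole turns.
  obtain ⟨m, hm⟩ : ∃ m : ℤ, |Complex.arg z - Complex.arg w - 2 * Real.pi * m| =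
      2 * Real.pi * |S.phase i j - S.phase i k| := by
    have hpi := Real.pi_pos
    have h1 := Int.floor_add_fract
      ((S.g i : ℝ) * (Complex.arg (S.center j - S.center i) - S.f i) / (2 * Real.pi))
    have h2 := Int.floor_add_fract
      ((S.g i : ℝ) * (Complex.arg (S.center k - S.center i) - S.f i) / (2 * Real.pi))
    rw [eq_div_iff (by positivity)] at h1 h2
    change (_ + S.phase i j) * _ = _ at h1
    change (_ + S.phase i k) * _ = _ at h2
    rw [← abs_of_pos (by positivity : 0 < 2 * Real.pi), ← abs_mul]
    rw [abs_of_pos (by positivity : 0 < 2 * Real.pi)]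
    generalize ⌊(S.g i : ℝ) * (Complex.arg (S.center j - S.center i) - S.f i) / (2 * Real.pi)⌋ = A
      at h1
    generalize ⌊(S.g i : ℝ) * (Complex.arg (S.center k - S.center i) - S.f i) / (2 * Real.pi)⌋ = B
      at h2
    rw [← hz] at h1
    rw [← hw] at h2
    rcases S.g_eq i with hg | hg <;> rw [hg] at h1 h2 <;> push_cast at h1 h2
    · refine ⟨A - B, congrArg _ ?_⟩
      push_cast
      linear_combination h2 - h1
    · refine ⟨B - A, ?_⟩
      rw [← abs_neg]
      congr 1
      push_cast
      linear_combination h2 - h1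
  have hle := norm_sub_le_of_arg z w m
  rw [hm] at hle
  have hpi := Real.pi_lt_d2
  have h5 : |‖z‖ - ‖w‖| ≤ 1 / 2 := by
    rw [abs_le]
    constructor <;> linarith
  have h6 : 2 * Real.pi * |S.phase i j - S.phase i k| ≤ 2 * 3.15 * (1 / 16) := by gcongr
  have h7 : ‖w‖ * (2 * Real.pi * |S.phase i j - S.phase i k|) ≤ 2.5 * (2 * 3.15 * (1 / 16)) := by
    apply mul_le_mul _ h6 _ (by norm_num)
    · linarith
    · have := Real.pi_pos
      positivity
  norm_num at h7
  linarith

/-! ### Rounds: the crossings of one interval as an involution -/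

open Classical in
/-- The trajectory to which the token in trajectory `i` moves in interval `q` of a period. -/
noncomputable def round (q : ℕ) (i : Fin n) : Fin n :=
  if h : ∃ j, S.graph.Adj i j ∧ S.bucket i j = q then h.choose else i

theorem round_eq {q : ℕ} {i j : Fin n} (h : S.graph.Adj i j) (hq : S.bucket i j = q) :
    S.round q i = j := by
  have hex : ∃ j, S.graph.Adj i j ∧ S.bucket i j = q := ⟨j, h, hq⟩
  rw [round, dif_pos hex]
  exact S.bucket_injective hex.choose_spec.1 h (hex.choose_spec.2.trans hq.symm)

theorem round_eq_self {q : ℕ} {i : Fin n} (h : ¬ ∃ j, S.graph.Adj i j ∧ S.bucket i j = q) :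
    S.round q i = i := dif_neg h

theorem round_involutive (q : ℕ) : Function.Involutive (S.round q) := by
  intro i
  by_cases h : ∃ j, S.graph.Adj i j ∧ S.bucket i j = q
  · obtain ⟨j, hj, hq⟩ := h
    rw [S.round_eq hj hq]
    exact S.round_eq hj.symm ((S.bucket_comm hj).symm.trans hq)
  · rw [S.round_eq_self h, S.round_eq_self h]

/-- The position of the tokens after `R` rounds. -/
noncomputable def rpos : ℕ → Equiv.Perm (Fin n)
  | 0 => 1
  | R + 1 => (S.round_involutive (R % 16)).toPerm * rpos R

theorem rpos_succ_apply (R : ℕ) (u : Fin n) :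
    S.rpos (R + 1) u = S.round (R % 16) (S.rpos R u) := rfl

/-- The permutation of the tokens made in one period. -/
noncomputable def period : Equiv.Perm (Fin n) := S.rpos 16

theorem rpos_add (m q : ℕ) : S.rpos (16 * m + q) = S.rpos q * S.rpos (16 * m) := by
  induction q with
  | zero => simp [rpos]
  | succ q ih =>
    rw [← add_assoc, rpos, ih, rpos, mul_assoc]
    simp

theorem rpos_mul (m : ℕ) : S.rpos (16 * m) = S.period ^ m := by
  induction m with
  | zero => simp [rpos]
  | succ m ih => rw [mul_add, mul_one, S.rpos_add, ih, pow_succ', period]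

end SCS

/-! ### Event times -/

namespace SCS

variable {n : ℕ} (S : SCS n)

theorem isEvent_iff (t : ℝ) : S.IsEvent t ↔ ∃ i j, S.graph.Adj i j ∧ Int.fract t = S.phase i j := by
  simp only [IsEvent, pos_eq_link_iff]

/-- An event time is an integer plus one of finitely many phases. -/
theorem finite_events (a b : ℝ) : {t | S.IsEvent t ∧ a ≤ t ∧ t ≤ b}.Finite := by
  have h1 : (Set.Icc ⌊a⌋ ⌊b⌋ ×ˢ (Set.univ : Set (Fin n × Fin n))).Finite :=
    (Set.finite_Icc _ _).prod Set.finite_univ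
  refine (h1.image fun x => (x.1 : ℝ) + S.phase x.2.1 x.2.2).subset ?_
  rintro t ⟨he, ha, hb⟩
  obtain ⟨i, j, -, hf⟩ := (S.isEvent_iff t).1 he
  refine ⟨(⌊t⌋, (i, j)), ⟨⟨Int.floor_le_floor ha, Int.floor_le_floor hb⟩, trivial⟩, ?_⟩
  change (⌊t⌋ : ℝ) + S.phase i j = t
  rw [← hf]
  exact Int.floor_add_fract t

theorem isLeast_sInf_events {A : Set ℝ} (hA : A ⊆ {t | S.IsEvent t}) (hb : BddBelow A)
    (hne : A.Nonempty) : IsLeast A (sInf A) := by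
  obtain ⟨a, ha⟩ := hb
  obtain ⟨b, hb⟩ := hne
  have hfin : {t | t ∈ A ∧ t ≤ b}.Finite :=
    (S.finite_events a b).subset fun t ht => ⟨hA ht.1, ha ht.1, ht.2⟩
  obtain ⟨x, hx, hmin⟩ := Set.exists_min_image _ id hfin ⟨b, hb, le_rfl⟩
  have hleast : IsLeast A x := by
    refine ⟨hx.1, fun y hy => ?_⟩
    rcases le_total y b with h | h
    · exact hmin y ⟨hy, h⟩
    · exact hx.2.trans h
  rwa [hleast.csInf_eq]

section Events

variable {S}

theorem exists_event_gt (hS : ∃ i j, S.graph.Adj i j) (a : ℝ) : ∃ t, a < t ∧ S.IsEvent t := by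
  obtain ⟨i, j, hij⟩ := hS
  refine ⟨((⌊a⌋ + 1 : ℤ) : ℝ) + S.phase i j, ?_, (S.isEvent_iff _).2 ⟨i, j, hij, ?_⟩⟩
  · have := Int.lt_floor_add_one a
    have := S.phase_nonneg i j
    push_cast
    linarith
  · rw [Int.fract_intCast_add, fract_phase]

theorem isLeast_eventTime_zero (hS : ∃ i j, S.graph.Adj i j) :
    IsLeast {t : ℝ | 0 ≤ t ∧ S.IsEvent t} (S.eventTime 0) := by
  rw [eventTime]
  obtain ⟨t, h0, ht⟩ := exists_event_gt hS 0
  exact S.isLeast_sInf_events (fun t ht => ht.2) ⟨0, fun t ht => ht.1⟩ ⟨t, h0.le, ht⟩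

theorem isLeast_eventTime_succ (hS : ∃ i j, S.graph.Adj i j) (k : ℕ) :
    IsLeast {t : ℝ | S.eventTime k < t ∧ S.IsEvent t} (S.eventTime (k + 1)) := by
  rw [eventTime]
  exact S.isLeast_sInf_events (fun t ht => ht.2) ⟨S.eventTime k, fun t ht => ht.1.le⟩
    (exists_event_gt hS _)

theorem eventTime_lt_succ (hS : ∃ i j, S.graph.Adj i j) (k : ℕ) :
    S.eventTime k < S.eventTime (k + 1) := (isLeast_eventTime_succ hS k).1.1

theorem eventTime_nonneg (hS : ∃ i j, S.graph.Adj i j) (k : ℕ) : 0 ≤ S.eventTime k := by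
  induction k with
  | zero => exact (isLeast_eventTime_zero hS).1.1
  | succ k ih => exact ih.trans (eventTime_lt_succ hS k).le

theorem isEvent_eventTime (hS : ∃ i j, S.graph.Adj i j) : ∀ k, S.IsEvent (S.eventTime k)
  | 0 => (isLeast_eventTime_zero hS).1.2
  | k + 1 => (isLeast_eventTime_succ hS k).1.2

/-- A missed event at `t` would stay ahead of every `eventTime k`, leaving infinitely many event
times in `[0, t]`. -/
theorem exists_eventTime_eq (hS : ∃ i j, S.graph.Adj i j) {t : ℝ} (h0 : 0 ≤ t)
    (ht : S.IsEvent t) : ∃ k, S.eventTime k = t := by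
  by_contra! hne
  have hlt : ∀ k, S.eventTime k < t := by
    intro k
    induction k with
    | zero => exact lt_of_le_of_ne ((isLeast_eventTime_zero hS).2 ⟨h0, ht⟩) (hne 0)
    | succ k ih => exact lt_of_le_of_ne ((isLeast_eventTime_succ hS k).2 ⟨ih, ht⟩) (hne _)
  have hinj : Function.Injective S.eventTime :=
    (strictMono_nat_of_lt_succ (eventTime_lt_succ hS)).injective
  exact Set.infinite_of_injective_forall_mem hinj
    (fun k => (⟨isEvent_eventTime hS k, eventTime_nonneg hS k, (hlt k).le⟩ :
      S.eventTime k ∈ {t' | S.IsEvent t' ∧ 0 ≤ t' ∧ t' ≤ t})) (S.finite_events 0 t)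

end Events

/-! ### Tokens -/

open Classical in
/-- The trajectory after time `t` of a token that is in trajectory `i` before time `t`; tokens
cross at every link. -/
noncomputable def cross (t : ℝ) (i : Fin n) : Fin n :=
  if h : ∃ j, S.graph.Adj i j ∧ Int.fract t = S.phase i j then h.choose else i

theorem cross_eq {t : ℝ} {i j : Fin n} (h : S.graph.Adj i j) (ht : Int.fract t = S.phase i j) :
    S.cross t i = j := by
  have hex : ∃ j, S.graph.Adj i j ∧ Int.fract t = S.phase i j := ⟨j, h, ht⟩
  rw [cross, dif_pos hex]
  -- Links of one trajectory with equal phases lie in the same interval, so the chosen neighbor is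
  -- the given one.
  refine S.bucket_injective hex.choose_spec.1 h ?_
  rw [bucket, bucket, ← hex.choose_spec.2, ← ht]

theorem cross_eq_self {t : ℝ} {i : Fin n}
    (h : ¬ ∃ j, S.graph.Adj i j ∧ Int.fract t = S.phase i j) : S.cross t i = i := dif_neg h

theorem cross_involutive (t : ℝ) : Function.Involutive (S.cross t) := by
  intro i
  by_cases h : ∃ j, S.graph.Adj i j ∧ Int.fract t = S.phase i j
  · obtain ⟨j, hj, hq⟩ := h
    rw [S.cross_eq hj hq]
    exact S.cross_eq hj.symm (hq.trans (S.phase_comm hj))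
  · rw [S.cross_eq_self h, S.cross_eq_self h]

/-- The trajectory of a token when the `k`-th event time is reached. -/
noncomputable def token : ℕ → Fin n → Fin n
  | 0, u => u
  | k + 1, u => S.cross (S.eventTime k) (token k u)

theorem token_injective (k : ℕ) : Function.Injective (S.token k) := by
  induction k with
  | zero => exact Function.injective_id
  | succ k ih => exact (S.cross_involutive _).injective.comp ih

/-- Tokens `u` and `v` meet at some event time. -/
def Meets (u v : Fin n) : Prop :=
  ∃ k, S.graph.Adj (S.token k u) (S.token k v) ∧
    Int.fract (S.eventTime k) = S.phase (S.token k u) (S.token k v)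

theorem not_meets_self (u : Fin n) : ¬ S.Meets u u := fun ⟨_, h, _⟩ => h.ne rfl

theorem neighborPresent_iff {live : Finset (Fin n)} {k : ℕ} {u j : Fin n}
    (h : S.Arrives live k u j) : S.NeighborPresent live k u j ↔ ∃ v ∈ live, S.loc live k v = j := by
  unfold NeighborPresent
  refine exists_congr fun v => and_congr_right fun _ => and_iff_left ?_
  obtain ⟨hadj, hpos⟩ := h
  exact (S.synchronized _ _ hadj _).1 hpos

/-- The neighbor chosen in `loc` is forced, since a trajectory has at most one link at a given time.
-/
theorem loc_succ_of_arrives {live : Finset (Fin n)} {k : ℕ} {u j : Fin n}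
    (h : S.Arrives live k u j) :
    S.loc live (k + 1) u =
      if ∃ v ∈ live, S.loc live k v = j then S.loc live k u else j := by
  classical
  have huniq : ∀ j', S.Arrives live k u j' → j' = j := by
    rintro j' ⟨h1, h2⟩
    rw [pos_eq_link_iff] at h2
    have h3 := h.2
    rw [pos_eq_link_iff] at h3
    rw [← S.cross_eq h1 h2, ← S.cross_eq h.1 h3]
  rw [loc]
  split_ifs with h1 h2 h2
  · exfalso
    obtain ⟨j', h3, h4⟩ := h1
    obtain rfl := huniq j' h3
    exact h4 ((S.neighborPresent_iff h).2 h2)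
  · exact huniq _ h1.choose_spec.1
  · rfl
  · exact absurd ⟨j, h, fun h3 => h2 ((S.neighborPresent_iff h).1 h3)⟩ h1

theorem loc_succ_of_not_arrives {live : Finset (Fin n)} {k : ℕ} {u : Fin n}
    (h : ¬ ∃ j, S.Arrives live k u j) : S.loc live (k + 1) u = S.loc live k u := by
  classical
  rw [loc]
  exact dif_neg fun ⟨j, h1, _⟩ => h ⟨j, h1⟩

/-- The live robots occupy the same trajectories as the live tokens. -/
theorem image_loc (live : Finset (Fin n)) (k : ℕ) :
    live.image (S.loc live k) = live.image (S.token k) := by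
  classical
  induction k with
  | zero => rfl
  | succ k ih =>
    have hinj : Set.InjOn (S.loc live k) live := by
      rw [← Finset.card_image_iff, ih, Finset.card_image_of_injective _ (S.token_injective k)]
    have hsub : live.image (S.token (k + 1)) ⊆ live.image (S.loc live (k + 1)) := by
      intro j hj
      obtain ⟨u, hu, rfl⟩ := Finset.mem_image.1 hj
      obtain ⟨v, hv, hvu⟩ := Finset.mem_image.1 (ih ▸ Finset.mem_image_of_mem (S.token k) hu :
        S.token k u ∈ live.image (S.loc live k))
      rw [token, ← hvu]
      by_cases ha : ∃ j, S.Arrives live k v j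
      · obtain ⟨j, ha⟩ := ha
        have hc : S.cross (S.eventTime k) (S.loc live k v) = j :=
          S.cross_eq ha.1 ((S.pos_eq_link_iff _ _ _).1 ha.2)
        rw [hc]
        -- If `j` is occupied by a robot `w`, then `w` stays there and covers the destination of the
        -- crossing token; otherwise `v` itself shifts to `j`.
        by_cases hp : ∃ w ∈ live, S.loc live k w = j
        · obtain ⟨w, hw, hwj⟩ := hp
          refine Finset.mem_image.2 ⟨w, hw, ?_⟩
          have ha' : S.Arrives live k w (S.loc live k v) := by
            refine ⟨hwj ▸ ha.1.symm, ?_⟩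
            rw [hwj]
            exact (S.synchronized _ _ ha.1 _).1 ha.2
          rw [S.loc_succ_of_arrives ha', if_pos ⟨v, hv, rfl⟩, hwj]
        · refine Finset.mem_image.2 ⟨v, hv, ?_⟩
          rw [S.loc_succ_of_arrives ha, if_neg hp]
      · refine Finset.mem_image.2 ⟨v, hv, ?_⟩
        rw [S.loc_succ_of_not_arrives ha, S.cross_eq_self]
        rintro ⟨j, h1, h2⟩
        exact ha ⟨j, h1, (S.pos_eq_link_iff _ _ _).2 h2⟩
    -- The tokens, being in distinct trajectories, already fill as many trajectories as there are
    -- live robots, so the inclusion is an equality.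
    refine (Finset.eq_of_subset_of_card_le hsub ?_).symm
    rw [Finset.card_image_of_injective _ (S.token_injective _)]
    exact Finset.card_image_le

theorem exists_loc_eq_iff (live : Finset (Fin n)) (k : ℕ) (j : Fin n) :
    (∃ v ∈ live, S.loc live k v = j) ↔ ∃ v ∈ live, S.token k v = j := by
  classical
  have h := S.image_loc live k
  rw [Finset.ext_iff] at h
  simpa using h j

/-- As long as `u` has found no neighbor, it has shifted at every link and is where its token is. By
`image_loc`, a robot opposite to it is present iff a live token is. -/
theorem starves_iff {live : Finset (Fin n)} {u : Fin n} :
    S.Starves live u ↔ ∀ v ∈ live, ¬ S.Meets u v := by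
  classical
  have step : ∀ k, S.loc live k u = S.token k u →
      (∀ j, S.Arrives live k u j → ¬ S.NeighborPresent live k u j) →
      S.loc live (k + 1) u = S.token (k + 1) u := by
    intro k hk hn
    rw [token, ← hk]
    by_cases ha : ∃ j, S.Arrives live k u j
    · obtain ⟨j, ha⟩ := ha
      rw [S.loc_succ_of_arrives ha, if_neg, S.cross_eq ha.1 ((S.pos_eq_link_iff _ _ _).1 ha.2)]
      rw [← S.neighborPresent_iff ha]
      exact hn j ha
    · rw [S.loc_succ_of_not_arrives ha, S.cross_eq_self]
      rintro ⟨j, h1, h2⟩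
      exact ha ⟨j, h1, (S.pos_eq_link_iff _ _ _).2 h2⟩
  constructor
  · intro hs v hv ⟨k, hadj, hph⟩
    have hk : ∀ k, S.loc live k u = S.token k u := by
      intro k
      induction k with
      | zero => rfl
      | succ k ih => exact step k ih (hs k)
    have ha : S.Arrives live k u (S.token k v) := by
      rw [Arrives, hk, pos_eq_link_iff]
      exact ⟨hadj, hph⟩
    refine hs k _ ha ?_
    rw [S.neighborPresent_iff ha, exists_loc_eq_iff]
    exact ⟨v, hv, rfl⟩
  · intro hm
    have hn : ∀ k, S.loc live k u = S.token k u →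
        ∀ j, S.Arrives live k u j → ¬ S.NeighborPresent live k u j := by
      intro k hk j ha hp
      rw [S.neighborPresent_iff ha, exists_loc_eq_iff] at hp
      obtain ⟨v, hv, rfl⟩ := hp
      rw [Arrives, hk, pos_eq_link_iff] at ha
      exact hm v hv ⟨k, ha⟩
    have hk : ∀ k, S.loc live k u = S.token k u := by
      intro k
      induction k with
      | zero => rfl
      | succ k ih => exact step k ih (hn k ih)
    exact fun k => hn k (hk k)

/-- Removing exactly the tokens that meet a minimizing `u` starves `u`, which survives since no
token meets itself. Conversely, a starving survivor has had all the tokens that meet it removed. -/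
theorem kResilience_one_eq {r : ℕ} (h1 : ∃ u, {v | S.Meets u v}.ncard = r)
    (h2 : ∀ u, r ≤ {v | S.Meets u v}.ncard) : S.kResilience 1 = r := by
  classical
  refine le_antisymm ?_ ?_
  · obtain ⟨u, hu⟩ := h1
    have hc : (Finset.univ.filter fun v => S.Meets u v).card = r := by
      rw [← hu, Set.ncard_eq_toFinset_card', Set.toFinset_ofPred]
    rw [← hc]
    refine iInf₂_le (Finset.univ.filter fun v => S.Meets u v) ?_
    rw [Nat.one_le_iff_ne_zero, ← Nat.pos_iff_ne_zero, Set.ncard_pos]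
    refine ⟨u, ?_, ?_⟩
    · simpa using S.not_meets_self u
    · rw [starves_iff]
      simp
  · refine le_iInf₂ fun removed hr => ?_
    rw [Nat.one_le_iff_ne_zero, ← Nat.pos_iff_ne_zero, Set.ncard_pos] at hr
    obtain ⟨u, -, hs⟩ := hr
    rw [starves_iff] at hs
    have hsub : {v | S.Meets u v} ⊆ (removed : Set (Fin n)) := by
      intro v hv
      by_contra hvr
      exact hs v (Finset.mem_compl.2 hvr) hv
    have := Set.ncard_le_ncard hsub
    rw [Set.ncard_coe_finset] at this
    exact_mod_cast (h2 u).trans this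

/-! ### Tokens in rounds -/

open Classical in
/-- The position at time `t`, in the interval number `R`, of token `u`. -/
noncomputable def posIn (R : ℕ) (t : ℝ) (u : Fin n) : Fin n :=
  if ∃ j, S.graph.Adj (S.rpos R u) j ∧ S.bucket (S.rpos R u) j = R % 16 ∧
      ((R / 16 : ℕ) : ℝ) + S.phase (S.rpos R u) j < t
  then S.rpos (R + 1) u else S.rpos R u

theorem div_add_mod_real (R : ℕ) : (R : ℝ) = 16 * ((R / 16 : ℕ) : ℝ) + ((R % 16 : ℕ) : ℝ) := by
  exact_mod_cast (Nat.div_add_mod R 16).symm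

theorem posIn_of_le {R : ℕ} {t : ℝ} (h : 16 * t ≤ R) (u : Fin n) : S.posIn R t u = S.rpos R u := by
  refine if_neg ?_
  rintro ⟨j, -, hb, hlt⟩
  have := S.bucket_le_phase (S.rpos R u) j
  rw [hb] at this
  have := div_add_mod_real R
  linarith

theorem posIn_of_ge {R : ℕ} {t : ℝ} (h : (R : ℝ) + 1 ≤ 16 * t) (u : Fin n) :
    S.posIn R t u = S.rpos (R + 1) u := by
  by_cases hc : ∃ j, S.graph.Adj (S.rpos R u) j ∧ S.bucket (S.rpos R u) j = R % 16
  · obtain ⟨j, hj, hb⟩ := hc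
    refine if_pos ⟨j, hj, hb, ?_⟩
    have := S.phase_lt_bucket (S.rpos R u) j
    rw [hb] at this
    have := div_add_mod_real R
    linarith
  · rw [rpos_succ_apply, S.round_eq_self hc]
    refine if_neg ?_
    rintro ⟨j, hj, hb, -⟩
    exact hc ⟨j, hj, hb⟩

/-- The strict inequality in `posIn` makes it the position just before time `t`, so only crossings
at times in `[a, b)` matter. -/
theorem posIn_congr {R : ℕ} {a b : ℝ} (hab : a ≤ b)
    (hev : ∀ t, S.IsEvent t → a ≤ t → t < b → False) (u : Fin n) :
    S.posIn R a u = S.posIn R b u := by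
  unfold posIn
  congr 1
  refine propext (exists_congr fun j => and_congr_right fun hj => and_congr_right fun _ =>
    ⟨fun h => h.trans_le hab, fun h => ?_⟩)
  by_contra hn
  refine hev _ ((S.isEvent_iff _).2 ⟨_, _, hj, ?_⟩) (not_lt.1 hn) h
  rw [Int.fract_natCast_add, fract_phase]

/-- The position at time `t` of token `u`. -/
noncomputable def posAt (t : ℝ) (u : Fin n) : Fin n := S.posIn ⌊16 * t⌋₊ t u

/-- On the boundary `16 * t = R + 1` the two descriptions agree: interval `R` has made all its
crossings and interval `R + 1` none. -/
theorem posAt_eq_posIn {R : ℕ} {t : ℝ} (h1 : (R : ℝ) ≤ 16 * t) (h2 : 16 * t ≤ R + 1) (u : Fin n) :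
    S.posAt t u = S.posIn R t u := by
  rcases h2.lt_or_eq with h | h
  · rw [posAt, (Nat.floor_eq_iff ((Nat.cast_nonneg R).trans h1)).2 ⟨h1, h⟩]
  · rw [posAt, S.posIn_of_ge h.ge, show 16 * t = ((R + 1 : ℕ) : ℝ) by rw [h]; push_cast; rfl,
      Nat.floor_natCast, S.posIn_of_le (by rw [h]; push_cast; rfl)]

theorem posAt_congr {a b : ℝ} (h0 : 0 ≤ a) (hab : a ≤ b)
    (hev : ∀ t, S.IsEvent t → a ≤ t → t < b → False) (u : Fin n) :
    S.posAt a u = S.posAt b u := by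
  -- Induction on the number of interval boundaries between `a` and `b`; the point `c` below is the
  -- first of them.
  obtain ⟨j, hj⟩ : ∃ j, ⌊16 * b⌋₊ = ⌊16 * a⌋₊ + j :=
    Nat.exists_eq_add_of_le (Nat.floor_le_floor (by linarith))
  induction j generalizing a with
  | zero =>
    rw [posAt, posAt, hj]
    exact S.posIn_congr hab hev u
  | succ j ih =>
    have h1 := Nat.floor_le (by linarith : (0 : ℝ) ≤ 16 * a)
    have h2 := Nat.lt_floor_add_one (16 * a)
    have h3 := Nat.floor_le (by linarith : (0 : ℝ) ≤ 16 * b)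
    rw [hj] at h3
    set R := ⌊16 * a⌋₊ with hR
    push_cast at h3
    have hjn : (0 : ℝ) ≤ j := Nat.cast_nonneg j
    obtain ⟨c, hc⟩ : ∃ c : ℝ, 16 * c = R + 1 := ⟨(R + 1) / 16, by ring⟩
    have hac : S.posAt a u = S.posAt c u := by
      rw [S.posAt_eq_posIn (R := R) h1 h2.le, S.posAt_eq_posIn (R := R) (by linarith) hc.le]
      exact S.posIn_congr (by linarith) (fun t ht hat htc => hev t ht hat (by linarith)) u
    rw [hac]
    have hfc : ⌊16 * c⌋₊ = R + 1 := by
      rw [hc, show (R : ℝ) + 1 = ((R + 1 : ℕ) : ℝ) by push_cast; rfl, Nat.floor_natCast]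
    exact ih (by linarith) (by linarith)
      (fun t ht hat htc => hev t ht (by linarith) htc) (by omega)

theorem floor_fract {t : ℝ} (h0 : 0 ≤ t) : ⌊16 * Int.fract t⌋₊ = ⌊16 * t⌋₊ % 16 ∧
    (((⌊16 * t⌋₊ / 16 : ℕ)) : ℝ) + Int.fract t = t := by
  have hf := Int.floor_add_fract t
  obtain ⟨m, hm⟩ := Int.eq_ofNat_of_zero_le (Int.floor_nonneg.2 h0)
  rw [hm] at hf
  have hfr := Int.fract_nonneg t
  have hfl := Int.fract_lt_one t
  have hlt : ⌊16 * Int.fract t⌋₊ < 16 := by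
    rw [Nat.floor_lt (by linarith)]
    push_cast
    linarith
  have h16 : ⌊16 * t⌋₊ = ⌊16 * Int.fract t⌋₊ + 16 * m := by
    rw [← Nat.floor_add_natCast (by linarith)]
    congr 1
    push_cast at hf ⊢
    linarith
  rw [h16]
  refine ⟨by omega, ?_⟩
  rw [show (⌊16 * Int.fract t⌋₊ + 16 * m) / 16 = m by omega]
  exact_mod_cast hf

theorem bucket_of_fract {t : ℝ} (h0 : 0 ≤ t) {i j : Fin n} (h : Int.fract t = S.phase i j) :
    S.bucket i j = ⌊16 * t⌋₊ % 16 := by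
  rw [bucket, ← h, (floor_fract h0).1]

/-- The only link of `i` in this interval is the one at time `t` itself, so no token can have
entered or left `i` between the start of the interval and `t`. This replaces exact times by round
numbers. -/
theorem posAt_eq_iff {t : ℝ} (h0 : 0 ≤ t) {i j u : Fin n} (hij : S.graph.Adj i j)
    (h : Int.fract t = S.phase i j) : S.posAt t u = i ↔ S.rpos ⌊16 * t⌋₊ u = i := by
  have hb := S.bucket_of_fract h0 h
  have hf := (floor_fract h0).2
  unfold posAt posIn
  set R := ⌊16 * t⌋₊
  split_ifs with hc
  · obtain ⟨k, hk, hkb, hlt⟩ := hc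
    have hround : S.rpos (R + 1) u = k := S.round_eq hk hkb
    rw [hround]
    constructor
    · rintro rfl
      have : j = S.rpos R u :=
        S.bucket_injective hij hk.symm (by rw [hb, S.bucket_comm hk.symm, hkb])
      subst this
      rw [S.phase_comm hk, ← h] at hlt
      linarith
    · intro hi
      rw [hi] at hk hkb hlt
      have : k = j := S.bucket_injective hk hij (by rw [hb, hkb])
      subst this
      rw [← h] at hlt
      linarith
  · rfl

theorem cross_posAt {a b : ℝ} (h0 : 0 ≤ a) (hab : a < b)
    (hev : ∀ t, S.IsEvent t → a < t → t < b → False) (u : Fin n) :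
    S.cross a (S.posAt a u) = S.posAt b u := by
  have h1 := Nat.floor_le (by linarith : (0 : ℝ) ≤ 16 * a)
  have h2 := Nat.lt_floor_add_one (16 * a)
  have hf := floor_fract h0
  have hbf : ∀ i j, Int.fract a = S.phase i j → S.bucket i j = ⌊16 * a⌋₊ % 16 :=
    fun i j h => S.bucket_of_fract h0 h
  -- The point `c` is `b`, cut off at the end of the interval of `a`; nothing happens from `c` to
  -- `b`, so one interval is enough.
  obtain ⟨c, hac, hcb, hcR, hcu⟩ : ∃ c, a < c ∧ c ≤ b ∧ 16 * c ≤ ⌊16 * a⌋₊ + 1 ∧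
      S.posAt b u = S.posIn ⌊16 * a⌋₊ c u := by
    rcases le_total (16 * b) (⌊16 * a⌋₊ + 1) with h | h
    · exact ⟨b, hab, le_rfl, h, S.posAt_eq_posIn (by linarith) h u⟩
    · refine ⟨(⌊16 * a⌋₊ + 1) / 16, by linarith, by linarith, by linarith, ?_⟩
      rw [← S.posAt_eq_posIn (by linarith) (by linarith)]
      exact (S.posAt_congr (by linarith) (by linarith)
        (fun t ht h3 h4 => hev t ht (by linarith) h4) u).symm
  rw [hcu, posAt]
  set R := ⌊16 * a⌋₊
  by_cases hc : ∃ j, S.graph.Adj (S.rpos R u) j ∧ S.bucket (S.rpos R u) j = R % 16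
  · obtain ⟨j, hj, hb⟩ := hc
    have hround : S.rpos (R + 1) u = j := S.round_eq hj hb
    have huniq : ∀ k, S.graph.Adj (S.rpos R u) k → S.bucket (S.rpos R u) k = R % 16 → k = j :=
      fun k hk hkb => S.bucket_injective hk hj (hkb.trans hb.symm)
    have hval : ∀ t, S.posIn R t u =
        if ((R / 16 : ℕ) : ℝ) + S.phase (S.rpos R u) j < t then j else S.rpos R u := by
      intro t
      rw [posIn, hround]
      congr 1
      refine propext ⟨?_, fun h => ⟨j, hj, hb, h⟩⟩
      rintro ⟨k, hk, hkb, hlt⟩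
      rwa [huniq k hk hkb] at hlt
    rw [hval, hval]
    -- The token's only crossing in this interval lies before `a`, at `a` or after `a`; in the last
    -- case it is not before `c`, since there is no event between `a` and `b`.
    rcases lt_trichotomy (((R / 16 : ℕ) : ℝ) + S.phase (S.rpos R u) j) a with h | h | h
    · rw [if_pos h, if_pos (h.trans hac)]
      refine S.cross_eq_self ?_
      rintro ⟨k, hk, hph⟩
      have : k = S.rpos R u :=
        S.bucket_injective hk hj.symm (by rw [hbf _ _ hph, S.bucket_comm hj.symm, hb])
      subst this
      rw [S.phase_comm hj, ← hph] at h
      linarith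
    · rw [if_neg h.not_lt, if_pos (h.trans_lt hac)]
      exact S.cross_eq hj (by linarith)
    · rw [if_neg h.not_gt, if_neg]
      · refine S.cross_eq_self ?_
        rintro ⟨k, hk, hph⟩
        rw [huniq k hk (hbf _ _ hph)] at hph
        rw [← hph] at h
        linarith
      · intro h3
        refine hev _ ((S.isEvent_iff _).2 ⟨_, _, hj, ?_⟩) h (h3.trans_le hcb)
        rw [Int.fract_natCast_add, fract_phase]
  · have hval : ∀ t, S.posIn R t u = S.rpos R u := fun t =>
      if_neg fun ⟨k, hk, hkb, _⟩ => hc ⟨k, hk, hkb⟩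
    rw [hval, hval]
    refine S.cross_eq_self ?_
    rintro ⟨k, hk, hph⟩
    exact hc ⟨k, hk, hbf _ _ hph⟩

theorem token_eq_posAt (hS : ∃ i j, S.graph.Adj i j) (k : ℕ) (u : Fin n) :
    S.token k u = S.posAt (S.eventTime k) u := by
  induction k with
  | zero =>
    have h0 : S.posAt 0 u = u := by simp [posAt, S.posIn_of_le (R := 0) (t := 0) (by simp), rpos]
    rw [token]
    conv_lhs => rw [← h0]
    refine S.posAt_congr le_rfl (eventTime_nonneg hS 0) (fun t ht h1 h2 => ?_) u
    exact absurd ((isLeast_eventTime_zero hS).2 ⟨h1, ht⟩) h2.not_ge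
  | succ k ih =>
    rw [token, ih]
    refine S.cross_posAt (eventTime_nonneg hS k) (eventTime_lt_succ hS k) (fun t ht h1 h2 => ?_) u
    exact absurd ((isLeast_eventTime_succ hS k).2 ⟨h1, ht⟩) h2.not_ge

/-- An event at link `i j` takes place at time `m + S.phase i j`, in round number `16 * m + S.bucket
i j`; the first `16 * m` rounds amount to `period ^ m`. -/
theorem meets_iff (u v : Fin n) : S.Meets u v ↔ ∃ m i j, S.graph.Adj i j ∧
    S.rpos (S.bucket i j) ((S.period ^ m) u) = i ∧
    S.rpos (S.bucket i j) ((S.period ^ m) v) = j := by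
  have key : ∀ (R : ℕ) (u : Fin n),
      S.rpos R u = S.rpos (R % 16) ((S.period ^ (R / 16)) u) := by
    intro R u
    conv_lhs => rw [← Nat.div_add_mod R 16, rpos_add, rpos_mul]
    rfl
  constructor
  · rintro ⟨k, hadj, hph⟩
    have hS : ∃ i j, S.graph.Adj i j := ⟨_, _, hadj⟩
    have h0 := eventTime_nonneg hS k
    have hu := (S.posAt_eq_iff (u := u) h0 hadj hph).1 (S.token_eq_posAt hS k u).symm
    have hv := (S.posAt_eq_iff (u := v) h0 hadj.symm (hph.trans (S.phase_comm hadj))).1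
      (S.token_eq_posAt hS k v).symm
    rw [key] at hu hv
    refine ⟨⌊16 * S.eventTime k⌋₊ / 16, _, _, hadj, ?_, ?_⟩
    · rw [S.bucket_of_fract h0 hph]
      exact hu
    · rw [S.bucket_of_fract h0 hph]
      exact hv
  · rintro ⟨m, i, j, hij, hu, hv⟩
    have hS : ∃ i j, S.graph.Adj i j := ⟨_, _, hij⟩
    have hfr : Int.fract ((m : ℝ) + S.phase i j) = S.phase i j := by
      rw [Int.fract_natCast_add, fract_phase]
    have h0 : 0 ≤ (m : ℝ) + S.phase i j := by
      have := S.phase_nonneg i j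
      positivity
    obtain ⟨k, hk⟩ := exists_eventTime_eq hS h0 ((S.isEvent_iff _).2 ⟨i, j, hij, hfr⟩)
    have hfl : ⌊16 * ((m : ℝ) + S.phase i j)⌋₊ = 16 * m + S.bucket i j := by
      rw [mul_add, bucket, show (16 : ℝ) * m = ((16 * m : ℕ) : ℝ) by push_cast; rfl, add_comm,
        Nat.floor_add_natCast (by have := S.phase_nonneg i j; positivity), add_comm]
    have htu : S.token k u = i := by
      rw [S.token_eq_posAt hS, hk, S.posAt_eq_iff h0 hij hfr, hfl, rpos_add, rpos_mul]
      exact hu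
    have htv : S.token k v = j := by
      rw [S.token_eq_posAt hS, hk, S.posAt_eq_iff h0 hij.symm (hfr.trans (S.phase_comm hij)), hfl,
        rpos_add, rpos_mul]
      exact hv
    refine ⟨k, ?_, ?_⟩
    · rwa [htu, htv]
    · rw [htu, htv, hk, hfr]

end SCS

/-! ### Orbits of pairs under a permutation -/

namespace Equiv.Perm

variable {n : ℕ} (σ : Equiv.Perm (Fin n))

open Classical in
/-- The smallest element of the cycle of `x`. -/
noncomputable def lead (x : Fin n) : Fin n :=
  (Finset.univ.filter fun y => σ.SameCycle x y).min' ⟨x, by simp [SameCycle.rfl]⟩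

theorem sameCycle_lead (x : Fin n) : σ.SameCycle x (σ.lead x) := by
  classical
  have := Finset.min'_mem (Finset.univ.filter fun y => σ.SameCycle x y) ⟨x, by simp [SameCycle.rfl]⟩
  exact (Finset.mem_filter.1 this).2

theorem lead_le {x y : Fin n} (h : σ.SameCycle x y) : σ.lead x ≤ y := by
  classical
  exact Finset.min'_le _ _ (by simpa using h)

theorem lead_eq_lead_iff {x y : Fin n} : σ.lead x = σ.lead y ↔ σ.SameCycle x y := by
  constructor
  · intro h
    exact (σ.sameCycle_lead x).trans (h ▸ (σ.sameCycle_lead y).symm)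
  · intro h
    exact le_antisymm (σ.lead_le (h.trans (σ.sameCycle_lead y)))
      (σ.lead_le (h.symm.trans (σ.sameCycle_lead x)))

theorem lead_lead (x : Fin n) : σ.lead (σ.lead x) = σ.lead x :=
  σ.lead_eq_lead_iff.2 (σ.sameCycle_lead x).symm

theorem lead_pow_apply (m : ℕ) (x : Fin n) : σ.lead ((σ ^ m) x) = σ.lead x :=
  σ.lead_eq_lead_iff.2 (sameCycle_pow_left.2 SameCycle.rfl)

/-- The length of the cycle of `x`. -/
noncomputable def cycleLen (x : Fin n) : ℕ := Function.minimalPeriod σ x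

theorem cycleLen_le (x : Fin n) : σ.cycleLen x ≤ n := by
  simpa [cycleLen] using Function.minimalPeriod_le_card (f := σ) (x := x)

theorem cycleLen_pos (x : Fin n) : 0 < σ.cycleLen x :=
  Function.minimalPeriod_pos_of_mem_periodicPts (Function.Injective.mem_periodicPts σ.injective x)

theorem pow_apply_eq_pow_apply_iff (a b : ℕ) (x : Fin n) :
    (σ ^ a) x = (σ ^ b) x ↔ a ≡ b [MOD σ.cycleLen x] := by
  rw [← iterate_eq_pow, ← iterate_eq_pow, ← Function.iterate_mod_minimalPeriod_eq,
    ← Function.iterate_mod_minimalPeriod_eq (n := b)]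
  exact Function.iterate_eq_iterate_iff_of_lt_minimalPeriod (Nat.mod_lt _ (σ.cycleLen_pos x))
    (Nat.mod_lt _ (σ.cycleLen_pos x))

theorem exists_pow_lead (x : Fin n) : ∃ k : ℕ, (σ ^ k) (σ.lead x) = x :=
  (σ.sameCycle_lead x).symm.exists_nat_pow_eq

open Classical in
/-- The number of steps from `σ.lead x` to `x`. -/
noncomputable def cycleIdx (x : Fin n) : ℕ := Nat.find (σ.exists_pow_lead x)

theorem pow_cycleIdx (x : Fin n) : (σ ^ σ.cycleIdx x) (σ.lead x) = x := by
  classical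
  exact Nat.find_spec (σ.exists_pow_lead x)

theorem pow_lead_eq_iff (k : ℕ) (x : Fin n) :
    (σ ^ k) (σ.lead x) = x ↔ k ≡ σ.cycleIdx x [MOD σ.cycleLen (σ.lead x)] := by
  rw [← pow_apply_eq_pow_apply_iff, pow_cycleIdx]

theorem cycleIdx_lt (x : Fin n) : σ.cycleIdx x < σ.cycleLen (σ.lead x) := by
  classical
  have h : (σ ^ (σ.cycleIdx x % σ.cycleLen (σ.lead x))) (σ.lead x) = x :=
    (σ.pow_lead_eq_iff _ x).2 (Nat.mod_modEq _ _)
  exact (Nat.find_min' (σ.exists_pow_lead x) h).trans_lt (Nat.mod_lt _ (σ.cycleLen_pos _))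

theorem cycleIdx_pow_lead {k : ℕ} {x : Fin n} (hx : σ.lead x = x) (hk : k < σ.cycleLen x) :
    σ.cycleIdx ((σ ^ k) x) = k := by
  have h1 : σ.lead ((σ ^ k) x) = x := by rw [lead_pow_apply, hx]
  have h2 := (σ.pow_lead_eq_iff k ((σ ^ k) x)).1 (by rw [h1])
  have h3 := σ.cycleIdx_lt ((σ ^ k) x)
  rw [h1] at h2 h3
  exact (h2.eq_of_lt_of_lt hk h3).symm

theorem cycleIdx_pow (m : ℕ) (x : Fin n) :
    σ.cycleIdx ((σ ^ m) x) ≡ σ.cycleIdx x + m [MOD σ.cycleLen (σ.lead x)] := by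
  have h := (σ.pow_lead_eq_iff (m + σ.cycleIdx x) ((σ ^ m) x)).1
    (by rw [lead_pow_apply, pow_add, mul_apply, pow_cycleIdx])
  rw [lead_pow_apply] at h
  rw [add_comm] at h
  exact h.symm

theorem eq_of_cycleIdx_modEq {x y : Fin n} (h : σ.lead x = σ.lead y)
    (hi : σ.cycleIdx x ≡ σ.cycleIdx y [MOD σ.cycleLen (σ.lead y)]) : x = y := by
  rw [← σ.pow_cycleIdx x, h]
  exact (σ.pow_lead_eq_iff _ y).2 hi

/-- The greatest common divisor of the lengths of the cycles of `x` and `y`. -/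
noncomputable def lenGcd (x y : Fin n) : ℕ :=
  Nat.gcd (σ.cycleLen (σ.lead x)) (σ.cycleLen (σ.lead y))

theorem lenGcd_pos (x y : Fin n) : 0 < σ.lenGcd x y :=
  Nat.gcd_pos_of_pos_left _ (σ.cycleLen_pos _)

/-- The shift between `x` and `y`, modulo `σ.lenGcd x y`. -/
noncomputable def shift (x y : Fin n) : ℕ :=
  (σ.cycleIdx y + σ.cycleLen (σ.lead x) - σ.cycleIdx x) % σ.lenGcd x y

theorem shift_lt (x y : Fin n) : σ.shift x y < σ.lenGcd x y := Nat.mod_lt _ (σ.lenGcd_pos x y)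

theorem shift_modEq (x y : Fin n) :
    σ.shift x y + σ.cycleIdx x ≡ σ.cycleIdx y [MOD σ.lenGcd x y] := by
  have h := (Nat.mod_modEq (σ.cycleIdx y + σ.cycleLen (σ.lead x) - σ.cycleIdx x)
    (σ.lenGcd x y)).add_right (σ.cycleIdx x)
  rw [Nat.sub_add_cancel (by have := σ.cycleIdx_lt x; omega)] at h
  refine h.trans ?_
  have h2 : σ.cycleLen (σ.lead x) ≡ 0 [MOD σ.lenGcd x y] :=
    Nat.modEq_zero_iff_dvd.2 (Nat.gcd_dvd_left _ _)
  simpa using h2.add_left (σ.cycleIdx y)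

/-- The orbit of the pair `(x, y)` is determined by the cycles of `x` and `y` and by the shift. -/
noncomputable def pairKey (p : Fin n × Fin n) : Fin n × Fin n × ℕ :=
  (σ.lead p.1, σ.lead p.2, σ.shift p.1 p.2)

theorem shift_eq_iff {x y : Fin n} {r : ℕ} (hr : r < σ.lenGcd x y) :
    σ.shift x y = r ↔ r + σ.cycleIdx x ≡ σ.cycleIdx y [MOD σ.lenGcd x y] := by
  constructor
  · rintro rfl
    exact σ.shift_modEq x y
  · intro h
    exact Nat.ModEq.eq_of_lt_of_lt
      (Nat.ModEq.add_right_cancel' _ ((σ.shift_modEq x y).trans h.symm)) (σ.shift_lt x y) hr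

/-- Both indices advance by `m` modulo their own cycle lengths, hence modulo the gcd, where the
difference is unchanged. -/
theorem pairKey_pow (m : ℕ) (x y : Fin n) :
    σ.pairKey ((σ ^ m) x, (σ ^ m) y) = σ.pairKey (x, y) := by
  have hg : σ.lenGcd ((σ ^ m) x) ((σ ^ m) y) = σ.lenGcd x y := by
    simp [lenGcd, lead_pow_apply]
  simp only [pairKey, lead_pow_apply, Prod.mk.injEq, true_and]
  rw [shift_eq_iff _ (by rw [hg]; exact σ.shift_lt x y), hg]
  have h1 := (σ.cycleIdx_pow m x).of_dvd (Nat.gcd_dvd_left _ (σ.cycleLen (σ.lead y)))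
  have h2 := (σ.cycleIdx_pow m y).of_dvd (Nat.gcd_dvd_right (σ.cycleLen (σ.lead x)) _)
  have h3 := (σ.shift_modEq x y).add_right m
  rw [add_assoc] at h3
  exact ((h1.add_left _).trans h3).trans h2.symm

/-- Reaching `a` from `u` and reaching `b` from `v` prescribe `m` modulo the two cycle lengths.
Equality of the shifts is the compatibility modulo the gcd that the Chinese remainder theorem
requires. -/
theorem exists_pow_eq_iff (u v a b : Fin n) :
    (∃ m : ℕ, (σ ^ m) u = a ∧ (σ ^ m) v = b) ↔ σ.pairKey (u, v) = σ.pairKey (a, b) := by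
  constructor
  · rintro ⟨m, rfl, rfl⟩
    exact (σ.pairKey_pow m u v).symm
  · intro h
    simp only [pairKey, Prod.mk.injEq] at h
    obtain ⟨hu, hv, hs⟩ := h
    have hg : σ.lenGcd u v = σ.lenGcd a b := by rw [lenGcd, lenGcd, hu, hv]
    have key : ∀ u a : Fin n, σ.lead u = σ.lead a → ∀ m : ℕ,
        σ.cycleIdx u + m ≡ σ.cycleIdx a [MOD σ.cycleLen (σ.lead a)] → (σ ^ m) u = a := by
      intro u a h m hm
      refine σ.eq_of_cycleIdx_modEq (by rw [lead_pow_apply, h]) ?_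
      have := σ.cycleIdx_pow m u
      rw [h] at this
      exact this.trans hm
    have hlu := σ.cycleIdx_lt u
    have hlv := σ.cycleIdx_lt v
    rw [hu] at hlu
    rw [hv] at hlv
    -- Numbers of steps that lead `u` to `a` and `v` to `b`; the added cycle lengths keep the
    -- truncated subtractions exact.
    set p := σ.cycleIdx a + σ.cycleLen (σ.lead a) - σ.cycleIdx u with hp
    set q := σ.cycleIdx b + σ.cycleLen (σ.lead b) - σ.cycleIdx v with hq
    have hp' : σ.cycleIdx u + p = σ.cycleIdx a + σ.cycleLen (σ.lead a) := by omega
    have hq' : σ.cycleIdx v + q = σ.cycleIdx b + σ.cycleLen (σ.lead b) := by omega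
    have hp2 : σ.cycleIdx u + p ≡ σ.cycleIdx a [MOD σ.cycleLen (σ.lead a)] := by
      rw [hp']
      simp [Nat.ModEq]
    have hq2 : σ.cycleIdx v + q ≡ σ.cycleIdx b [MOD σ.cycleLen (σ.lead b)] := by
      rw [hq']
      simp [Nat.ModEq]
    have hpg := hp2.of_dvd (Nat.gcd_dvd_left _ (σ.cycleLen (σ.lead b)))
    have hqg := hq2.of_dvd (Nat.gcd_dvd_right (σ.cycleLen (σ.lead a)) _)
    have h1 := σ.shift_modEq u v
    rw [hg, hs] at h1
    have h2 := σ.shift_modEq a b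
    have hpq : p ≡ q [MOD σ.lenGcd a b] := by
      refine Nat.ModEq.add_left_cancel' (σ.shift a b + σ.cycleIdx u) ?_
      calc σ.shift a b + σ.cycleIdx u + p ≡ σ.shift a b + σ.cycleIdx a [MOD σ.lenGcd a b] := by
            rw [add_assoc]
            exact hpg.add_left _
        _ ≡ σ.cycleIdx b [MOD σ.lenGcd a b] := h2
        _ ≡ σ.cycleIdx v + q [MOD σ.lenGcd a b] := hqg.symm
        _ ≡ σ.shift a b + σ.cycleIdx u + q [MOD σ.lenGcd a b] := (h1.symm.add_right q)
    obtain ⟨m, hm1, hm2⟩ := Nat.chineseRemainder' hpq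
    exact ⟨m, key u a hu m ((hm1.add_left _).trans hp2), key v b hv m ((hm2.add_left _).trans hq2)⟩

/-- The number of `y` such that `(x, y)` has the given key, for every `x` in the first cycle. -/
noncomputable def keyWeight (κ : Fin n × Fin n × ℕ) : ℕ :=
  σ.cycleLen κ.2.1 / Nat.gcd (σ.cycleLen κ.1) (σ.cycleLen κ.2.1)

/-- The key confines `v` to the cycle of `b` and its index to one residue class modulo the gcd. The
gcd divides the length of that cycle, so the class is hit exactly length / gcd times. -/
theorem card_pairKey_eq (u a b : Fin n) (h : σ.lead a = σ.lead u) :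
    (Finset.univ.filter fun v => σ.pairKey (u, v) = σ.pairKey (a, b)).card =
      σ.keyWeight (σ.pairKey (a, b)) := by
  have hg : ∀ v, σ.lead v = σ.lead b → σ.lenGcd u v = σ.lenGcd a b := by
    intro v hv
    rw [lenGcd, lenGcd, h, hv]
  have hmem : ∀ v, σ.pairKey (u, v) = σ.pairKey (a, b) ↔ σ.lead v = σ.lead b ∧
      σ.cycleIdx v ≡ σ.shift a b + σ.cycleIdx u [MOD σ.lenGcd a b] := by
    intro v
    simp only [pairKey, Prod.mk.injEq, h, true_and]
    refine and_congr_right fun hv => ?_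
    rw [shift_eq_iff _ (by rw [hg v hv]; exact σ.shift_lt a b), hg v hv]
    exact ⟨fun h => h.symm, fun h => h.symm⟩
  have hcount : (Nat.count (· ≡ σ.shift a b + σ.cycleIdx u [MOD σ.lenGcd a b])
      (σ.cycleLen (σ.lead b))) = σ.keyWeight (σ.pairKey (a, b)) := by
    rw [Nat.count_modEq_card _ (σ.lenGcd_pos a b)]
    have h0 : σ.cycleLen (σ.lead b) % σ.lenGcd a b = 0 :=
      Nat.mod_eq_zero_of_dvd (Nat.gcd_dvd_right _ _)
    rw [h0, if_neg (Nat.not_lt_zero _), add_zero]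
    rfl
  rw [← hcount, Nat.count_eq_card_filter_range]
  have hlead : ∀ k : ℕ, σ.lead ((σ ^ k) (σ.lead b)) = σ.lead b := fun k => by
    rw [lead_pow_apply, lead_lead]
  refine Finset.card_nbij' (fun v => σ.cycleIdx v) (fun k => (σ ^ k) (σ.lead b)) ?_ ?_ ?_ ?_
  · intro v hv
    simp only [Finset.coe_filter, Finset.mem_univ, true_and, Set.mem_ofPred_eq, hmem] at hv
    simp only [Finset.coe_filter, Finset.mem_range, Set.mem_ofPred_eq]
    refine ⟨?_, hv.2⟩
    rw [← hv.1]
    exact σ.cycleIdx_lt v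
  · intro k hk
    simp only [Finset.coe_filter, Finset.mem_range, Set.mem_ofPred_eq] at hk
    simp only [Finset.coe_filter, Finset.mem_univ, true_and, Set.mem_ofPred_eq, hmem]
    refine ⟨hlead k, ?_⟩
    rw [σ.cycleIdx_pow_lead (σ.lead_lead b) hk.1]
    exact hk.2
  · intro v hv
    simp only [Finset.coe_filter, Finset.mem_univ, true_and, Set.mem_ofPred_eq, hmem] at hv
    change (σ ^ σ.cycleIdx v) (σ.lead b) = v
    rw [← hv.1, pow_cycleIdx]
  · intro k hk
    simp only [Finset.coe_filter, Finset.mem_range, Set.mem_ofPred_eq] at hk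
    exact σ.cycleIdx_pow_lead (σ.lead_lead b) hk.1

/-- Split the `v` by key. Only keys whose first cycle is that of `u` can occur, and `hK` makes
`card_pairKey_eq` available for each of them. -/
theorem card_pairKey_mem (u : Fin n) (K : Finset (Fin n × Fin n × ℕ))
    (hK : ∀ κ ∈ K, ∃ p, κ = σ.pairKey p) :
    (Finset.univ.filter fun v => σ.pairKey (u, v) ∈ K).card =
      ∑ κ ∈ K with κ.1 = σ.lead u, σ.keyWeight κ := by
  rw [Finset.card_eq_sum_card_fiberwise (f := fun v => σ.pairKey (u, v))
    (t := K.filter fun κ => κ.1 = σ.lead u)]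
  · refine Finset.sum_congr rfl fun κ hκ => ?_
    obtain ⟨hκK, hκu⟩ := Finset.mem_filter.1 hκ
    obtain ⟨⟨a, b⟩, rfl⟩ := hK κ hκK
    rw [← σ.card_pairKey_eq u a b hκu, Finset.filter_filter]
    congr 1
    ext v
    simp only [Finset.mem_filter, Finset.mem_univ, true_and, and_iff_right_iff_imp]
    intro h
    rwa [h]
  · intro v hv
    simp only [Finset.coe_filter, Finset.mem_univ, true_and, Set.mem_ofPred_eq] at hv
    simp only [Finset.coe_filter, Set.mem_ofPred_eq]
    exact ⟨hv, rfl⟩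

end Equiv.Perm

/-! ### Executions of the machine -/

namespace RAM

/-- The subroutine for gcds comes with a word bound of its own and is run under the larger bound of
the whole program. -/
theorem Exec.mono {B B' : ℕ} (hB : B ≤ B') {p : Program} {s s' : State} {t : ℕ}
    (h : Exec B p s t s') : Exec B' p s t s' := by
  induction h with
  | skip s => exact .skip s
  | const s x a h => exact .const s x a (h.trans hB)
  | word s op x y z h => exact .word s op x y z (h.trans hB)
  | load s x y h => exact .load s x y (h.trans hB)
  | store s x y h => exact .store s x y (h.trans hB)
  | rconst s x a => exact .rconst s x a
  | real s op x y z => exact .real s op x y z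
  | rload s x y => exact .rload s x y
  | rstore s x y => exact .rstore s x y
  | seq _ _ ih₁ ih₂ => exact .seq ih₁ ih₂
  | ite_true hb _ ih => exact .ite_true hb ih
  | ite_false hb _ ih => exact .ite_false hb ih
  | while_true hb _ _ ih₁ ih₂ => exact .while_true hb ih₁ ih₂
  | while_false hb => exact .while_false hb
  | call _ hr ih => exact .call ih (hr.trans hB)

theorem Exec.one_le {B : ℕ} {p : Program} {s s' : State} {t : ℕ} (h : Exec B p s t s') : 1 ≤ t := by
  induction h <;> omega

/-! ### A layer with arrays

Statements work on configurations: word registers, eight word arrays, real registers, and a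
read-only input. -/

/-- A configuration. -/
structure Cfg where
  reg : ℕ → ℕ
  arr : Fin 8 → ℕ → ℕ
  rreg : ℕ → ℝ

/-- The read-only data of an execution: the size and the contents of the word input, the real
input, the bound on words, and the range and the running time of the subroutine for greatest common
divisors. -/
structure Env where
  base : ℕ
  word : ℕ → ℕ
  real : ℕ → ℝ
  bound : ℕ
  gcdRange : ℕ
  gcdTime : ℕ

inductive Stmt
  | skip
  | const (x a : ℕ)
  | word (op : WordOp) (x y z : ℕ)
  /-- word register `x` becomes the entry of array `q` whose index is in `i` -/
  | get (q : Fin 8) (x i : ℕ)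
  /-- the entry of array `q` whose index is in `i` becomes the content of word register `y` -/
  | put (q : Fin 8) (i y : ℕ)
  /-- word register `x` becomes the word of the input whose address is in `i` -/
  | input (x i : ℕ)
  | rconst (x : ℕ) (a : ℤ)
  | real (op : RealOp) (x y z : ℕ)
  /-- real register `x` becomes the real of the input whose address is in `i` -/
  | rinput (x i : ℕ)
  | seq (p q : Stmt)
  | ite (b : Test) (p q : Stmt)
  | loop (b : Test) (p : Stmt)
  /-- word register `x` becomes the greatest common divisor of word registers `y` and `z` -/
  | gcd (x y z : ℕ)

infixr:60 " ;; " => Stmt.seq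

/-- A test on configurations. -/
def Test.HoldsIn : Test → Cfg → Prop
  | .weq x y, c => c.reg x = c.reg y
  | .wlt x y, c => c.reg x < c.reg y
  | .rlt x y, c => c.rreg x < c.rreg y

/-- The test of the machine for a test on configurations. -/
def Test.compile : Test → Test
  | .weq x y => .weq (x + 12) (y + 12)
  | .wlt x y => .wlt (x + 12) (y + 12)
  | .rlt x y => .rlt x y

/-- The program for a statement. Word register `x` is kept in register `x + 12`, entry `i` of array
`q` at address `base + q + 8 * i`; registers `2` to `9` hold the numbers `base + q`, register `10`
holds the number `8`, and register `11` is used for addresses. -/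
def Stmt.compile (gcdProgram : Program) : Stmt → Program
  | .skip => .skip
  | .const x a => .const (x + 12) a
  | .word op x y z => .word op (x + 12) (y + 12) (z + 12)
  | .get q x i => .seq (.word .mul 11 (i + 12) 10) (.seq (.word .add 11 11 (2 + q))
      (.load (x + 12) 11))
  | .put q i y => .seq (.word .mul 11 (i + 12) 10) (.seq (.word .add 11 11 (2 + q))
      (.store 11 (y + 12)))
  | .input x i => .load (x + 12) (i + 12)
  | .rconst x a => .rconst x a
  | .real op x y z => .real op x y z
  | .rinput x i => .rload x (i + 12)
  | .seq p q => .seq (p.compile gcdProgram) (q.compile gcdProgram)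
  | .ite b p q => .ite b.compile (p.compile gcdProgram) (q.compile gcdProgram)
  | .loop b p => .while b.compile (p.compile gcdProgram)
  | .gcd x y z => .call gcdProgram (x + 12) (y + 12) (z + 12)

/-- The running time of a statement without loops. -/
def Stmt.cost (G : ℕ) : Stmt → ℕ
  | .get _ _ _ => 3
  | .put _ _ _ => 3
  | .seq p q => p.cost G + q.cost G
  | .ite _ p q => max (p.cost G) (q.cost G) + 1
  | .gcd _ _ _ => G + 1
  | _ => 1

/-- The weakest precondition of a statement without loops. -/
def Stmt.wp (e : Env) : Stmt → (Cfg → Prop) → Cfg → Prop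
  | .skip, Q, c => Q c
  | .const x a, Q, c => a ≤ e.bound ∧ Q { c with reg := Function.update c.reg x a }
  | .word op x y z, Q, c => op.eval (c.reg y) (c.reg z) ≤ e.bound ∧
      Q { c with reg := Function.update c.reg x (op.eval (c.reg y) (c.reg z)) }
  | .get q x i, Q, c => 8 * c.reg i + e.base + 8 ≤ e.bound ∧ c.arr q (c.reg i) ≤ e.bound ∧
      Q { c with reg := Function.update c.reg x (c.arr q (c.reg i)) }
  | .put q i y, Q, c => 8 * c.reg i + e.base + 8 ≤ e.bound ∧ c.reg y ≤ e.bound ∧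
      Q { c with arr := Function.update c.arr q (Function.update (c.arr q) (c.reg i) (c.reg y)) }
  -- Addresses from `base` on belong to the arrays, so an input address must lie below it.
  | .input x i, Q, c => c.reg i < e.base ∧ e.word (c.reg i) ≤ e.bound ∧
      Q { c with reg := Function.update c.reg x (e.word (c.reg i)) }
  | .rconst x a, Q, c => Q { c with rreg := Function.update c.rreg x (a : ℝ) }
  | .real op x y z, Q, c =>
      Q { c with rreg := Function.update c.rreg x (op.eval (c.rreg y) (c.rreg z)) }
  | .rinput x i, Q, c => Q { c with rreg := Function.update c.rreg x (e.real (c.reg i)) }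
  | .seq p q, Q, c => p.wp e (q.wp e Q) c
  | .ite b p q, Q, c => (b.HoldsIn c → p.wp e Q c) ∧ (¬ b.HoldsIn c → q.wp e Q c)
  -- Loops are left to `Runs.loop`, which takes the number of iterations into account.
  | .loop _ _, _, _ => False
  | .gcd x y z, Q, c => (1 ≤ c.reg y ∧ c.reg y ≤ e.gcdRange ∧ 1 ≤ c.reg z ∧ c.reg z ≤ e.gcdRange) ∧
      Q { c with reg := Function.update c.reg x (Nat.gcd (c.reg y) (c.reg z)) }

theorem Stmt.wp_mono {e : Env} {p : Stmt} {Q Q' : Cfg → Prop} (h : ∀ c, Q c → Q' c) {c : Cfg}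
    (hp : p.wp e Q c) : p.wp e Q' c := by
  induction p generalizing Q Q' c with
  | skip | rconst | real | rinput => exact h _ hp
  | const | word | gcd => exact ⟨hp.1, h _ hp.2⟩
  | get | put | input => exact ⟨hp.1, hp.2.1, h _ hp.2.2⟩
  | seq p q ihp ihq => exact ihp (fun c hc => ihq h hc) hp
  | ite b p q ihp ihq => exact ⟨fun hb => ihp h (hp.1 hb), fun hb => ihq h (hp.2 hb)⟩
  | loop => exact hp

theorem Stmt.wp_seq {e : Env} {p q : Stmt} {Q₁ Q : Cfg → Prop} {c : Cfg} (hp : p.wp e Q₁ c)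
    (hq : ∀ c', Q₁ c' → q.wp e Q c') : (p ;; q).wp e Q c := Stmt.wp_mono hq hp

/-- Fixed repetition. -/
def Stmt.rep : ℕ → Stmt → Stmt
  | 0, _ => .skip
  | k + 1, p => .seq (Stmt.rep k p) p

theorem Stmt.wp_rep {e : Env} {p : Stmt} {K : ℕ} (I : ℕ → Cfg → Prop)
    (hp : ∀ k < K, ∀ c, I k c → p.wp e (I (k + 1)) c) {c : Cfg} (h0 : I 0 c) :
    (Stmt.rep K p).wp e (I K) c := by
  induction K with
  | zero => exact h0
  | succ K ih =>
    exact Stmt.wp_mono (fun c hc => hp K (Nat.lt_succ_self K) c hc)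
      (ih fun k hk c hc => hp k (hk.trans (Nat.lt_succ_self K)) c hc)

/-- The contents of the word memory. -/
def Env.memory (e : Env) (A : Fin 8 → ℕ → ℕ) (a : ℕ) : ℕ :=
  if a < e.base then e.word a
  else A ⟨(a - e.base) % 8, Nat.mod_lt _ (by norm_num)⟩ ((a - e.base) / 8)

theorem Env.memory_input (e : Env) (A : Fin 8 → ℕ → ℕ) {a : ℕ} (h : a < e.base) :
    e.memory A a = e.word a := if_pos h

theorem Env.memory_array (e : Env) (A : Fin 8 → ℕ → ℕ) (q : Fin 8) (i : ℕ) :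
    e.memory A (i * 8 + (e.base + q)) = A q i := by
  have hq := q.2
  rw [Env.memory, if_neg (by omega)]
  congr 1
  · congr 1
    omega
  · omega

theorem Env.update_memory (e : Env) (A : Fin 8 → ℕ → ℕ) (q : Fin 8) (i v : ℕ) :
    Function.update (e.memory A) (i * 8 + (e.base + q)) v =
      e.memory (Function.update A q (Function.update (A q) i v)) := by
  have hq := q.2
  funext a
  rw [Function.update_apply]
  split_ifs with h
  · rw [h, Env.memory_array, Function.update_self, Function.update_self]
  · unfold Env.memory
    split_ifs with h2
    · rfl
    · by_cases h3 : (⟨(a - e.base) % 8, Nat.mod_lt _ (by norm_num)⟩ : Fin 8) = q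
      · rw [h3, Function.update_self, Function.update_of_ne]
        have := congrArg Fin.val h3
        simp only at this
        omega
      · rw [Function.update_of_ne h3]

/-- The machine state `s` represents the configuration `c`. -/
structure Represents (e : Env) (c : Cfg) (s : State) : Prop where
  reg : ∀ r, s.reg (r + 12) = c.reg r
  base : ∀ q : Fin 8, s.reg (2 + q) = e.base + q
  eight : s.reg 10 = 8
  mem : s.mem = e.memory c.arr
  rreg : s.rreg = c.rreg
  rmem : s.rmem = e.real

theorem Represents.setReg {e : Env} {c : Cfg} {s : State} (h : Represents e c s) (x v : ℕ) :
    Represents e { c with reg := Function.update c.reg x v }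
      { s with reg := Function.update s.reg (x + 12) v } where
  reg r := by
    by_cases hr : r = x
    · simp [hr]
    · simp [hr, h.reg]
  base q := by
    have := q.2
    exact (Function.update_of_ne (show 2 + (q : ℕ) ≠ x + 12 by omega) v s.reg).trans (h.base q)
  eight := (Function.update_of_ne (show 10 ≠ x + 12 by omega) v s.reg).trans h.eight
  mem := h.mem
  rreg := h.rreg
  rmem := h.rmem

theorem Represents.setAddress {e : Env} {c : Cfg} {s : State} (h : Represents e c s) (v : ℕ) :
    Represents e c { s with reg := Function.update s.reg 11 v } where
  reg r := (Function.update_of_ne (show r + 12 ≠ 11 by omega) v s.reg).trans (h.reg r)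
  base q := by
    have := q.2
    exact (Function.update_of_ne (show 2 + (q : ℕ) ≠ 11 by omega) v s.reg).trans (h.base q)
  eight := h.eight
  mem := h.mem
  rreg := h.rreg
  rmem := h.rmem

theorem Represents.holds_compile {e : Env} {c : Cfg} {s : State} (h : Represents e c s)
    (b : Test) : b.compile.Holds s ↔ b.HoldsIn c := by
  cases b <;> simp [Test.compile, Test.Holds, Test.HoldsIn, h.reg, h.rreg]

/-- Every machine state that represents `c` is led by the statement `p`, in time at most `T`, to a
state that represents a configuration with property `Q`. -/
def Runs (e : Env) (gcdProgram : Program) (p : Stmt) (c : Cfg) (T : ℕ) (Q : Cfg → Prop) : Prop :=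
  ∀ s, Represents e c s → ∃ t s' c', Exec e.bound (p.compile gcdProgram) s t s' ∧ t ≤ T ∧
    Represents e c' s' ∧ Q c'

/-- The subroutine computes greatest common divisors. -/
structure Env.GcdSpec (e : Env) (gcdProgram : Program) : Prop where
  range_le : e.gcdRange ≤ e.bound
  exec : ∀ a b, 1 ≤ a → a ≤ e.gcdRange → 1 ≤ b → b ≤ e.gcdRange → ∃ t s',
    Exec e.bound gcdProgram (argState a b) t s' ∧ t ≤ e.gcdTime ∧ s'.reg 0 = Nat.gcd a b

/-- The address is itself a word that the machine writes, which is why array indices have to be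
bounded. -/
theorem exec_address {e : Env} {c : Cfg} {s : State} (h : Represents e c s) (q : Fin 8) (i : ℕ)
    (hb : 8 * c.reg i + e.base + 8 ≤ e.bound) (p : Program) {t : ℕ} {s' : State}
    (hp : Exec e.bound p
      { s with reg := Function.update s.reg 11 (c.reg i * 8 + (e.base + q)) } t s') :
    Exec e.bound (.seq (.word .mul 11 (i + 12) 10) (.seq (.word .add 11 11 (2 + q)) p)) s
      (1 + (1 + t)) s' := by
  have hq := q.2
  have h1 : WordOp.mul.eval (s.reg (i + 12)) (s.reg 10) = c.reg i * 8 := by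
    rw [h.reg, h.eight]
    rfl
  refine .seq (.word s .mul 11 (i + 12) 10 (by rw [h1]; omega)) ?_
  rw [h1]
  have h2 : WordOp.add.eval (Function.update s.reg 11 (c.reg i * 8) 11)
      (Function.update s.reg 11 (c.reg i * 8) (2 + q)) = c.reg i * 8 + (e.base + q) := by
    rw [Function.update_self, Function.update_of_ne (by omega), h.base]
    rfl
  refine .seq (.word _ .add 11 11 (2 + q) ?_) ?_
  · change WordOp.add.eval (Function.update s.reg 11 (c.reg i * 8) 11)
      (Function.update s.reg 11 (c.reg i * 8) (2 + q)) ≤ _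
    rw [h2]
    omega
  · simp only [h2, Function.update_idem]
    exact hp

/-- Soundness of the weakest preconditions, including the time bound: compiled code simulates each
statement on the representing state. -/
theorem Runs.of_wp {e : Env} {gcdProgram : Program} (hg : e.GcdSpec gcdProgram) {p : Stmt}
    {Q : Cfg → Prop} {c : Cfg} (hp : p.wp e Q c) :
    Runs e gcdProgram p c (p.cost e.gcdTime) Q := by
  induction p generalizing Q c with
  | skip => exact fun s h => ⟨1, s, c, .skip s, le_rfl, h, hp⟩
  | const x a => exact fun s h => ⟨1, _, _, .const s _ a hp.1, le_rfl, h.setReg x a, hp.2⟩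
  | word op x y z =>
    intro s h
    have h1 : op.eval (s.reg (y + 12)) (s.reg (z + 12)) = op.eval (c.reg y) (c.reg z) := by
      rw [h.reg, h.reg]
    refine ⟨1, _, _, .word s op _ _ _ (by rw [h1]; exact hp.1), le_rfl, ?_, hp.2⟩
    rw [h1]
    exact h.setReg x _
  | get q x i =>
    intro s h
    have h1 := h.setAddress (c.reg i * 8 + (e.base + q))
    have h2 : e.memory c.arr (c.reg i * 8 + (e.base + q)) = c.arr q (c.reg i) :=
      e.memory_array _ _ _
    have h3 := Exec.load (B := e.bound)
      { s with reg := Function.update s.reg 11 (c.reg i * 8 + (e.base + q)) } (x + 12) 11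
      (by simp only [Function.update_self, h.mem, h2]; exact hp.2.1)
    refine ⟨_, _, _, exec_address h q i hp.1 _ h3, le_rfl, ?_, hp.2.2⟩
    simp only [Function.update_self, h.mem, h2]
    have h4 := h1.setReg x (c.arr q (c.reg i))
    rw [← h.mem]
    exact h4
  | put q i y =>
    intro s h
    have h1 := h.setAddress (c.reg i * 8 + (e.base + q))
    have h2 : Function.update s.reg 11 (c.reg i * 8 + (e.base + q)) (y + 12) = c.reg y := h1.reg y
    have h3 := Exec.store (B := e.bound)
      { s with reg := Function.update s.reg 11 (c.reg i * 8 + (e.base + q)) } 11 (y + 12)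
      (by simp only [h2]; exact hp.2.1)
    refine ⟨_, _, _, exec_address h q i hp.1 _ h3, le_rfl, ?_, hp.2.2⟩
    simp only [h2, Function.update_self, h.mem, e.update_memory]
    exact ⟨h1.reg, h1.base, h1.eight, rfl, h1.rreg, h1.rmem⟩
  | input x i =>
    intro s h
    have h1 : s.mem (s.reg (i + 12)) = e.word (c.reg i) := by
      rw [h.reg, h.mem, e.memory_input _ hp.1]
    refine ⟨1, _, _, .load s (x + 12) (i + 12) (by rw [h1]; exact hp.2.1), le_rfl, ?_, hp.2.2⟩
    rw [h1]
    exact h.setReg x _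
  | rconst x a =>
    intro s h
    exact ⟨1, _, { c with rreg := Function.update c.rreg x (a : ℝ) }, .rconst s x a, le_rfl,
      ⟨h.reg, h.base, h.eight, h.mem, by simp only [h.rreg], h.rmem⟩, hp⟩
  | real op x y z =>
    intro s h
    exact ⟨1, _, { c with rreg := Function.update c.rreg x (op.eval (c.rreg y) (c.rreg z)) }, .real s op x y z, le_rfl,
      ⟨h.reg, h.base, h.eight, h.mem, by simp only [h.rreg], h.rmem⟩, hp⟩
  | rinput x i =>
    intro s h
    exact ⟨1, _, { c with rreg := Function.update c.rreg x (e.real (c.reg i)) }, .rload s x (i + 12), le_rfl,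
      ⟨h.reg, h.base, h.eight, h.mem, by simp only [h.rreg, h.rmem, h.reg], h.rmem⟩, hp⟩
  | seq p q ihp ihq =>
    intro s h
    obtain ⟨t₁, s₁, c₁, he₁, ht₁, hr₁, hq₁⟩ := ihp hp s h
    obtain ⟨t₂, s₂, c₂, he₂, ht₂, hr₂, hq₂⟩ := ihq hq₁ s₁ hr₁
    exact ⟨_, s₂, c₂, .seq he₁ he₂, Nat.add_le_add ht₁ ht₂, hr₂, hq₂⟩
  | ite b p q ihp ihq =>
    intro s h
    by_cases hb : b.HoldsIn c
    · obtain ⟨t, s', c', he, ht, hr, hq⟩ := ihp (hp.1 hb) s h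
      exact ⟨_, s', c', .ite_true ((h.holds_compile b).2 hb) he,
        Nat.add_le_add_right (ht.trans (le_max_left _ _)) 1, hr, hq⟩
    · obtain ⟨t, s', c', he, ht, hr, hq⟩ := ihq (hp.2 hb) s h
      exact ⟨_, s', c', .ite_false (fun h' => hb ((h.holds_compile b).1 h')) he,
        Nat.add_le_add_right (ht.trans (le_max_right _ _)) 1, hr, hq⟩
  | loop => exact hp.elim
  | gcd x y z =>
    intro s h
    obtain ⟨⟨hy1, hy2, hz1, hz2⟩, hQ⟩ := hp
    obtain ⟨t, s', he, ht, hr⟩ := hg.exec _ _ hy1 hy2 hz1 hz2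
    rw [← h.reg y, ← h.reg z] at he
    refine ⟨t + 1, _, _, .call (x := x + 12) he ?_, Nat.add_le_add_right ht 1, ?_, hQ⟩
    · rw [hr]
      exact (Nat.gcd_le_left _ hy1).trans (hy2.trans hg.range_le)
    · rw [hr]
      exact h.setReg x _

theorem Runs.seq {e : Env} {gcdProgram : Program} {p q : Stmt} {c : Cfg} {T₁ T₂ : ℕ}
    {Q₁ Q : Cfg → Prop} (h₁ : Runs e gcdProgram p c T₁ Q₁)
    (h₂ : ∀ c', Q₁ c' → Runs e gcdProgram q c' T₂ Q) :
    Runs e gcdProgram (.seq p q) c (T₁ + T₂) Q := by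
  intro s h
  obtain ⟨t₁, s₁, c₁, he₁, ht₁, hr₁, hq₁⟩ := h₁ s h
  obtain ⟨t₂, s₂, c₂, he₂, ht₂, hr₂, hq₂⟩ := h₂ c₁ hq₁ s₁ hr₁
  exact ⟨_, s₂, c₂, .seq he₁ he₂, Nat.add_le_add ht₁ ht₂, hr₂, hq₂⟩

/-- The invariant decides the test from the iteration number, so the body runs exactly `N` times,
with one extra step for each test. -/
theorem Runs.loop {e : Env} {gcdProgram : Program} {p : Stmt} {b : Test} {N T : ℕ}
    (I : ℕ → Cfg → Prop) (hb : ∀ k c, I k c → (b.HoldsIn c ↔ k < N))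
    (hp : ∀ k < N, ∀ c, I k c → Runs e gcdProgram p c T (I (k + 1))) {c : Cfg} (h0 : I 0 c) :
    Runs e gcdProgram (.loop b p) c (N * (T + 1) + 1) (I N) := by
  suffices h : ∀ j k c, k + j = N → I k c →
      Runs e gcdProgram (.loop b p) c (j * (T + 1) + 1) (I N) from h N 0 c (Nat.zero_add N) h0
  intro j
  induction j with
  | zero =>
    intro k c hk hI s h
    obtain rfl : k = N := hk
    exact ⟨1, s, c, .while_false fun h' =>
      lt_irrefl _ ((hb k c hI).1 ((h.holds_compile b).1 h')), by omega, h, hI⟩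
  | succ j ih =>
    intro k c hk hI s h
    have hkN : k < N := by omega
    obtain ⟨t₁, s₁, c₁, he₁, ht₁, hr₁, hq₁⟩ := hp k hkN c hI s h
    obtain ⟨t₂, s₂, c₂, he₂, ht₂, hr₂, hq₂⟩ := ih (k + 1) c₁ (by omega) hq₁ s₁ hr₁
    refine ⟨_, s₂, c₂, .while_true ((h.holds_compile b).2 ((hb k c hI).2 hkN)) he₁ he₂, ?_,
      hr₂, hq₂⟩
    rw [Nat.succ_mul]
    omega

/-! ### Euclid's algorithm -/

/-- Euclid's algorithm. -/
def euclid : Program :=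
  .while (.wlt 2 1) (.seq (.word .mod 3 0 1) (.seq (.word .add 0 1 2) (.word .add 1 3 2)))

theorem exec_euclid_step {B : ℕ} {s : State} (h0 : s.reg 0 ≤ B) (h1 : s.reg 1 ≤ B)
    (h2 : s.reg 2 = 0) (hpos : 0 < s.reg 1) :
    ∃ s₁, s₁.reg 0 = s.reg 1 ∧ s₁.reg 1 = s.reg 0 % s.reg 1 ∧ s₁.reg 2 = 0 ∧
      ∀ t s', Exec B euclid s₁ t s' → Exec B euclid s (t + 4) s' := by
  have hm : s.reg 0 % s.reg 1 ≤ B := (Nat.mod_le _ _).trans h0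
  refine ⟨{ s with reg := Function.update (Function.update (Function.update s.reg 3
    (s.reg 0 % s.reg 1)) 0 (s.reg 1)) 1 (s.reg 0 % s.reg 1) }, ?_, ?_, ?_, ?_⟩
  · simp
  · simp
  · simpa using h2
  · intro t s' ht
    have e1 := Exec.word (B := B) s .mod 3 0 1 hm
    set s₁ : State := { s with reg := Function.update s.reg 3 (s.reg 0 % s.reg 1) } with hs₁
    have v2 : WordOp.add.eval (s₁.reg 1) (s₁.reg 2) = s.reg 1 := by simp [hs₁, WordOp.eval, h2]
    have e2 := Exec.word (B := B) s₁ .add 0 1 2 (by rw [v2]; exact h1)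
    rw [v2] at e2
    set s₂ : State := { s₁ with reg := Function.update s₁.reg 0 (s.reg 1) } with hs₂
    have v3 : WordOp.add.eval (s₂.reg 3) (s₂.reg 2) = s.reg 0 % s.reg 1 := by
      simp [hs₂, hs₁, WordOp.eval, h2]
    have e3 := Exec.word (B := B) s₂ .add 1 3 2 (by rw [v3]; exact hm)
    rw [v3] at e3
    have hh := Exec.while_true (b := .wlt 2 1) (by simpa [Test.Holds, h2] using hpos)
      (.seq e1 (.seq e2 e3)) ht
    rw [show t + 4 = 1 + (1 + 1) + t + 1 by omega]
    exact hh

/-- For `b ≤ a` one has `2 * (a % b) ≤ a`, so the product of the two numbers at least halves in each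
iteration, which takes 4 steps. -/
theorem exec_euclid_of_le {B : ℕ} (j : ℕ) : ∀ s : State, s.reg 1 ≤ s.reg 0 → s.reg 0 ≤ B →
    s.reg 2 = 0 → s.reg 0 * s.reg 1 < 2 ^ j →
    ∃ t s', Exec B euclid s t s' ∧ t ≤ 4 * j + 1 ∧ s'.reg 0 = Nat.gcd (s.reg 0) (s.reg 1) := by
  induction j with
  | zero =>
    intro s hle hB h2 hlt
    have h1 : s.reg 1 = 0 := by
      by_contra h
      have h1 : 1 ≤ s.reg 1 := by omega
      have := Nat.mul_le_mul (h1.trans hle) h1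
      simp at hlt
      omega
    exact ⟨1, s, .while_false (by simp [Test.Holds, h1]), by omega, by simp [h1]⟩
  | succ j ih =>
    intro s hle hB h2 hlt
    rcases Nat.eq_zero_or_pos (s.reg 1) with h1 | h1
    · exact ⟨1, s, .while_false (by simp [Test.Holds, h1]), by omega, by simp [h1]⟩
    obtain ⟨s₁, e0, e1, e2, hs⟩ := exec_euclid_step hB (hle.trans hB) h2 h1
    have hmod : 2 * (s.reg 0 % s.reg 1) ≤ s.reg 0 := by
      have h3 := Nat.mod_lt (s.reg 0) h1
      have h4 := Nat.div_add_mod (s.reg 0) (s.reg 1)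
      have h5 : 1 ≤ s.reg 0 / s.reg 1 := Nat.div_pos hle h1
      have h6 := Nat.mul_le_mul_left (s.reg 1) h5
      omega
    obtain ⟨t, s', he, ht, hr⟩ := ih s₁ (by rw [e0, e1]; exact (Nat.mod_lt _ h1).le)
      (by rw [e0]; omega) e2 (by
        rw [e0, e1]
        have := Nat.mul_le_mul_left (s.reg 1) hmod
        rw [pow_succ] at hlt
        nlinarith)
    refine ⟨t + 4, s', hs t s' he, by omega, ?_⟩
    rw [hr, e0, e1, Nat.gcd_comm, ← Nat.gcd_rec, Nat.gcd_comm]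

/-- If the arguments are in the wrong order, the first iteration swaps them, at a cost of 4 more
steps. -/
theorem exec_euclid {B a b j : ℕ} (ha : a ≤ B) (hb : b ≤ B) (hj : a * b < 2 ^ j) :
    ∃ t s', Exec B euclid (argState a b) t s' ∧ t ≤ 4 * j + 5 ∧ s'.reg 0 = Nat.gcd a b := by
  have v0 : (argState a b).reg 0 = a := rfl
  have v1 : (argState a b).reg 1 = b := rfl
  have v2 : (argState a b).reg 2 = 0 := rfl
  rcases le_or_gt b a with hle | hgt
  · obtain ⟨t, s', he, ht, hr⟩ := exec_euclid_of_le j (argState a b) hle ha v2 hj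
    exact ⟨t, s', he, by omega, hr⟩
  · obtain ⟨s₁, e0, e1, e2, hs⟩ := exec_euclid_step (s := argState a b) ha hb v2
      (by rw [v1]; omega)
    rw [v1] at e0
    rw [v0, v1, Nat.mod_eq_of_lt hgt] at e1
    obtain ⟨t, s', he, ht, hr⟩ := exec_euclid_of_le (B := B) j s₁ (by omega) (by omega) e2
      (by rw [e0, e1, mul_comm]; exact hj)
    exact ⟨t + 4, s', hs t s' he, by omega, by rw [hr, e0, e1, Nat.gcd_comm]⟩

theorem computesGcd_euclid :
    ComputesGcd euclid (fun n => 32 * Real.log ((n : ℝ) + 2) ^ 1) := by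
  refine ⟨1, fun n a b ha han hb hbn => ?_⟩
  have hlog := Nat.lt_pow_succ_log_self (b := 2) (by norm_num) (n + 2)
  set l := Nat.log 2 (n + 2) with hl
  have hj : a * b < 2 ^ (2 * (l + 1)) := by
    rw [two_mul, pow_add]
    exact Nat.mul_lt_mul'' (by omega) (by omega)
  obtain ⟨t, s', he, ht, hr⟩ := exec_euclid (B := (n + 2) ^ 1) (by rw [pow_one]; omega)
    (by rw [pow_one]; omega) hj
  refine ⟨t, s', he, ?_, hr⟩
  have hl1 : 1 ≤ l := Nat.log_pos (by norm_num) (by omega)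
  -- Here `t ≤ 8 * l + 13` and `1 ≤ l`; the constant 32 works because `32 * log 2 > 21`.
  have h1 : (t : ℝ) ≤ 21 * l := by
    have : t ≤ 21 * l := by omega
    exact_mod_cast this
  have h2 : (l : ℝ) * Real.log 2 ≤ Real.log ((n : ℝ) + 2) := by
    rw [← Real.log_pow]
    refine Real.log_le_log (by positivity) ?_
    exact_mod_cast Nat.pow_log_le_self 2 (by omega : n + 2 ≠ 0)
  have h3 := Real.log_two_gt_d9
  have h4 : (l : ℝ) * 0.6931471803 ≤ l * Real.log 2 := by gcongr
  simp only [pow_one]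
  have h5 : (1 : ℝ) ≤ l := by exact_mod_cast hl1
  linarith

end RAM

/-! ### Darts and the number of tokens met -/

namespace SCS

variable {n : ℕ}

/-- The dart opposite to dart `d`; darts `2 * e` and `2 * e + 1` belong to edge `e`. -/
def rev (d : ℕ) : ℕ := d + 1 - 2 * (d % 2)

theorem rev_rev (d : ℕ) : rev (rev d) = d := by
  unfold rev
  omega

/-- A numbering of the darts (oriented edges) of the communication graph. -/
structure Darts (S : SCS n) where
  edges : ℕ
  src : ℕ → Fin n
  adj : ∀ d < 2 * edges, S.graph.Adj (src d) (src (rev d))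
  inj : ∀ d < 2 * edges, ∀ d' < 2 * edges, src d = src d' → src (rev d) = src (rev d') → d = d'
  surj : ∀ i j, S.graph.Adj i j → ∃ d < 2 * edges, src d = i ∧ src (rev d) = j

theorem rev_lt {m d : ℕ} (h : d < 2 * m) : rev d < 2 * m := by
  unfold rev
  omega

namespace Darts

variable {S : SCS n} (Δ : S.Darts)

/-- The bucket of a dart. -/
noncomputable def bkt (d : ℕ) : ℕ := S.bucket (Δ.src d) (Δ.src (rev d))

theorem bkt_lt (d : ℕ) : Δ.bkt d < 16 := S.bucket_lt _ _

theorem bkt_rev {d : ℕ} (h : d < 2 * Δ.edges) : Δ.bkt (rev d) = Δ.bkt d := by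
  rw [bkt, bkt, rev_rev, S.bucket_comm (Δ.adj d h)]

theorem round_src {d : ℕ} (h : d < 2 * Δ.edges) :
    S.round (Δ.bkt d) (Δ.src d) = Δ.src (rev d) := S.round_eq (Δ.adj d h) rfl

/-- A trajectory has at most one link per interval, so a dart is determined by its source and its
interval. -/
theorem eq_of_slot {d d' : ℕ} (h : d < 2 * Δ.edges) (h' : d' < 2 * Δ.edges)
    (hs : Δ.src d = Δ.src d') (hb : Δ.bkt d = Δ.bkt d') : d = d' := by
  refine Δ.inj d h d' h' hs ?_
  rw [← Δ.round_src h, ← Δ.round_src h', hs, hb]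

theorem edges_le : 2 * Δ.edges ≤ 16 * n := by
  have h := Finset.card_le_card_of_injOn (s := Finset.range (2 * Δ.edges))
    (t := Finset.range (16 * n)) (fun d => 16 * (Δ.src d : ℕ) + Δ.bkt d) ?_ ?_
  · simpa using h
  · intro d _
    have h1 := Δ.bkt_lt d
    have h2 := (Δ.src d).2
    simp only [Finset.coe_range, Set.mem_Iio]
    omega
  · intro d hd d' hd' h
    simp only [Finset.coe_range, Set.mem_Iio] at hd hd' h
    have h1 := Δ.bkt_lt d
    have h2 := Δ.bkt_lt d'
    exact Δ.eq_of_slot hd hd' (Fin.ext (by omega)) (by omega)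

/-- The trajectory in which the token that crosses dart `d` is at the start of the period. -/
noncomputable def start (d : ℕ) : Fin n := (S.rpos (Δ.bkt d)).symm (Δ.src d)

theorem start_eq_iff (d : ℕ) (v : Fin n) : Δ.start d = v ↔ S.rpos (Δ.bkt d) v = Δ.src d := by
  rw [start, Equiv.symm_apply_eq, eq_comm]

/-- The key of the pair of tokens that meet at dart `d`. -/
noncomputable def key (d : ℕ) : Fin n × Fin n × ℕ :=
  S.period.pairKey (Δ.start d, Δ.start (rev d))

/-- The keys of the first `k` darts. -/
noncomputable def keys (k : ℕ) : Finset (Fin n × Fin n × ℕ) := (Finset.range k).image Δ.key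

theorem keys_succ (k : ℕ) : Δ.keys (k + 1) = insert (Δ.key k) (Δ.keys k) := by
  rw [keys, Finset.range_add_one, Finset.image_insert, keys]

theorem mem_keys {k : ℕ} {κ : Fin n × Fin n × ℕ} :
    κ ∈ Δ.keys k ↔ ∃ d < k, Δ.key d = κ := by
  simp [keys]

/-- The number of tokens that meet the tokens in the cycle of `a`, counted over the first `k`
darts. -/
noncomputable def count (k : ℕ) (a : Fin n) : ℕ :=
  ∑ κ ∈ Δ.keys k with κ.1 = a, S.period.keyWeight κ

theorem count_succ_of_mem {k : ℕ} (h : Δ.key k ∈ Δ.keys k) (a : Fin n) :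
    Δ.count (k + 1) a = Δ.count k a := by
  rw [count, keys_succ, Finset.insert_eq_of_mem h, count]

theorem count_succ_of_notMem {k : ℕ} (h : Δ.key k ∉ Δ.keys k) (a : Fin n) :
    Δ.count (k + 1) a =
      if a = (Δ.key k).1 then Δ.count k a + S.period.keyWeight (Δ.key k) else Δ.count k a := by
  rw [count, keys_succ, Finset.filter_insert]
  split_ifs with h1 h2 h2
  · rw [Finset.sum_insert (fun h3 => h (Finset.mem_filter.1 h3).1), add_comm, count]
  · exact absurd h1.symm h2
  · exact absurd h2.symm h1
  · rfl

/-- A meeting in period `m` at a dart says that the `m`-th power of `period` takes the pair to the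
two tokens that cross there in the first period; `exists_pow_eq_iff` turns this into an equality of
keys. -/
theorem meets_iff_key (u v : Fin n) :
    S.Meets u v ↔ S.period.pairKey (u, v) ∈ Δ.keys (2 * Δ.edges) := by
  rw [meets_iff, mem_keys]
  constructor
  · rintro ⟨m, i, j, hij, hu, hv⟩
    obtain ⟨d, hd, rfl, rfl⟩ := Δ.surj i j hij
    refine ⟨d, hd, Eq.symm ?_⟩
    rw [key, ← Equiv.Perm.exists_pow_eq_iff]
    refine ⟨m, ((Δ.start_eq_iff _ _).2 hu).symm, ((Δ.start_eq_iff _ _).2 ?_).symm⟩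
    rw [Δ.bkt_rev hd]
    exact hv
  · rintro ⟨d, hd, h⟩
    rw [key, eq_comm, ← Equiv.Perm.exists_pow_eq_iff] at h
    obtain ⟨m, hu, hv⟩ := h
    refine ⟨m, _, _, Δ.adj d hd, ?_, ?_⟩
    · exact (Δ.start_eq_iff _ _).1 hu.symm
    · have := (Δ.start_eq_iff _ _).1 hv.symm
      rwa [Δ.bkt_rev hd] at this

theorem ncard_meets (u : Fin n) :
    {v | S.Meets u v}.ncard = Δ.count (2 * Δ.edges) (S.period.lead u) := by
  classical
  rw [count, ← Equiv.Perm.card_pairKey_mem, Set.ncard_eq_toFinset_card', Set.toFinset_ofPred]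
  · congr 1
    ext v
    simp only [Finset.mem_filter, Finset.mem_univ, true_and]
    exact Δ.meets_iff_key u v
  · intro κ hκ
    obtain ⟨d, -, rfl⟩ := Δ.mem_keys.1 hκ
    exact ⟨_, rfl⟩

theorem count_lead_le (u : Fin n) : Δ.count (2 * Δ.edges) (S.period.lead u) ≤ n := by
  rw [← ncard_meets]
  simpa using Set.ncard_le_card {v | S.Meets u v}

theorem count_mono (k : ℕ) (a : Fin n) : Δ.count k a ≤ Δ.count (k + 1) a := by
  refine Finset.sum_le_sum_of_subset (Finset.filter_subset_filter _ ?_)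
  rw [keys_succ]
  exact Finset.subset_insert _ _

/-- Partial counts only grow, and the final one counts tokens; this keeps the counters within the
word bound. -/
theorem count_le {k : ℕ} (hk : k ≤ 2 * Δ.edges) (u : Fin n) :
    Δ.count k (S.period.lead u) ≤ n :=
  (monotone_nat_of_le_succ (fun k => Δ.count_mono k (S.period.lead u)) hk).trans
    (Δ.count_lead_le u)

/-- The darts of a list of edges. -/
def ofList (es : List (Fin n × Fin n)) (i₀ : Fin n) (h : RAM.ListsEdges S es) : S.Darts where
  edges := es.length
  src d := if d % 2 = 0 then (es.getD (d / 2) (i₀, i₀)).1 else (es.getD (d / 2) (i₀, i₀)).2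
  adj d hd := by
    have hd2 : d / 2 < es.length := by omega
    have h1 : S.graph.Adj es[d / 2].1 es[d / 2].2 :=
      (h.2 _ _).2 (List.mem_map.2 ⟨es[d / 2], List.getElem_mem hd2, rfl⟩)
    have hr : rev d / 2 = d / 2 := by
      unfold rev
      omega
    rw [hr, List.getD_eq_getElem _ _ hd2]
    rcases Nat.mod_two_eq_zero_or_one d with h0 | h0
    · have hr2 : rev d % 2 = 1 := by
        unfold rev
        omega
      simpa [h0, hr2] using h1
    · have hr2 : rev d % 2 = 0 := by
        unfold rev
        omega
      simpa [h0, hr2] using h1.symm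
  inj d hd d' hd' h1 h2 := by
    have hd2 : d / 2 < es.length := by omega
    have hd2' : d' / 2 < es.length := by omega
    have hr : rev d / 2 = d / 2 := by
      unfold rev
      omega
    have hr' : rev d' / 2 = d' / 2 := by
      unfold rev
      omega
    have hm : rev d % 2 = 1 - d % 2 := by
      unfold rev
      omega
    have hm' : rev d' % 2 = 1 - d' % 2 := by
      unfold rev
      omega
    rw [hr, hr', hm, hm', List.getD_eq_getElem _ _ hd2, List.getD_eq_getElem _ _ hd2'] at h2
    rw [List.getD_eq_getElem _ _ hd2, List.getD_eq_getElem _ _ hd2'] at h1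
    -- The unordered pairs agree and the list repeats none, so the edge is the same; its ends are
    -- distinct, so the orientation is too.
    have hs : s(es[d / 2].1, es[d / 2].2) = s(es[d' / 2].1, es[d' / 2].2) := by
      rw [Sym2.eq_iff]
      rcases Nat.mod_two_eq_zero_or_one d with h0 | h0 <;>
        rcases Nat.mod_two_eq_zero_or_one d' with h0' | h0' <;>
        simp [h0, h0'] at h1 h2 <;> tauto
    have he : d / 2 = d' / 2 := by
      refine (List.Nodup.getElem_inj_iff h.1 (i := d / 2) (j := d' / 2) (hi := ?_) (hj := ?_)).1 ?_
      · simpa using hd2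
      · simpa using hd2'
      · simpa using hs
    have hne : es[d / 2].1 ≠ es[d / 2].2 :=
      ((h.2 _ _).2 (List.mem_map.2 ⟨es[d / 2], List.getElem_mem hd2, rfl⟩)).ne
    have h3 : d % 2 = d' % 2 := by
      by_contra hc
      rcases Nat.mod_two_eq_zero_or_one d with h0 | h0
      · have h0' : d' % 2 = 1 := by omega
        simp only [← he] at h1
        simp [h0, h0'] at h1
        exact hne h1
      · have h0' : d' % 2 = 0 := by omega
        simp only [← he] at h1
        simp [h0, h0'] at h1
        exact hne h1.symm
    omega
  surj i j hij := by
    obtain ⟨e, he, hs⟩ := List.mem_map.1 ((h.2 i j).1 hij)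
    obtain ⟨k, hk, rfl⟩ := List.mem_iff_getElem.1 he
    rw [Sym2.eq_iff] at hs
    rcases hs with ⟨h1, h2⟩ | ⟨h1, h2⟩
    · refine ⟨2 * k, by omega, ?_⟩
      have hr : rev (2 * k) = 2 * k + 1 := by
        unfold rev
        omega
      rw [hr, show 2 * k / 2 = k by omega, show (2 * k + 1) / 2 = k by omega,
        List.getD_eq_getElem _ _ hk]
      simpa using ⟨h1, h2⟩
    · refine ⟨2 * k + 1, by omega, ?_⟩
      have hr : rev (2 * k + 1) = 2 * k := by
        unfold rev
        omega
      rw [hr, show 2 * k / 2 = k by omega, show (2 * k + 1) / 2 = k by omega,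
        List.getD_eq_getElem _ _ hk]
      simpa using ⟨h2, h1⟩

end Darts

end SCS

/-! ### Reading the input -/

namespace RAM

theorem getD_flatMap_pair {n : ℕ} (es : List (Fin n × Fin n)) (i₀ : Fin n) (d : ℕ)
    (h : d < 2 * es.length) :
    (es.flatMap fun e : Fin n × Fin n => [(e.1 : ℕ), (e.2 : ℕ)]).getD d 0 =
      ((if d % 2 = 0 then (es.getD (d / 2) (i₀, i₀)).1
        else (es.getD (d / 2) (i₀, i₀)).2 : Fin n) : ℕ) := by
  induction es generalizing d with
  | nil => simp at h
  | cons e es ih =>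
    match d with
    | 0 => simp
    | 1 => simp
    | d + 2 =>
      have := ih d (by simp at h; omega)
      rw [show (d + 2) % 2 = d % 2 by omega, show (d + 2) / 2 = d / 2 + 1 by omega]
      simpa using this

theorem getD_flatten_triple (l : List (ℝ × ℝ × ℝ)) (i j : ℕ) (hj : j < 3) (h : i < l.length) :
    ((l.map fun x => [x.1, x.2.1, x.2.2]).flatten).getD (3 * i + j) 0 =
      [l[i].1, l[i].2.1, l[i].2.2].getD j 0 := by
  induction l generalizing i with
  | nil => simp at h
  | cons x l ih =>
    match i with
    | 0 =>
      match j, hj with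
      | 0, _ => simp
      | 1, _ => simp
      | 2, _ => simp
    | i + 1 =>
      have := ih i (by simpa using h)
      rw [show 3 * (i + 1) + j = 3 * i + j + 3 by omega]
      simpa using this

variable {n : ℕ} (S : SCS n) (es : List (Fin n × Fin n))

theorem inputState_mem_direction (i : Fin n) :
    (inputState S es).mem i = if S.g i = 1 then 1 else 0 := by
  change (List.ofFn _ ++ _).getD (i : ℕ) 0 = _
  rw [List.getD_append _ _ _ _ (by simp), List.getD_eq_getElem _ _ (by simp)]
  simp

theorem inputState_mem_src (i₀ : Fin n) (h : ListsEdges S es) {d : ℕ} (hd : d < 2 * es.length) :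
    (inputState S es).mem (n + d) = ((SCS.Darts.ofList es i₀ h).src d : ℕ) := by
  change (List.ofFn _ ++ _).getD (n + d) 0 = _
  rw [List.getD_append_right _ _ _ _ (by simp), List.length_ofFn, Nat.add_sub_cancel_left,
    getD_flatMap_pair es i₀ d hd]
  rfl

theorem inputState_rmem (i : Fin n) (j : ℕ) (hj : j < 3) :
    (inputState S es).rmem (3 * i + j) =
      [(S.center i).re, (S.center i).im, S.f i].getD j 0 := by
  have h := getD_flatten_triple
    (List.ofFn fun i : Fin n => ((S.center i).re, (S.center i).im, S.f i)) i j hj (by simp)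
  rw [List.map_ofFn] at h
  simp only [List.getElem_ofFn] at h
  exact h

end RAM

namespace RAM

open SCS

/-! ### The program

Word registers: `0` holds `n`, `1` the number of darts, `2` the loop counter, `3`, `4`, `5` and `6`
the constants `1`, `2`, `16` and `0`. Real registers: `0` holds `π / 8`, `1` holds `0`, `7` holds
`2 * π`. Arrays: `0` slots, `1` starts of darts, `2` period permutation, `3` cycles, `4` indices in
cycles, `5` lengths of cycles, `6` counters, `7` marks. -/

/-- Word register `x` becomes the dart opposite to the dart in `y`. -/
def revStmt (x y : ℕ) : Stmt :=
  .word .mod 9 y 4 ;; .word .mul 9 4 9 ;; .word .add x y 3 ;; .word .sub x x 9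

/-- The trajectories of a dart, and the time of the link in units of `1 / (2 * π)`. -/
def phaseStmt : Stmt :=
  .word .add 7 0 2 ;; .input 8 7 ;; revStmt 7 2 ;; .word .add 7 0 7 ;; .input 9 7 ;;
  .const 10 3 ;; .word .mul 7 10 8 ;; .rinput 2 7 ;; .word .add 7 7 3 ;; .rinput 3 7 ;;
  .word .add 7 7 3 ;; .rinput 4 7 ;;
  .word .mul 7 10 9 ;; .rinput 5 7 ;; .word .add 7 7 3 ;; .rinput 6 7 ;;
  .real .sub 5 5 2 ;; .real .sub 6 6 3 ;; .real .angle 5 5 6 ;;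
  .input 11 8 ;;
  .ite (.weq 11 3) (.real .sub 5 5 4) (.real .sub 5 4 5) ;;
  .ite (.rlt 5 1) (.real .add 5 5 7) .skip ;;
  .const 12 0 ;; .real .add 6 0 1

/-- One comparison of the computation of the bucket of a dart. -/
def bucketStep : Stmt :=
  .ite (.rlt 5 6) .skip (.word .add 12 12 3 ;; .real .add 6 6 0)

/-- Enter a dart in the table of slots. -/
def slotStmt : Stmt :=
  .word .mul 7 5 8 ;; .word .add 7 7 12 ;; .word .add 9 2 3 ;; .put 0 7 9 ;; .word .add 2 2 3

def slotBody : Stmt := phaseStmt ;; Stmt.rep 15 bucketStep ;; slotStmt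

/-- The data of an execution on the SCS `S`. -/
structure Env.Presents {n : ℕ} {S : SCS n} (e : Env) (Δ : S.Darts) : Prop where
  pos : 0 < n
  base : e.base = n + 2 * Δ.edges
  direction : ∀ i : Fin n, e.word i = if S.g i = 1 then 1 else 0
  src : ∀ d < 2 * Δ.edges, e.word (n + d) = Δ.src d
  re : ∀ i : Fin n, e.real (3 * i) = (S.center i).re
  im : ∀ i : Fin n, e.real (3 * i + 1) = (S.center i).im
  angle : ∀ i : Fin n, e.real (3 * i + 2) = S.f i
  gcdRange : e.gcdRange = n
  bound : 8 * n ^ 3 + 1000 * n + 1000 ≤ e.bound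

/-- The registers that hold constants. -/
structure Consts (n m : ℕ) (c : Cfg) : Prop where
  r0 : c.reg 0 = n
  r1 : c.reg 1 = 2 * m
  r3 : c.reg 3 = 1
  r4 : c.reg 4 = 2
  r5 : c.reg 5 = 16
  r6 : c.reg 6 = 0

/-- The machine has no floor function. As `α` and `f i` both lie in `[0, 2π)`, their difference lies
in `(-2π, 2π)`, and one conditional addition of `2π` brings it into range. -/
theorem two_pi_mul_phase {n : ℕ} (S : SCS n) (i j : Fin n) :
    let α := toIcoMod Real.two_pi_pos 0 (Complex.arg ⟨(S.center j).re - (S.center i).re,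
      (S.center j).im - (S.center i).im⟩)
    let β := if S.g i = 1 then α - S.f i else S.f i - α
    2 * Real.pi * S.phase i j = if β < 0 then β + 2 * Real.pi else β := by
  intro α β
  have hz : (⟨(S.center j).re - (S.center i).re, (S.center j).im - (S.center i).im⟩ : ℂ) =
      S.center j - S.center i := by
    apply Complex.ext <;> simp
  have hpi := Real.two_pi_pos
  have hα := toIcoMod_mem_Ico Real.two_pi_pos 0 (Complex.arg (S.center j - S.center i))
  have hαe := toIcoMod_add_toIcoDiv_zsmul Real.two_pi_pos 0
    (Complex.arg (S.center j - S.center i))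
  have hα1 : α = toIcoMod Real.two_pi_pos 0 (Complex.arg (S.center j - S.center i)) := by
    rw [← hz]
  rw [← hα1] at hα hαe
  rw [zsmul_eq_mul] at hαe
  generalize toIcoDiv Real.two_pi_pos 0 (Complex.arg (S.center j - S.center i)) = N at hαe
  have hf := S.f_mem i
  simp only [zero_add, Set.mem_Ico] at hα hf
  have hβ : ∃ z : ℤ, (S.g i : ℝ) * (Complex.arg (S.center j - S.center i) - S.f i) - β =
      2 * Real.pi * z := by
    rcases S.g_eq i with hg | hg
    · refine ⟨N, ?_⟩
      simp only [β, hg, if_true]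
      push_cast
      linear_combination -hαe
    · refine ⟨-N, ?_⟩
      simp only [β, hg]
      norm_num
      linear_combination hαe
  obtain ⟨z, hz⟩ := hβ
  have hβ2 : -(2 * Real.pi) < β ∧ β < 2 * Real.pi := by
    simp only [β]
    split_ifs <;> constructor <;> linarith
  have key : ∀ γ : ℝ, 0 ≤ γ → γ < 2 * Real.pi → (∃ w : ℤ, γ = β + 2 * Real.pi * w) →
      2 * Real.pi * S.phase i j = γ := by
    rintro γ h0 h1 ⟨w, hw⟩
    have : S.phase i j = γ / (2 * Real.pi) := by
      rw [phase, Int.fract_eq_iff]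
      refine ⟨by positivity, by rwa [div_lt_one hpi], z - w, ?_⟩
      rw [← sub_div, div_eq_iff hpi.ne']
      push_cast
      linear_combination hz - hw
    rw [this]
    field_simp
  split_ifs with h
  · exact key _ (by linarith) (by linarith) ⟨1, by push_cast; ring⟩
  · exact key _ (by linarith) (by linarith) ⟨0, by push_cast; ring⟩

/-- Reals cannot be converted to words, so the floor is found by comparison with successive
multiples of `π / 8 = 2π / 16`; 15 comparisons are enough for 16 intervals. -/
theorem wp_bucketStep {e : Env} (he : 100 ≤ e.bound) {Q : Cfg → Prop} {c : Cfg} (h3 : c.reg 3 = 1)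
    {τ : ℝ} (hτ0 : 0 ≤ τ) (hτ1 : τ < 1) (h12 : c.reg 12 = 0) (hr0 : c.rreg 0 = Real.pi / 8)
    (hr5 : c.rreg 5 = 2 * Real.pi * τ) (hr6 : c.rreg 6 = Real.pi / 8)
    (hQ : ∀ x, Q ⟨Function.update c.reg 12 ⌊16 * τ⌋₊, c.arr, Function.update c.rreg 6 x⟩) :
    (Stmt.rep 15 bucketStep).wp e Q c := by
  have hpi := Real.pi_pos
  -- The counter `q` has either reached the floor, where it stays, or is still advancing with `q =
  -- k`.
  refine Stmt.wp_mono ?_ (Stmt.wp_rep (fun k c' => ∃ q : ℕ, q ≤ k ∧ q ≤ 16 * τ ∧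
    (16 * τ < q + 1 ∨ q = k) ∧ c' = ⟨Function.update c.reg 12 q, c.arr,
      Function.update c.rreg 6 ((q + 1) * (Real.pi / 8))⟩) ?_ ?_)
  · rintro c' ⟨q, hq, h1, h2, rfl⟩
    have : ⌊16 * τ⌋₊ = q := by
      rw [Nat.floor_eq_iff (by linarith)]
      refine ⟨h1, ?_⟩
      rcases h2 with h2 | rfl
      · exact h2
      · push_cast
        linarith
    rw [← this]
    exact hQ _
  · rintro k hk c' ⟨q, hq, h1, h2, rfl⟩
    simp only [bucketStep, Stmt.wp, Test.HoldsIn, WordOp.eval, RealOp.eval]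
    constructor
    · intro hlt
      simp [hr5] at hlt
      refine ⟨q, by omega, h1, Or.inl ?_, rfl⟩
      nlinarith
    · intro hlt
      simp [hr5] at hlt
      have h4 : (q : ℝ) + 1 ≤ 16 * τ := by nlinarith
      have hqk : q = k := by
        rcases h2 with h2 | h2
        · linarith
        · exact h2
      simp [h3, hr0]
      refine ⟨by omega, q + 1, by omega, by push_cast; exact h4, Or.inr (by omega), ?_, ?_⟩
      · rfl
      · congr 1
        push_cast
        ring
  · refine ⟨0, le_rfl, by push_cast; linarith, Or.inr rfl, ?_⟩
    have e1 : Function.update c.reg 12 0 = c.reg := by rw [← h12, Function.update_eq_self]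
    have e2 : Function.update c.rreg 6 (((0 : ℕ) + 1) * (Real.pi / 8)) = c.rreg := by
      rw [Function.update_eq_self_iff, hr6]
      simp
    rw [e1, e2]

/-- The table of slots contains the first `k` darts. -/
structure Slots {n : ℕ} {S : SCS n} (Δ : S.Darts) (k : ℕ) (A : ℕ → ℕ) : Prop where
  get : ∀ d < k, A (16 * Δ.src d + Δ.bkt d) = d + 1
  eq : ∀ a, A a ≠ 0 → ∃ d < k, a = 16 * Δ.src d + Δ.bkt d ∧ A a = d + 1

theorem Slots.succ {n : ℕ} {S : SCS n} {Δ : S.Darts} {k : ℕ} {A : ℕ → ℕ} (h : Slots Δ k A)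
    (hk : k < 2 * Δ.edges) :
    Slots Δ (k + 1) (Function.update A (16 * Δ.src k + Δ.bkt k) (k + 1)) where
  get d hd := by
    rcases Nat.lt_succ_iff_lt_or_eq.1 hd with h1 | rfl
    · rw [Function.update_of_ne, h.get d h1]
      intro h2
      have h3 := Δ.bkt_lt d
      have h4 := Δ.bkt_lt k
      exact h1.ne (Δ.eq_of_slot (by omega) hk (Fin.ext (by omega)) (by omega))
    · rw [Function.update_self]
  eq a ha := by
    by_cases h1 : a = 16 * Δ.src k + Δ.bkt k
    · exact ⟨k, Nat.lt_succ_self k, h1, by rw [h1, Function.update_self]⟩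
    · rw [Function.update_of_ne h1] at ha ⊢
      obtain ⟨d, hd, h2⟩ := h.eq a ha
      exact ⟨d, by omega, h2⟩

/-- The invariant of the loop that enters the darts in the table of slots. -/
structure SlotInv {n : ℕ} {S : SCS n} (Δ : S.Darts) (k : ℕ) (c : Cfg) : Prop where
  consts : Consts n Δ.edges c
  counter : c.reg 2 = k
  rr0 : c.rreg 0 = Real.pi / 8
  rr1 : c.rreg 1 = 0
  rr7 : c.rreg 7 = 2 * Real.pi
  slots : Slots Δ k (c.arr 0)
  zero : ∀ q, q ≠ 0 → c.arr q = fun _ => 0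

/-- The configuration after `phaseStmt`. -/
structure PhasePost {n : ℕ} {S : SCS n} (Δ : S.Darts) (k : ℕ) (c c' : Cfg) : Prop where
  low : ∀ r < 7, c'.reg r = c.reg r
  r8 : c'.reg 8 = Δ.src k
  r12 : c'.reg 12 = 0
  arr : c'.arr = c.arr
  rr0 : c'.rreg 0 = Real.pi / 8
  rr1 : c'.rreg 1 = 0
  rr7 : c'.rreg 7 = 2 * Real.pi
  rr5 : c'.rreg 5 = 2 * Real.pi * S.phase (Δ.src k) (Δ.src (rev k))
  rr6 : c'.rreg 6 = Real.pi / 8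

theorem wp_phaseStmt {n : ℕ} {S : SCS n} {Δ : S.Darts} {e : Env} (he : e.Presents Δ) {k : ℕ}
    (hk : k < 2 * Δ.edges) {c : Cfg} (hc : SlotInv Δ k c) :
    phaseStmt.wp e (PhasePost Δ k c) c := by
  obtain ⟨⟨r0, r1, r3, r4, r5, r6⟩, r2, rr0, rr1, rr7, hs, hz⟩ := hc
  have hB := he.bound
  have hb := he.base
  have hm := Δ.edges_le
  have hn := he.pos
  have hsrc := he.src k hk
  have hsl := (Δ.src k).2
  have hrev := rev_lt hk
  have htgt := he.src _ hrev
  have htl := (Δ.src (rev k)).2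
  have hdir := he.direction (Δ.src k)
  have hdir1 : (if S.g (Δ.src k) = 1 then 1 else 0) ≤ e.bound := by split_ifs <;> omega
  have hph := two_pi_mul_phase S (Δ.src k) (Δ.src (rev k))
  have hrev' : k + 1 - 2 * (k % 2) = rev k := rfl
  simp [phaseStmt, revStmt, Stmt.wp, WordOp.eval, RealOp.eval, Test.HoldsIn, r0, r2,
    r3, r4, rr0, rr1, rr7, hsrc, htgt, hdir, hrev', he.re, he.im, he.angle, add_assoc]
  generalize toIcoMod Real.two_pi_pos 0 (Complex.arg ⟨(S.center (Δ.src (rev k))).re -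
    (S.center (Δ.src k)).re, (S.center (Δ.src (rev k))).im - (S.center (Δ.src k)).im⟩) = α at hph ⊢
  simp only at hph
  have low : ∀ r < 7, r ≠ 7 ∧ r ≠ 8 ∧ r ≠ 9 ∧ r ≠ 10 ∧ r ≠ 11 ∧ r ≠ 12 := fun r hr => by omega
  refine ⟨by omega, by omega, by omega, by omega, by omega, by omega, by omega, by omega,
    by omega, by omega, by omega, by omega, by omega, by omega, by omega, by omega, by omega, hdir1,
    fun hg => ⟨fun h => ?_, fun h => ?_⟩, fun hg => ⟨fun h => ?_, fun h => ?_⟩⟩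
  · rw [if_pos hg, if_pos (by linarith)] at hph
    constructor <;> simp +contextual [low, rr0, rr1, rr7, hph]
  · rw [if_pos hg, if_neg (by linarith)] at hph
    constructor <;> simp +contextual [low, rr0, rr1, rr7, hph]
  · rw [if_neg hg, if_pos (by linarith)] at hph
    constructor <;> simp +contextual [low, rr0, rr1, rr7, hph]
  · rw [if_neg hg, if_neg (by linarith)] at hph
    constructor <;> simp +contextual [low, rr0, rr1, rr7, hph]

theorem wp_slotBody {n : ℕ} {S : SCS n} {Δ : S.Darts} {e : Env} (he : e.Presents Δ) {k : ℕ}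
    (hk : k < 2 * Δ.edges) {c : Cfg} (hc : SlotInv Δ k c) :
    slotBody.wp e (SlotInv Δ (k + 1)) c := by
  unfold slotBody
  refine Stmt.wp_seq (wp_phaseStmt he hk hc) fun c' hc' => ?_
  obtain ⟨⟨r0, r1, r3, r4, r5, r6⟩, r2, rr0, rr1, rr7, hs, hz⟩ := hc
  obtain ⟨low, r8, r12, harr, rr0', rr1', rr7', rr5', rr6'⟩ := hc'
  have hB := he.bound
  have hb := he.base
  have hm := Δ.edges_le
  have hn := he.pos
  have hsl := (Δ.src k).2
  have hbk := Δ.bkt_lt k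
  rw [← low _ (by norm_num)] at r0 r1 r2 r3 r4 r5 r6
  rw [← harr] at hs hz
  refine Stmt.wp_seq (Q₁ := slotStmt.wp e (SlotInv Δ (k + 1))) (wp_bucketStep (by omega) r3
    (S.phase_nonneg _ _) (S.phase_lt_one _ _) r12 rr0' rr5' rr6' fun x => ?_) fun _ h => h
  change slotStmt.wp e _ ⟨Function.update c'.reg 12 (Δ.bkt k), _, _⟩
  simp [slotStmt, Stmt.wp, WordOp.eval, r2, r3, r5, r8]
  refine ⟨by omega, by omega, by omega, by omega, by omega, ⟨?_, ?_, ?_, ?_, ?_, ?_, ?_⟩⟩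
  · constructor <;> simp [r0, r1, r3, r4, r5, r6]
  · simp
  · simpa using rr0'
  · simpa using rr1'
  · simpa using rr7'
  · simpa using hs.succ hk
  · intro q hq
    simp [hq, hz]

end RAM

namespace RAM

open SCS

/-! ### Following the tokens during one period -/

/-- One round of the walk of the token that starts in the trajectory in register `2`: register `13`
holds its trajectory, register `12` the number of the round. -/
def walkStep : Stmt :=
  .word .mul 7 5 13 ;; .word .add 7 7 12 ;; .get 0 8 7 ;;
  .ite (.weq 8 6) .skip
    (.word .sub 8 8 3 ;; .put 1 8 2 ;; revStmt 8 8 ;; .word .add 8 0 8 ;; .input 13 8) ;;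
  .word .add 12 12 3

def walkInit : Stmt := .word .add 13 2 6 ;; .const 12 0

def walkEnd : Stmt := .put 2 2 13 ;; .word .add 2 2 3

def walkBody : Stmt := walkInit ;; Stmt.rep 16 walkStep ;; walkEnd

/-- The invariant of the walk of token `v`, before round `q`. -/
structure WalkInv {n : ℕ} {S : SCS n} (Δ : S.Darts) (v : Fin n) (q : ℕ) (c : Cfg) : Prop where
  consts : Consts n Δ.edges c
  counter : c.reg 2 = v
  round : c.reg 12 = q
  trajectory : c.reg 13 = S.rpos q v
  slots : Slots Δ (2 * Δ.edges) (c.arr 0)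
  start : ∀ d < 2 * Δ.edges, (Δ.start d < v ∨ Δ.start d = v ∧ Δ.bkt d < q) →
    c.arr 1 d = Δ.start d
  period : ∀ x : Fin n, x < v → c.arr 2 x = S.period x
  zero : ∀ q, 3 ≤ q → c.arr q = fun _ => 0

theorem wp_walkStep {n : ℕ} {S : SCS n} {Δ : S.Darts} {e : Env} (he : e.Presents Δ) {v : Fin n}
    {q : ℕ} (hq : q < 16) {c : Cfg} (hc : WalkInv Δ v q c) :
    walkStep.wp e (WalkInv Δ v (q + 1)) c := by
  obtain ⟨⟨r0, r1, r3, r4, r5, r6⟩, r2, r12, r13, hs, hst, hp, hz⟩ := hc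
  have hB := he.bound
  have hb := he.base
  have hm := Δ.edges_le
  have hn := he.pos
  have hv := v.2
  have hj := (S.rpos q v).2
  have hround : S.rpos (q + 1) v = S.round q (S.rpos q v) := by
    rw [rpos_succ_apply, Nat.mod_eq_of_lt hq]
  have hstart : ∀ d < 2 * Δ.edges, Δ.start d = v → Δ.bkt d = q →
      c.arr 0 (16 * (S.rpos q v : ℕ) + q) = d + 1 := by
    intro d hd h1 h2
    have h3 := (Δ.start_eq_iff d v).1 h1
    rw [h2] at h3
    rw [h3, ← h2]
    exact hs.get d hd
  -- Entries of the slot table are dart numbers plus one; zero means that the current trajectory has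
  -- no link in this interval, and the token stays.
  rcases Nat.eq_zero_or_pos (c.arr 0 (16 * (S.rpos q v : ℕ) + q)) with h0 | h0
  · simp [walkStep, revStmt, Stmt.wp, WordOp.eval, Test.HoldsIn, r3, r5, r6, r12, r13, h0]
    refine ⟨by omega, by omega, by omega, by omega, ⟨?_, ?_, ?_, ?_, ?_, ?_, ?_, ?_⟩⟩
    · constructor <;> simp [r0, r1, r3, r4, r5, r6]
    · simpa using r2
    · simp
    · rw [hround, round_eq_self]
      · simpa using r13
      · rintro ⟨j, hj, hjq⟩
        obtain ⟨d, hd, h1, h2⟩ := Δ.surj _ _ hj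
        have hbk : Δ.bkt d = q := by rw [Darts.bkt, h1, h2, hjq]
        have := hs.get d hd
        rw [h1, hbk] at this
        omega
    · exact hs
    · intro d hd h
      refine hst d hd (h.imp_right fun h => ⟨h.1, ?_⟩)
      rcases Nat.lt_succ_iff_lt_or_eq.1 h.2 with h2 | h2
      · exact h2
      · have := hstart d hd h.1 h2
        omega
    · exact hp
    · exact hz
  · obtain ⟨d, hd, ha, hx⟩ := hs.eq _ h0.ne'
    have hbd := Δ.bkt_lt d
    have hbk : Δ.bkt d = q := by omega
    have hsrc : Δ.src d = S.rpos q v := Fin.ext (by omega)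
    have hrev := rev_lt hd
    have hrev' : d + 1 - 2 * (d % 2) = rev d := rfl
    have htgt := he.src _ hrev
    have htl := (Δ.src (rev d)).2
    simp [walkStep, revStmt, Stmt.wp, WordOp.eval, Test.HoldsIn, r0, r2, r3, r4, r5, r6, r12, r13,
      hx, hrev', htgt]
    refine ⟨by omega, by omega, by omega, by omega, by omega, by omega, by omega, by omega,
      by omega, by omega, by omega, by omega, by omega, by omega, by omega,
      ⟨?_, ?_, ?_, ?_, ?_, ?_, ?_, ?_⟩⟩
    · constructor <;> simp [r0, r1, r3, r4, r5, r6]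
    · simpa using r2
    · simp
    · rw [hround, ← hsrc, ← hbk, Δ.round_src hd]
      simp
    · simpa using hs
    · intro d' hd' h
      by_cases hdd : d' = d
      · subst hdd
        -- Token `v` is crossing dart `d'` in this round, so `v` is the start to be recorded.
        have : Δ.start d' = v := by rw [Δ.start_eq_iff, hbk, hsrc]
        simp [this]
      · simp only [Function.update_self, Function.update_of_ne hdd]
        refine hst d' hd' (h.imp_right fun h => ⟨h.1, ?_⟩)
        rcases Nat.lt_succ_iff_lt_or_eq.1 h.2 with h2 | h2
        · exact h2
        · have := hstart d' hd' h.1 h2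
          omega
    · simpa using hp
    · intro q' hq'
      have : q' ≠ 1 := by
        rintro rfl
        exact absurd hq' (by decide)
      simpa [this] using hz q' hq'

/-- The invariant of the loop over the walks. -/
structure StartInv {n : ℕ} {S : SCS n} (Δ : S.Darts) (v : ℕ) (c : Cfg) : Prop where
  consts : Consts n Δ.edges c
  counter : c.reg 2 = v
  slots : Slots Δ (2 * Δ.edges) (c.arr 0)
  start : ∀ d < 2 * Δ.edges, Δ.start d < v → c.arr 1 d = Δ.start d
  period : ∀ x : Fin n, x < v → c.arr 2 x = S.period x
  zero : ∀ q, 3 ≤ q → c.arr q = fun _ => 0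

theorem wp_walkBody {n : ℕ} {S : SCS n} {Δ : S.Darts} {e : Env} (he : e.Presents Δ) {v : ℕ}
    (hv : v < n) {c : Cfg} (hc : StartInv Δ v c) : walkBody.wp e (StartInv Δ (v + 1)) c := by
  obtain ⟨⟨r0, r1, r3, r4, r5, r6⟩, r2, hs, hst, hp, hz⟩ := hc
  have hB := he.bound
  have hb := he.base
  have hm := Δ.edges_le
  have hinit : walkInit.wp e (WalkInv Δ ⟨v, hv⟩ 0) c := by
    simp only [walkInit, Stmt.wp, WordOp.eval, r2, r6]
    refine ⟨by omega, by omega, ?_, ?_, ?_, ?_, hs, ?_, hp, hz⟩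
    · constructor <;> simp [r0, r1, r3, r4, r5, r6]
    · simpa using r2
    · simp
    · simp [rpos]
    · rintro d hd (h | h)
      · exact hst d hd h
      · exact absurd h.2 (Nat.not_lt_zero _)
  unfold walkBody
  refine Stmt.wp_seq hinit fun c₁ hc₁ => ?_
  refine Stmt.wp_seq (Stmt.wp_rep (WalkInv Δ ⟨v, hv⟩)
    (fun q hq c' hc' => wp_walkStep he hq hc') hc₁) fun c' hc' => ?_
  obtain ⟨⟨r0, r1, r3, r4, r5, r6⟩, r2, r12, r13, hs, hst, hp, hz⟩ := hc'
  have hj := (S.rpos 16 ⟨v, hv⟩).2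
  simp [walkEnd, Stmt.wp, WordOp.eval, r2, r3, r13]
  refine ⟨by omega, by omega, by omega, ⟨?_, ?_, ?_, ?_, ?_, ?_⟩⟩
  · constructor <;> simp [r0, r1, r3, r4, r5, r6]
  · simp
  · simpa using hs
  · intro d hd h
    simp only [ne_eq, Fin.reduceEq, not_false_eq_true, Function.update_of_ne]
    refine hst d hd ?_
    rcases Nat.lt_succ_iff_lt_or_eq.1 h with h | h
    · exact Or.inl h
    -- There are only 16 intervals, so after 16 rounds all darts crossed by this token are recorded.
    · exact Or.inr ⟨Fin.ext h, Δ.bkt_lt d⟩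
  · intro x hx
    rcases Nat.lt_succ_iff_lt_or_eq.1 hx with h | h
    · simp only [Function.update_self]
      rw [Function.update_of_ne h.ne]
      exact hp x h
    · have : x = ⟨v, hv⟩ := Fin.ext h
      rw [this]
      simp [period]
  · intro q' hq'
    have : q' ≠ 2 := by
      rintro rfl
      exact absurd hq' (by decide)
    simpa [this] using hz q' hq'

/-! ### Labelling the cycles -/

/-- One step along the cycles: register `15` holds the start `v` of the current walk, `16` the
current trajectory, `17` the number of steps from `v`. -/
def cycleBody : Stmt :=
  .ite (.wlt 15 0)
    (.get 3 8 16 ;;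
      .ite (.weq 8 6)
        (.word .add 9 15 3 ;; .put 3 16 9 ;; .put 4 16 17 ;; .word .add 17 17 3 ;; .get 2 16 16)
        (.put 5 15 17 ;; .word .add 15 15 3 ;; .word .add 16 15 6 ;; .const 17 0))
    .skip ;;
  .word .add 2 2 3

open Classical in
/-- The trajectories that have been visited after `k` steps from `v`. -/
noncomputable def visited {n : ℕ} (σ : Equiv.Perm (Fin n)) (v k : ℕ) : Finset (Fin n) :=
  Finset.univ.filter fun x => (σ.lead x : ℕ) < v ∨ (σ.lead x : ℕ) = v ∧ σ.cycleIdx x < k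

theorem mem_visited {n : ℕ} {σ : Equiv.Perm (Fin n)} {v k : ℕ} {x : Fin n} :
    x ∈ visited σ v k ↔ (σ.lead x : ℕ) < v ∨ (σ.lead x : ℕ) = v ∧ σ.cycleIdx x < k := by
  simp [visited]

/-- All cycles with a smaller leader have been visited, so an unvisited element on the walk from `v`
shows that `v` leads its cycle. -/
theorem lead_eq_of_notMem_visited {n : ℕ} {σ : Equiv.Perm (Fin n)} {v : Fin n} {k : ℕ}
    (h : (σ ^ k) v ∉ visited σ v k) : σ.lead v = v := by
  rw [mem_visited, Equiv.Perm.lead_pow_apply] at h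
  push Not at h
  exact le_antisymm (σ.lead_le Equiv.Perm.SameCycle.rfl) h.1

theorem lt_of_notMem_visited {n : ℕ} {σ : Equiv.Perm (Fin n)} {v : Fin n} {k : ℕ}
    (h : (σ ^ k) v ∉ visited σ v k) (hk : k ≤ σ.cycleLen v) : k < σ.cycleLen v := by
  have hl := lead_eq_of_notMem_visited h
  refine lt_of_le_of_ne hk fun hkl => ?_
  have h1 : (σ ^ k) v = v := by
    have := (σ.pow_apply_eq_pow_apply_iff k 0 v).2 (by simp [hkl, Nat.ModEq])
    simpa using this
  rw [h1, mem_visited, hl] at h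
  have h2 : σ.cycleIdx v < σ.cycleLen v := by
    have := σ.cycleIdx_lt v
    rwa [hl] at this
  omega

theorem visited_succ {n : ℕ} {σ : Equiv.Perm (Fin n)} {v : Fin n} {k : ℕ}
    (hl : σ.lead v = v) (hk : k < σ.cycleLen v) :
    visited σ v (k + 1) = insert ((σ ^ k) v) (visited σ v k) := by
  ext x
  rw [Finset.mem_insert, mem_visited, mem_visited]
  constructor
  · rintro (h | ⟨h1, h2⟩)
    · exact Or.inr (Or.inl h)
    · rcases Nat.lt_succ_iff_lt_or_eq.1 h2 with h3 | h3
      · exact Or.inr (Or.inr ⟨h1, h3⟩)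
      · left
        rw [← h3, ← (Fin.ext h1 : σ.lead x = v), σ.pow_cycleIdx]
  · rintro (rfl | h | h)
    · right
      rw [Equiv.Perm.lead_pow_apply, hl, σ.cycleIdx_pow_lead hl hk]
      exact ⟨rfl, Nat.lt_succ_self k⟩
    · exact Or.inl h
    · exact Or.inr ⟨h.1, h.2.trans (Nat.lt_succ_self k)⟩

/-- A walk that starts at a leader meets a visited trajectory only when it closes up, so the step
counter is then the cycle length. -/
theorem eq_cycleLen_of_mem_visited {n : ℕ} {σ : Equiv.Perm (Fin n)} {v : Fin n} {k : ℕ}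
    (h : (σ ^ k) v ∈ visited σ v k) (hl : σ.lead v = v) (hk : k ≤ σ.cycleLen v) :
    k = σ.cycleLen v := by
  refine le_antisymm hk (not_lt.1 fun hlt => ?_)
  rw [mem_visited, Equiv.Perm.lead_pow_apply, hl, σ.cycleIdx_pow_lead hl hlt] at h
  omega

/-- Either `v` is not a leader and contributes nothing, or its whole cycle has been labelled; in
both cases the walk may pass to `v + 1`. -/
theorem visited_eq_of_mem {n : ℕ} {σ : Equiv.Perm (Fin n)} {v : Fin n} {k : ℕ}
    (h : (σ ^ k) v ∈ visited σ v k) (hk : k ≤ σ.cycleLen v) :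
    visited σ (v + 1) 0 = visited σ v k := by
  ext x
  rw [mem_visited, mem_visited]
  have key : (σ.lead x : ℕ) = v → σ.cycleIdx x < k := by
    intro hx
    have hx' : σ.lead x = v := Fin.ext hx
    have hl : σ.lead v = v := by rw [← hx', σ.lead_lead]
    rw [eq_cycleLen_of_mem_visited h hl hk]
    have := σ.cycleIdx_lt x
    rwa [hx'] at this
  constructor
  · rintro (h1 | h1)
    · rcases Nat.lt_succ_iff_lt_or_eq.1 h1 with h2 | h2
      · exact Or.inl h2
      · exact Or.inr ⟨h2, key h2⟩
    · exact absurd h1.2 (Nat.not_lt_zero _)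
  · rintro (h1 | h1) <;> left <;> omega

/-- The arrays of labels, when the trajectories in `visited σ v k` have been visited. -/
structure Labels {n : ℕ} (σ : Equiv.Perm (Fin n)) (v k : ℕ) (A : Fin 8 → ℕ → ℕ) : Prop where
  cycle : ∀ x ∈ visited σ v k, A 3 x = σ.lead x + 1
  idx : ∀ x ∈ visited σ v k, A 4 x = σ.cycleIdx x
  unvisited : ∀ x ∉ visited σ v k, A 3 x = 0
  len : ∀ a : Fin n, a < v → σ.lead a = a → A 5 a = σ.cycleLen a

/-- The invariant of the loop that labels the cycles. -/
structure CycleInv {n : ℕ} {S : SCS n} (Δ : S.Darts) (t : ℕ) (c : Cfg) : Prop where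
  consts : Consts n Δ.edges c
  counter : c.reg 2 = t
  limit : c.reg 14 = 2 * n
  start : ∀ d < 2 * Δ.edges, c.arr 1 d = Δ.start d
  period : ∀ x : Fin n, c.arr 2 x = S.period x
  zero : ∀ q, 6 ≤ q → c.arr q = fun _ => 0
  vLe : c.reg 15 ≤ n
  labels : Labels S.period (c.reg 15) (c.reg 17) c.arr
  walk : ∀ v : Fin n, c.reg 15 = v → c.reg 16 = (S.period ^ c.reg 17) v ∧
    c.reg 17 ≤ S.period.cycleLen v ∧ (0 < c.reg 17 → S.period.lead v = v)
  finished : c.reg 15 = n → c.reg 17 = 0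
  time : c.reg 15 = n ∨ t ≤ c.reg 15 + (visited S.period (c.reg 15) (c.reg 17)).card

/-- The nested search over starts and cycles is flattened into one loop. Until the starts are
exhausted, each iteration increases the potential `v + (visited ..).card` by one, either with a new
label or with a new start; afterwards it idles. Since the potential is at most `2 * n`, that many
iterations suffice. -/
theorem wp_cycleBody {n : ℕ} {S : SCS n} {Δ : S.Darts} {e : Env} (he : e.Presents Δ) {t : ℕ}
    (ht : t < 2 * n) {c : Cfg} (hc : CycleInv Δ t c) : cycleBody.wp e (CycleInv Δ (t + 1)) c := by
  obtain ⟨⟨r0, r1, r3, r4, r5, r6⟩, r2, r14, hst, hp, hz, hvle, hlab, hwalk, hfin, htime⟩ := hc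
  have hB := he.bound
  have hb := he.base
  have hm := Δ.edges_le
  rcases hvle.lt_or_eq with hvn | hvn
  · obtain ⟨v, hv⟩ : ∃ v : Fin n, c.reg 15 = v := ⟨⟨_, hvn⟩, rfl⟩
    obtain ⟨h16, hk, hlead⟩ := hwalk v hv
    obtain ⟨k, hkk⟩ : ∃ k, c.reg 17 = k := ⟨_, rfl⟩
    rw [hkk] at h16 hk hlead
    rw [hv, hkk] at hlab htime
    have hv2 := v.2
    have hkn := hk.trans (S.period.cycleLen_le v)
    have htime' : t ≤ v + (visited S.period v k).card := by
      rcases htime with h | h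
      · omega
      · exact h
    have hcur := ((S.period ^ k) v).2
    have hnext := (S.period ((S.period ^ k) v)).2
    by_cases hvis : (S.period ^ k) v ∈ visited S.period v k
    · have h3 := hlab.cycle _ hvis
      have hll := (S.period.lead ((S.period ^ k) v)).2
      simp [cycleBody, Stmt.wp, WordOp.eval, Test.HoldsIn, r0, r2, r3, r6, h16, hv, hkk, h3]
      and_intros
      any_goals omega
      refine ⟨?_, ?_, ?_, ?_, ?_, ?_, ?_, ?_, ?_, ?_, ?_⟩
      · constructor <;> simp [r0, r1, r3, r4, r5, r6]
      · simp
      · simpa using r14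
      · simpa using hst
      · simpa using hp
      · intro q hq
        have : q ≠ 5 := by
          rintro rfl
          exact absurd hq (by decide)
        simpa [this] using hz q hq
      · simp
      · simp only [ne_eq, Nat.reduceEqDiff, not_false_eq_true, Function.update_of_ne,
          Function.update_self]
        have hve := visited_eq_of_mem hvis hk
        refine ⟨?_, ?_, ?_, ?_⟩
        · simpa [hve] using hlab.cycle
        · simpa [hve] using hlab.idx
        · simpa [hve] using hlab.unvisited
        · intro a ha hla
          rcases Nat.lt_succ_iff_lt_or_eq.1 ha with h | h
          · rw [Function.update_self, Function.update_of_ne h.ne]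
            exact hlab.len a h hla
          · have : a = v := Fin.ext h
            subst this
            simpa using eq_cycleLen_of_mem_visited hvis hla hk
      · intro w hw
        simp at hw
        simp [hw]
      · simp
      · right
        simp [visited_eq_of_mem hvis hk]
        omega
    · have hl := lead_eq_of_notMem_visited hvis
      have hklt := lt_of_notMem_visited hvis hk
      have h3 := hlab.unvisited _ hvis
      have hpow : (S.period ^ (k + 1)) v = S.period ((S.period ^ k) v) := by
        rw [pow_succ']
        rfl
      have hvs := visited_succ hl hklt
      simp [cycleBody, Stmt.wp, WordOp.eval, Test.HoldsIn, r0, r2, r3, r6, h16, hv, hkk, h3, hp]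
      and_intros
      any_goals omega
      refine ⟨?_, ?_, ?_, ?_, ?_, ?_, ?_, ?_, ?_, ?_, ?_⟩
      · constructor <;> simp [r0, r1, r3, r4, r5, r6]
      · simp
      · simpa using r14
      · simpa using hst
      · simpa using hp
      · intro q hq
        have h1 : q ≠ 3 := by
          rintro rfl
          exact absurd hq (by decide)
        have h2 : q ≠ 4 := by
          rintro rfl
          exact absurd hq (by decide)
        simpa [h1, h2] using hz q hq
      · simp [hv]
      · simp only [ne_eq, Nat.reduceEqDiff, not_false_eq_true, Function.update_of_ne,
          Function.update_self, hv]
        refine ⟨?_, ?_, ?_, ?_⟩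
        · intro x hx
          by_cases hxc : x = (S.period ^ k) v
          · subst hxc
            simp [Equiv.Perm.lead_pow_apply, hl]
          · have hxv : (x : ℕ) ≠ (S.period ^ k) v := fun h => hxc (Fin.ext h)
            rw [hvs, Finset.mem_insert] at hx
            simpa [hxv] using hlab.cycle x (hx.resolve_left hxc)
        · intro x hx
          by_cases hxc : x = (S.period ^ k) v
          · subst hxc
            simp [S.period.cycleIdx_pow_lead hl hklt]
          · have hxv : (x : ℕ) ≠ (S.period ^ k) v := fun h => hxc (Fin.ext h)
            rw [hvs, Finset.mem_insert] at hx
            simpa [hxv] using hlab.idx x (hx.resolve_left hxc)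
        · intro x hx
          rw [hvs, Finset.mem_insert, not_or] at hx
          have hxv : (x : ℕ) ≠ (S.period ^ k) v := fun h => hx.1 (Fin.ext h)
          simpa [hxv] using hlab.unvisited x hx.2
        · simpa using hlab.len
      · intro w hw
        simp [hv] at hw
        have : w = v := Fin.ext hw.symm
        subst this
        simp [hpow, hl]
        omega
      · simp [hv]
        omega
      · right
        simp only [ne_eq, Nat.reduceEqDiff, not_false_eq_true, Function.update_of_ne,
          Function.update_self, hv, hvs, Finset.card_insert_of_notMem hvis]
        omega
  · have h17 := hfin hvn
    simp [cycleBody, Stmt.wp, WordOp.eval, Test.HoldsIn, r0, r2, r3, hvn]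
    and_intros
    any_goals omega
    refine ⟨?_, ?_, ?_, hst, hp, hz, ?_, ?_, ?_, ?_, ?_⟩
    · constructor <;> simp [r0, r1, r3, r4, r5, r6]
    · simp
    · simpa using r14
    · simpa using hvle
    · simpa using hlab
    · intro v hv
      have := v.2
      simp [hvn] at hv
      omega
    · simp [h17]
    · simp [hvn]

end RAM

namespace RAM

open SCS

/-! ### Counting the tokens that meet -/

/-- Compute the key of a dart: the cycles in registers `9` and `10` and the shift in register `8`. -/
def keyStmt : Stmt :=
  .get 1 7 2 ;; revStmt 8 2 ;; .get 1 8 8 ;;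
  .get 3 9 7 ;; .word .sub 9 9 3 ;; .get 3 10 8 ;; .word .sub 10 10 3 ;;
  .get 5 11 9 ;; .get 5 12 10 ;; .gcd 13 11 12 ;;
  .get 4 7 7 ;; .get 4 8 8 ;; .word .add 8 8 11 ;; .word .sub 8 8 7 ;; .word .mod 8 8 13

/-- Count the tokens that meet at a dart, unless their orbit has been counted. -/
def markStmt : Stmt :=
  .word .mul 7 9 0 ;; .word .add 7 7 10 ;; .word .mul 7 7 0 ;; .word .add 7 7 8 ;;
  .get 7 8 7 ;;
  .ite (.weq 8 6)
    (.put 7 7 3 ;; .word .div 12 12 13 ;; .get 6 8 9 ;; .word .add 8 8 12 ;; .put 6 9 8)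
    .skip ;;
  .word .add 2 2 3

def countBody : Stmt := keyStmt ;; markStmt

/-- The index of the mark of a key. -/
def keyCode {n : ℕ} (κ : Fin n × Fin n × ℕ) : ℕ := (κ.1 * n + κ.2.1) * n + κ.2.2

theorem keyCode_lt {n : ℕ} {κ : Fin n × Fin n × ℕ} (h : κ.2.2 < n) : keyCode κ < n ^ 3 := by
  obtain ⟨a, b, r⟩ := κ
  have ha := a.2
  have hb := b.2
  simp only [keyCode] at h ⊢
  have h1 : (a + 1) * n ≤ n * n := Nat.mul_le_mul_right n ha
  have h2 : (a : ℕ) * n + b + 1 ≤ n * n := by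
    rw [Nat.succ_mul] at h1
    omega
  have h3 := Nat.mul_le_mul_right n h2
  rw [Nat.succ_mul] at h3
  rw [pow_succ, pow_two]
  omega

/-- The code is written in base `n`; the third digit is below `n` for keys of darts, because a gcd
of cycle lengths is at most `n`. -/
theorem keyCode_inj {n : ℕ} {κ κ' : Fin n × Fin n × ℕ} (h : κ.2.2 < n) (h' : κ'.2.2 < n)
    (he : keyCode κ = keyCode κ') : κ = κ' := by
  obtain ⟨a, b, r⟩ := κ
  obtain ⟨a', b', r'⟩ := κ'
  simp only [keyCode] at h h' he
  have hn : 0 < n := a.pos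
  have key : ∀ x y r r' : ℕ, r < n → r' < n → x * n + r = y * n + r' → x = y ∧ r = r' := by
    intro x y r r' hr hr' hxy
    have h1 := congrArg (· / n) hxy
    have h2 := congrArg (· % n) hxy
    simp only [hr, hr', Nat.mul_comm _ n,
      Nat.mul_add_div hn, Nat.div_eq_of_lt, Nat.mul_add_mod, Nat.mod_eq_of_lt, add_zero] at h1 h2
    exact ⟨h1, h2⟩
  obtain ⟨h1, rfl⟩ := key _ _ _ _ h h' he
  obtain ⟨h2, h3⟩ := key _ _ _ _ b.2 b'.2 h1
  rw [Fin.ext h2, Fin.ext h3]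

/-- The invariant of the loop that counts. -/
structure CountInv {n : ℕ} {S : SCS n} (Δ : S.Darts) (k : ℕ) (c : Cfg) : Prop where
  consts : Consts n Δ.edges c
  counter : c.reg 2 = k
  start : ∀ d < 2 * Δ.edges, c.arr 1 d = Δ.start d
  cycle : ∀ x : Fin n, c.arr 3 x = S.period.lead x + 1
  idx : ∀ x : Fin n, c.arr 4 x = S.period.cycleIdx x
  len : ∀ x : Fin n, c.arr 5 (S.period.lead x) = S.period.cycleLen (S.period.lead x)
  count : ∀ a : Fin n, c.arr 6 a = Δ.count k a
  marked : ∀ κ ∈ Δ.keys k, c.arr 7 (keyCode κ) = 1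
  unmarked : ∀ κ : Fin n × Fin n × ℕ, κ.2.2 < n → κ ∉ Δ.keys k → c.arr 7 (keyCode κ) = 0

theorem key_lt {n : ℕ} {S : SCS n} (Δ : S.Darts) (d : ℕ) : (Δ.key d).2.2 < n :=
  (S.period.shift_lt _ _).trans_le
    ((Nat.gcd_le_left _ (S.period.cycleLen_pos _)).trans (S.period.cycleLen_le _))

/-- The configuration after `keyStmt`. -/
structure KeyPost {n : ℕ} {S : SCS n} (Δ : S.Darts) (k : ℕ) (c c' : Cfg) : Prop where
  low : ∀ r < 7, c'.reg r = c.reg r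
  arr : c'.arr = c.arr
  r8 : c'.reg 8 = (Δ.key k).2.2
  r9 : c'.reg 9 = (Δ.key k).1
  r10 : c'.reg 10 = (Δ.key k).2.1
  r12 : c'.reg 12 = S.period.cycleLen (Δ.key k).2.1
  r13 : c'.reg 13 = Nat.gcd (S.period.cycleLen (Δ.key k).1) (S.period.cycleLen (Δ.key k).2.1)

theorem wp_keyStmt {n : ℕ} {S : SCS n} {Δ : S.Darts} {e : Env} (he : e.Presents Δ) {k : ℕ}
    (hk : k < 2 * Δ.edges) {c : Cfg} (hc : CountInv Δ k c) :
    keyStmt.wp e (KeyPost Δ k c) c := by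
  obtain ⟨⟨r0, r1, r3, r4, r5, r6⟩, r2, hst, hcy, hidx, hlen, -, -, -⟩ := hc
  have hB := he.bound
  have hb := he.base
  have hm := Δ.edges_le
  have hgr := he.gcdRange
  have hrev := rev_lt hk
  have hrev' : k + 1 - 2 * (k % 2) = rev k := rfl
  have hs1 := hst k hk
  have hs2 := hst _ hrev
  have hkey : Δ.key k = (S.period.lead (Δ.start k), S.period.lead (Δ.start (rev k)),
      S.period.shift (Δ.start k) (Δ.start (rev k))) := rfl
  have hkl := key_lt Δ k
  simp only [hkey] at hkl
  generalize Δ.start k = u at hs1 hkey hkl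
  generalize Δ.start (rev k) = w at hs2 hkey hkl
  have hsh : (S.period.cycleIdx w + S.period.cycleLen (S.period.lead u) - S.period.cycleIdx u) %
      Nat.gcd (S.period.cycleLen (S.period.lead u)) (S.period.cycleLen (S.period.lead w)) =
      S.period.shift u w := rfl
  have hu2 := u.2
  have hw2 := w.2
  have hlu := (S.period.lead u).2
  have hlw := (S.period.lead w).2
  have hiu := S.period.cycleIdx_lt u
  have hiw := S.period.cycleIdx_lt w
  have hcu := S.period.cycleLen_le (S.period.lead u)
  have hcw := S.period.cycleLen_le (S.period.lead w)
  have hcu0 := S.period.cycleLen_pos (S.period.lead u)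
  have hcw0 := S.period.cycleLen_pos (S.period.lead w)
  have low : ∀ r < 7, r ≠ 7 ∧ r ≠ 8 ∧ r ≠ 9 ∧ r ≠ 10 ∧ r ≠ 11 ∧ r ≠ 12 ∧ r ≠ 13 :=
    fun r hr => by omega
  simp [keyStmt, revStmt, Stmt.wp, WordOp.eval, r2, r3, r4, hs1, hs2, hrev', hcy, hlen, hidx, hsh]
  and_intros
  any_goals omega
  constructor <;> simp +contextual [low, hkey]

theorem wp_markStmt {n : ℕ} {S : SCS n} {Δ : S.Darts} {e : Env} (he : e.Presents Δ) {k : ℕ}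
    (hk : k < 2 * Δ.edges) {c₀ c : Cfg} (hc₀ : CountInv Δ k c₀) (hc : KeyPost Δ k c₀ c) :
    markStmt.wp e (CountInv Δ (k + 1)) c := by
  obtain ⟨⟨r0, r1, r3, r4, r5, r6⟩, r2, hst, hcy, hidx, hlen, hcnt, hma, hun⟩ := hc₀
  obtain ⟨low, harr, r8, r9, r10, r12, r13⟩ := hc
  rw [← low _ (by norm_num)] at r0 r1 r2 r3 r4 r5 r6
  rw [← harr] at hst hcy hidx hlen hcnt hma hun
  have hB := he.bound
  have hb := he.base
  have hm := Δ.edges_le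
  have hkl := key_lt Δ k
  have hcode := keyCode_lt hkl
  have hcd : ((Δ.key k).1 * n + (Δ.key k).2.1) * n + (Δ.key k).2.2 = keyCode (Δ.key k) := rfl
  -- The bound at `k + 1` also covers the new value of the counter before it is written.
  have hcount := Δ.count_le hk (Δ.start k)
  have hnm := Δ.count_succ_of_notMem (k := k)
  have hmm := Δ.count_succ_of_mem (k := k)
  have hwt : S.period.cycleLen (Δ.key k).2.1 /
      Nat.gcd (S.period.cycleLen (Δ.key k).1) (S.period.cycleLen (Δ.key k).2.1) =
      S.period.keyWeight (Δ.key k) := rfl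
  have hkeys := Δ.keys_succ k
  change Δ.count (k + 1) (Δ.key k).1 ≤ n at hcount
  have hla := (Δ.key k).1.2
  have hle1 : ((Δ.key k).1 : ℕ) * n + (Δ.key k).2.1 ≤ keyCode (Δ.key k) := by
    rw [← hcd]
    nlinarith
  have hle0 : ((Δ.key k).1 : ℕ) * n ≤ keyCode (Δ.key k) := (Nat.le_add_right _ _).trans hle1
  have hle2 : (((Δ.key k).1 : ℕ) * n + (Δ.key k).2.1) * n ≤ keyCode (Δ.key k) := by omega
  by_cases hmem : Δ.key k ∈ Δ.keys k
  · have h7 := hma _ hmem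
    simp only [markStmt, Stmt.wp, WordOp.eval, Test.HoldsIn]
    simp [r0, r2, r3, r6, r8, r9, r10, hcd, h7]
    and_intros
    any_goals omega
    refine ⟨?_, ?_, ?_, ?_, ?_, ?_, ?_, ?_, ?_⟩
    · constructor <;> simp [r0, r1, r3, r4, r5, r6]
    · simp
    · exact hst
    · exact hcy
    · exact hidx
    · exact hlen
    · intro a
      rw [hmm hmem]
      exact hcnt a
    · rw [hkeys, Finset.insert_eq_of_mem hmem]
      exact hma
    · rw [hkeys, Finset.insert_eq_of_mem hmem]
      exact hun
  · have h7 := hun _ hkl hmem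
    have hcs := hnm hmem (Δ.key k).1
    rw [if_pos rfl] at hcs
    simp only [markStmt, Stmt.wp, WordOp.eval, Test.HoldsIn]
    simp [r0, r2, r3, r6, r8, r9, r10, r12, r13, hcd, h7, hcnt, hwt, ← hcs]
    and_intros
    any_goals omega
    refine ⟨?_, ?_, ?_, ?_, ?_, ?_, ?_, ?_, ?_⟩
    · constructor <;> simp [r0, r1, r3, r4, r5, r6]
    · simp
    · simpa using hst
    · simpa using hcy
    · simpa using hidx
    · simpa using hlen
    · intro a
      simp only [Function.update_self]
      by_cases ha : a = (Δ.key k).1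
      · rw [ha, Function.update_self]
      · have hav : (a : ℕ) ≠ (Δ.key k).1 := fun h => ha (Fin.ext h)
        rw [Function.update_of_ne hav, hnm hmem, if_neg ha]
        simpa using hcnt a
    · intro κ hκ
      rw [hkeys, Finset.mem_insert] at hκ
      rcases hκ with rfl | hκ
      · simp
      · obtain ⟨d, -, rfl⟩ := Δ.mem_keys.1 hκ
        have hne : keyCode (Δ.key d) ≠ keyCode (Δ.key k) := fun h =>
          hmem (keyCode_inj (key_lt Δ d) (key_lt Δ k) h ▸ hκ)
        simpa [hne] using hma _ hκ
    · intro κ hκn hκ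
      rw [hkeys, Finset.mem_insert, not_or] at hκ
      have hne : keyCode κ ≠ keyCode (Δ.key k) := fun h =>
        hκ.1 (keyCode_inj hκn (key_lt Δ k) h)
      simpa [hne] using hun _ hκn hκ.2

theorem wp_countBody {n : ℕ} {S : SCS n} {Δ : S.Darts} {e : Env} (he : e.Presents Δ) {k : ℕ}
    (hk : k < 2 * Δ.edges) {c : Cfg} (hc : CountInv Δ k c) :
    countBody.wp e (CountInv Δ (k + 1)) c := by
  unfold countBody
  exact Stmt.wp_seq (wp_keyStmt he hk hc) fun _ => wp_markStmt he hk hc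

/-- Update the minimum in register `15`. -/
def minBody : Stmt :=
  .get 3 7 2 ;; .word .sub 7 7 3 ;; .get 6 7 7 ;;
  .ite (.wlt 7 15) (.word .add 15 7 6) .skip ;; .word .add 2 2 3

/-- The invariant of the loop that computes the minimum. -/
structure MinInv {n : ℕ} {S : SCS n} (Δ : S.Darts) (v : ℕ) (c : Cfg) : Prop where
  consts : Consts n Δ.edges c
  counter : c.reg 2 = v
  cycle : ∀ x : Fin n, c.arr 3 x = S.period.lead x + 1
  count : ∀ a : Fin n, c.arr 6 a = Δ.count (2 * Δ.edges) a
  le_n : c.reg 15 ≤ n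
  le : ∀ x : Fin n, x < v → c.reg 15 ≤ Δ.count (2 * Δ.edges) (S.period.lead x)
  eq : c.reg 15 = n ∨ ∃ x, Δ.count (2 * Δ.edges) (S.period.lead x) = c.reg 15

theorem wp_minBody {n : ℕ} {S : SCS n} {Δ : S.Darts} {e : Env} (he : e.Presents Δ) {v : ℕ}
    (hv : v < n) {c : Cfg} (hc : MinInv Δ v c) : minBody.wp e (MinInv Δ (v + 1)) c := by
  obtain ⟨⟨r0, r1, r3, r4, r5, r6⟩, r2, hcy, hcnt, hn, hle, heq⟩ := hc
  have hB := he.bound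
  have hb := he.base
  have hm := Δ.edges_le
  obtain ⟨x, hx⟩ : ∃ x : Fin n, v = x := ⟨⟨v, hv⟩, rfl⟩
  have hl := (S.period.lead x).2
  have hcl := Δ.count_lead_le x
  simp [minBody, Stmt.wp, WordOp.eval, Test.HoldsIn, r2, r3, r6, hx, hcy, hcnt]
  have key : ∀ r, r ≤ c.reg 15 → r ≤ Δ.count (2 * Δ.edges) (S.period.lead x) →
      ∀ y : Fin n, (y : ℕ) < x + 1 → r ≤ Δ.count (2 * Δ.edges) (S.period.lead y) := by
    intro r h1 h2 y hy
    rcases Nat.lt_succ_iff_lt_or_eq.1 hy with h | h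
    · exact h1.trans (hle y (by omega))
    · rwa [Fin.ext h]
  refine ⟨by omega, by omega, by omega, by omega, by omega,
    fun hlt => ⟨by omega, by omega, ?_⟩, fun hge => ⟨by omega, ?_⟩⟩
  · refine ⟨?_, ?_, hcy, hcnt, ?_, ?_, ?_⟩
    · constructor <;> simp [r0, r1, r3, r4, r5, r6]
    · simp
    · simpa using hcl
    · simpa using key _ hlt.le le_rfl
    · right
      exact ⟨x, by simp⟩
  · refine ⟨?_, ?_, hcy, hcnt, ?_, ?_, ?_⟩
    · constructor <;> simp [r0, r1, r3, r4, r5, r6]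
    · simp
    · simpa using hn
    · simpa using key _ le_rfl hge
    · simpa using heq

end RAM

namespace RAM

open SCS

/-! ### The whole program -/

/-- Every instruction costs at most a constant times `G + 1`, so the gcd time separates from a
constant that depends only on the code. -/
theorem Stmt.cost_le (G : ℕ) (p : Stmt) : p.cost G ≤ p.cost 0 * (G + 1) := by
  induction p with
  | seq p q ihp ihq =>
    simp only [Stmt.cost]
    rw [add_mul]
    omega
  | ite b p q ihp ihq =>
    simp only [Stmt.cost]
    have h1 := Nat.mul_le_mul_right (G + 1) (le_max_left (p.cost 0) (q.cost 0))
    have h2 := Nat.mul_le_mul_right (G + 1) (le_max_right (p.cost 0) (q.cost 0))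
    rw [add_mul]
    omega
  | _ => simp only [Stmt.cost]; omega

theorem loop_time_le {n N G : ℕ} (hn : 0 < n) (hN : N ≤ 16 * n) (p : Stmt) :
    N * (p.cost G + 1) + 1 ≤ (16 * p.cost 0 + 17) * (n * (G + 1)) := by
  have h1 := p.cost_le G
  have h2 : N * (p.cost G + 1) ≤ 16 * n * (p.cost 0 * (G + 1) + 1) :=
    Nat.mul_le_mul hN (by omega)
  have h3 : n * 1 ≤ n * (G + 1) := Nat.mul_le_mul_left n (by omega)
  nlinarith

theorem straight_time_le {n G : ℕ} (hn : 0 < n) (p : Stmt) :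
    p.cost G ≤ p.cost 0 * (n * (G + 1)) := by
  refine (p.cost_le G).trans (Nat.mul_le_mul_left _ ?_)
  exact Nat.le_mul_of_pos_left _ hn

theorem Runs.mono_time {e : Env} {gcdProgram : Program} {p : Stmt} {c : Cfg} {T T' : ℕ}
    {Q : Cfg → Prop} (h : Runs e gcdProgram p c T Q) (hT : T ≤ T') :
    Runs e gcdProgram p c T' Q := by
  intro s hs
  obtain ⟨t, s', c', he, ht, hr⟩ := h s hs
  exact ⟨t, s', c', he, ht.trans hT, hr⟩

def initStmt : Stmt :=
  .const 3 1 ;; .const 4 2 ;; .const 5 16 ;; .rconst 2 (-1) ;; .real .angle 0 2 1 ;;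
  .real .add 7 0 0 ;; .rconst 3 8 ;; .real .div 0 0 3

def resetStmt : Stmt := .const 2 0

def cycleInitStmt : Stmt :=
  .const 2 0 ;; .word .add 14 0 0 ;; .const 15 0 ;; .const 16 0 ;; .const 17 0

def minInitStmt : Stmt := .const 2 0 ;; .word .add 15 0 6

/-- The computation of the 1-resilience, in register `15`. -/
def mainStmt : Stmt :=
  initStmt ;; .loop (.wlt 2 1) slotBody ;;
  resetStmt ;; .loop (.wlt 2 0) walkBody ;;
  cycleInitStmt ;; .loop (.wlt 2 14) cycleBody ;;
  resetStmt ;; .loop (.wlt 2 1) countBody ;;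
  minInitStmt ;; .loop (.wlt 2 0) minBody

/-- A constant for the running time of `mainStmt`. -/
def mainConstant : ℕ :=
  initStmt.cost 0 + (16 * slotBody.cost 0 + 17) +
  (resetStmt.cost 0 + (16 * walkBody.cost 0 + 17)) +
  (cycleInitStmt.cost 0 + (16 * cycleBody.cost 0 + 17)) +
  (resetStmt.cost 0 + (16 * countBody.cost 0 + 17)) +
  (minInitStmt.cost 0 + (16 * minBody.cost 0 + 17))

theorem wp_initStmt {n : ℕ} {S : SCS n} {Δ : S.Darts} {e : Env} (he : e.Presents Δ) {c : Cfg}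
    (h0 : c.reg 0 = n) (h1 : c.reg 1 = 2 * Δ.edges) (h2 : c.reg 2 = 0) (h6 : c.reg 6 = 0)
    (hr1 : c.rreg 1 = 0) (harr : c.arr = fun _ _ => 0) : initStmt.wp e (SlotInv Δ 0) c := by
  have hB := he.bound
  -- The machine has only integer constants; it obtains `π` as the polar angle of `(-1, 0)`.
  have hangle : RealOp.angle.eval (-1) 0 = Real.pi := by
    have hz : (⟨-1, 0⟩ : ℂ) = -1 := by apply Complex.ext <;> simp
    rw [RealOp.eval, hz, Complex.arg_neg_one, toIcoMod_eq_self]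
    have := Real.pi_pos
    constructor <;> linarith
  simp only [initStmt, Stmt.wp]
  refine ⟨by omega, by omega, by omega, ?_, ?_, ?_, ?_, ?_, ?_, ?_⟩
  · constructor <;> simp [h0, h1, h6]
  · simpa using h2
  · simp [hr1, hangle]
    simp [RealOp.eval]
  · simpa using hr1
  · simp [hr1, hangle]
    simp [RealOp.eval]
    ring
  · exact ⟨fun d hd => absurd hd (Nat.not_lt_zero d), fun a ha => absurd (by simp [harr]) ha⟩
  · intro q _
    simp [harr]

theorem wp_reset_slot {n : ℕ} {S : SCS n} {Δ : S.Darts} {e : Env} {c : Cfg}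
    (hc : SlotInv Δ (2 * Δ.edges) c) : resetStmt.wp e (StartInv Δ 0) c := by
  obtain ⟨⟨r0, r1, r3, r4, r5, r6⟩, -, -, -, -, hs, hz⟩ := hc
  refine ⟨Nat.zero_le _, ?_, ?_, hs, fun d _ h => absurd h (Nat.not_lt_zero _),
    fun x h => absurd h (Nat.not_lt_zero _), fun q hq => hz q ?_⟩
  · constructor <;> simp [r0, r1, r3, r4, r5, r6]
  · simp
  · rintro rfl
    exact absurd hq (by decide)

theorem wp_cycleInit {n : ℕ} {S : SCS n} {Δ : S.Darts} {e : Env} (he : e.Presents Δ) {c : Cfg}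
    (hc : StartInv Δ n c) : cycleInitStmt.wp e (CycleInv Δ 0) c := by
  obtain ⟨⟨r0, r1, r3, r4, r5, r6⟩, -, -, hst, hp, hz⟩ := hc
  have hB := he.bound
  have hvis : ∀ x, x ∉ visited S.period 0 0 := fun x => by simp [mem_visited]
  simp only [cycleInitStmt, Stmt.wp, WordOp.eval]
  simp [r0]
  refine ⟨by omega, ⟨?_, ?_, ?_, ?_, ?_, ?_, ?_, ?_, ?_, ?_, ?_⟩⟩
  · constructor <;> simp [r0, r1, r3, r4, r5, r6]
  · simp
  · simp
    omega
  · exact fun d hd => hst d hd (Δ.start d).2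
  · exact fun x => hp x x.2
  · exact fun q hq => hz q (le_trans (by decide) hq)
  · simp
  · simp only [ne_eq, Nat.reduceEqDiff, not_false_eq_true, Function.update_of_ne,
      Function.update_self]
    refine ⟨fun x hx => absurd hx (hvis x), fun x hx => absurd hx (hvis x), fun x _ => ?_,
      fun a ha => absurd ha (Nat.not_lt_zero _)⟩
    rw [hz 3 le_rfl]
  · intro v hv
    simp at hv
    simpa using hv
  · simp
  · simp

theorem wp_reset_cycle {n : ℕ} {S : SCS n} {Δ : S.Darts} {e : Env} {c : Cfg}
    (hc : CycleInv Δ (2 * n) c) : resetStmt.wp e (CountInv Δ 0) c := by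
  obtain ⟨⟨r0, r1, r3, r4, r5, r6⟩, -, -, hst, -, hz, hvle, hlab, -, hfin, htime⟩ := hc
  -- At most `n` trajectories can be visited, so a potential of at least `2 * n` forces the start
  -- counter to `n`.
  have hv : c.reg 15 = n := by
    have hcard := Finset.card_le_univ (visited S.period (c.reg 15) (c.reg 17))
    rw [Fintype.card_fin] at hcard
    rcases htime with h | h
    · exact h
    · omega
  have hvis : ∀ x, x ∈ visited S.period (c.reg 15) (c.reg 17) := fun x => by
    rw [mem_visited, hv]
    exact Or.inl (S.period.lead x).2
  refine ⟨Nat.zero_le _, ?_, ?_, hst, fun x => hlab.cycle x (hvis x), fun x => hlab.idx x (hvis x),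
    fun x => hlab.len _ (by rw [hv]; exact (S.period.lead x).2) (S.period.lead_lead x), ?_, ?_, ?_⟩
  · constructor <;> simp [r0, r1, r3, r4, r5, r6]
  · simp
  · intro a
    simp [hz, Darts.count, Darts.keys]
  · intro κ hκ
    simp [Darts.keys] at hκ
  · intro κ _ _
    simp [hz]

theorem wp_minInit {n : ℕ} {S : SCS n} {Δ : S.Darts} {e : Env} (he : e.Presents Δ) {c : Cfg}
    (hc : CountInv Δ (2 * Δ.edges) c) : minInitStmt.wp e (MinInv Δ 0) c := by
  obtain ⟨⟨r0, r1, r3, r4, r5, r6⟩, -, -, hcy, -, -, hcnt, -, -⟩ := hc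
  have hB := he.bound
  simp only [minInitStmt, Stmt.wp, WordOp.eval]
  simp [r0, r6]
  refine ⟨by omega, ⟨?_, ?_, hcy, hcnt, ?_, ?_, ?_⟩⟩
  · constructor <;> simp [r0, r1, r3, r4, r5, r6]
  · simp
  · simp
  · exact fun x h => absurd h (Nat.not_lt_zero _)
  · simp

theorem MinInv.eq_kResilience {n : ℕ} {S : SCS n} {Δ : S.Darts} (hn : 0 < n) {c : Cfg}
    (hc : MinInv Δ n c) : ((c.reg 15 : ℕ) : ℕ∞) = S.kResilience 1 := by
  have hle : ∀ u, c.reg 15 ≤ {v | S.Meets u v}.ncard := fun u => by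
    rw [Δ.ncard_meets]
    exact hc.le u u.2
  refine (S.kResilience_one_eq ?_ hle).symm
  -- If the minimum still has its initial value `n`, it is attained by any trajectory, since no
  -- count exceeds `n`.
  rcases hc.eq with h | ⟨x, h⟩
  · refine ⟨⟨0, hn⟩, le_antisymm ?_ (hle _)⟩
    rw [Δ.ncard_meets, h]
    exact Δ.count_lead_le _
  · exact ⟨x, by rw [Δ.ncard_meets, h]⟩

theorem runs_mainStmt {n : ℕ} {S : SCS n} {Δ : S.Darts} {e : Env} (he : e.Presents Δ)
    {gcdProgram : Program} (hg : e.GcdSpec gcdProgram) {c : Cfg}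
    (h0 : c.reg 0 = n) (h1 : c.reg 1 = 2 * Δ.edges) (h2 : c.reg 2 = 0) (h6 : c.reg 6 = 0)
    (hr1 : c.rreg 1 = 0) (harr : c.arr = fun _ _ => 0) :
    Runs e gcdProgram mainStmt c (mainConstant * (n * (e.gcdTime + 1))) (MinInv Δ n) := by
  have hn := he.pos
  have hm := Δ.edges_le
  have straight : ∀ {p : Stmt} {c : Cfg} {Q : Cfg → Prop}, p.wp e Q c →
      Runs e gcdProgram p c (p.cost 0 * (n * (e.gcdTime + 1))) Q := fun hp =>
    (Runs.of_wp hg hp).mono_time (straight_time_le hn _)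
  have loop : ∀ {p : Stmt} {b : Test} {N : ℕ} (I : ℕ → Cfg → Prop), N ≤ 16 * n →
      (∀ k c, I k c → (b.HoldsIn c ↔ k < N)) → (∀ k < N, ∀ c, I k c → p.wp e (I (k + 1)) c) →
      ∀ c, I 0 c → Runs e gcdProgram (.loop b p) c
        ((16 * p.cost 0 + 17) * (n * (e.gcdTime + 1))) (I N) := fun I hN hb hp c hc =>
    (Runs.loop I hb (fun k hk c hc => Runs.of_wp hg (hp k hk c hc)) hc).mono_time
      (loop_time_le hn hN _)
  have hrun := (straight (wp_initStmt he h0 h1 h2 h6 hr1 harr)).seq fun c hc =>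
    (loop (b := .wlt 2 1) (p := slotBody) (SlotInv Δ) hm
      (fun k c hc => by rw [Test.HoldsIn, hc.counter, hc.consts.r1])
      (fun k hk c hc => wp_slotBody he hk hc) c hc).seq fun c hc =>
    (straight (wp_reset_slot (e := e) hc)).seq fun c hc =>
    (loop (b := .wlt 2 0) (p := walkBody) (N := n) (StartInv Δ) (by omega)
      (fun k c hc => by rw [Test.HoldsIn, hc.counter, hc.consts.r0])
      (fun k hk c hc => wp_walkBody he hk hc) c hc).seq fun c hc =>
    (straight (wp_cycleInit he hc)).seq fun c hc =>
    (loop (b := .wlt 2 14) (p := cycleBody) (N := 2 * n) (CycleInv Δ) (by omega)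
      (fun k c hc => by rw [Test.HoldsIn, hc.counter, hc.limit])
      (fun k hk c hc => wp_cycleBody he hk hc) c hc).seq fun c hc =>
    (straight (wp_reset_cycle (e := e) hc)).seq fun c hc =>
    (loop (b := .wlt 2 1) (p := countBody) (CountInv Δ) hm
      (fun k c hc => by rw [Test.HoldsIn, hc.counter, hc.consts.r1])
      (fun k hk c hc => wp_countBody he hk hc) c hc).seq fun c hc =>
    (straight (wp_minInit he hc)).seq fun c hc =>
    loop (b := .wlt 2 0) (p := minBody) (N := n) (MinInv Δ) (by omega)
      (fun k c hc => by rw [Test.HoldsIn, hc.counter, hc.consts.r0])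
      (fun k hk c hc => wp_minBody he hk hc) c hc
  refine Runs.mono_time hrun (le_of_eq ?_)
  unfold mainConstant
  ring

/-- Set up the registers for addresses. -/
def prelude : Program :=
  .seq (.word .add 13 1 1) <| .seq (.word .add 2 13 0) <| .seq (.const 11 1) <|
  .seq (.word .add 3 2 11) <| .seq (.word .add 4 3 11) <| .seq (.word .add 5 4 11) <|
  .seq (.word .add 6 5 11) <| .seq (.word .add 7 6 11) <| .seq (.word .add 8 7 11) <|
  .seq (.word .add 9 8 11) <| .seq (.const 11 0) <| .seq (.const 10 8) (.word .add 12 0 11)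

theorem exec_prelude {e : Env} {n m : ℕ} {s : State} (hbase : e.base = n + 2 * m)
    (hB : e.base + 10 ≤ e.bound) (h0 : s.reg 0 = n) (h1 : s.reg 1 = m)
    (h2 : ∀ r, 2 ≤ r → s.reg r = 0) (hmem : s.mem = e.memory fun _ _ => 0)
    (hrreg : s.rreg = fun _ => 0) (hrmem : s.rmem = e.real) :
    ∃ s' c, Exec e.bound prelude s 13 s' ∧ Represents e c s' ∧ c.reg 0 = n ∧ c.reg 1 = 2 * m ∧
      (∀ r, 2 ≤ r → c.reg r = 0) ∧ c.rreg = (fun _ => 0) ∧ c.arr = fun _ _ => 0 := by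
  have hexec : ∃ s' : State, Exec e.bound prelude s 13 s' ∧ s'.reg 12 = n ∧ s'.reg 13 = 2 * m ∧
      (∀ r, 14 ≤ r → s'.reg r = 0) ∧ (∀ q : Fin 8, s'.reg (2 + q) = e.base + q) ∧
      s'.reg 10 = 8 ∧ s'.mem = s.mem ∧ s'.rreg = s.rreg ∧ s'.rmem = s.rmem := by
    refine ⟨_, .seq (.word _ _ _ _ _ ?_) <| .seq (.word _ _ _ _ _ ?_) <| .seq (.const _ _ _ ?_) <|
      .seq (.word _ _ _ _ _ ?_) <| .seq (.word _ _ _ _ _ ?_) <| .seq (.word _ _ _ _ _ ?_) <|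
      .seq (.word _ _ _ _ _ ?_) <| .seq (.word _ _ _ _ _ ?_) <| .seq (.word _ _ _ _ _ ?_) <|
      .seq (.word _ _ _ _ _ ?_) <| .seq (.const _ _ _ ?_) <|
      .seq (.const _ _ _ ?_) (.word _ _ _ _ _ ?_), ?_, ?_, ?_, ?_, ?_, rfl, rfl, rfl⟩
    all_goals try simp [WordOp.eval, h0, h1]
    any_goals omega
    · intro r hr
      have : r ≠ 2 ∧ r ≠ 3 ∧ r ≠ 4 ∧ r ≠ 5 ∧ r ≠ 6 ∧ r ≠ 7 ∧ r ≠ 8 ∧ r ≠ 9 ∧ r ≠ 10 ∧ r ≠ 11 ∧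
        r ≠ 12 ∧ r ≠ 13 := by omega
      simp [this, h2 r (by omega)]
    · intro q
      fin_cases q <;> simp <;> omega
  obtain ⟨s', he, h12, h13, h14, hq, h10, hm', hr', hrm'⟩ := hexec
  refine ⟨s', ⟨fun r => s'.reg (r + 12), fun _ _ => 0, fun _ => 0⟩, he,
    ⟨fun r => rfl, hq, h10, hm'.trans hmem, hr'.trans hrreg, hrm'.trans hrmem⟩, h12, h13,
    fun r hr => h14 _ (by omega), rfl, rfl⟩

/-- The program for the 1-resilience. -/
def resilienceProgram (gcdProgram : Program) : Program :=
  .seq prelude (.seq (mainStmt.compile gcdProgram) (.seq (.const 1 0) (.word .add 0 27 1)))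

/-- The term `8 * n ^ 3` is for addresses in the table of marks; the exponent also dominates that of
the gcd program. -/
theorem bound_le {n : ℕ} (hn : 0 < n) (c : ℕ) :
    8 * n ^ 3 + 1000 * n + 1000 ≤ (n + 2) ^ (c + 9) := by
  have h1 : (n + 2) ^ (3 + 6) ≤ (n + 2) ^ (c + 9) := Nat.pow_le_pow_right (by omega) (by omega)
  refine le_trans ?_ h1
  rw [pow_add]
  have h2 : 3 ^ 6 ≤ (n + 2) ^ 6 := Nat.pow_le_pow_left (by omega) 6
  have h3 : (n + 2) ^ 3 = n ^ 3 + 6 * n ^ 2 + 12 * n + 8 := by ring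
  calc 8 * n ^ 3 + 1000 * n + 1000 ≤ (n + 2) ^ 3 * 3 ^ 6 := by
        rw [h3]
        omega
    _ ≤ _ := Nat.mul_le_mul_left _ h2

theorem computesOneResilience {gcdProgram : Program} {Tgcd : ℕ → ℝ}
    (h : ComputesGcd gcdProgram Tgcd) :
    ComputesOneResilience (resilienceProgram gcdProgram)
      (fun n => (2 * mainConstant + 15 : ℕ) * ((n : ℝ) * Tgcd n)) := by
  obtain ⟨c, hc⟩ := h
  refine ⟨c + 9, fun n S es hes => ?_⟩
  have i₀ : Fin n := S.connected.nonempty.some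
  have hn : 0 < n := i₀.pos
  set Δ := Darts.ofList es i₀ hes with hΔ
  have hed : Δ.edges = es.length := rfl
  have hm := Δ.edges_le
  have hbound := bound_le hn c
  set e : Env := ⟨n + 2 * es.length, (inputState S es).mem, (inputState S es).rmem,
    (n + 2) ^ (c + 9), n, ⌊Tgcd n⌋₊⟩ with he
  have hpres : e.Presents Δ := by
    refine ⟨hn, rfl, inputState_mem_direction S es, fun d hd => inputState_mem_src S es i₀ hes hd,
      fun i => ?_, fun i => ?_, fun i => ?_, rfl, hbound⟩
    · simpa using inputState_rmem S es i 0 (by norm_num)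
    · simpa using inputState_rmem S es i 1 (by norm_num)
    · simpa using inputState_rmem S es i 2 (by norm_num)
  have hspec : e.GcdSpec gcdProgram := by
    refine ⟨?_, fun a b ha han hb hbn => ?_⟩
    · change n ≤ (n + 2) ^ (c + 9)
      omega
    · obtain ⟨t, s', hex, ht, hr⟩ := hc n a b ha han hb hbn
      exact ⟨t, s', hex.mono (Nat.pow_le_pow_right (by omega) (by omega)), Nat.le_floor ht, hr⟩
  -- Even the gcd of 1 and 1 takes a step. This lets `n * Tgcd n` absorb the terms without gcds: `n
  -- * (G + 1) ≤ 2 * (n * G)`, and the 15 steps outside `mainStmt` are at most `15 * (n * G)`.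
  have hT : 1 ≤ Tgcd n := by
    obtain ⟨t, s', hex, ht, -⟩ := hc n 1 1 le_rfl hn le_rfl hn
    refine le_trans ?_ ht
    exact_mod_cast hex.one_le
  have hG : 1 ≤ ⌊Tgcd n⌋₊ := Nat.le_floor (by exact_mod_cast hT)
  have hmem : (inputState S es).mem = e.memory fun _ _ => 0 := by
    funext a
    unfold Env.memory
    split_ifs with ha
    · rfl
    · change (_ : List ℕ).getD a 0 = 0
      refine List.getD_eq_default _ _ ?_
      have hlen : ∀ l : List (Fin n × Fin n),
          (l.flatMap fun e : Fin n × Fin n => [(e.1 : ℕ), (e.2 : ℕ)]).length = 2 * l.length := by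
        intro l
        induction l with
        | nil => rfl
        | cons x l ih =>
          rw [List.flatMap_cons, List.length_append, ih, List.length_cons]
          simp
          omega
      rw [List.length_append, List.length_ofFn, hlen]
      exact not_lt.1 ha
  obtain ⟨s₁, c₁, hex₁, hrep₁, k0, k1, k2, kr, ka⟩ := exec_prelude (e := e) (n := n)
    (m := es.length) (s := inputState S es) rfl
    (by change n + 2 * es.length + 10 ≤ (n + 2) ^ (c + 9); omega) rfl rfl
    (fun r hr => by
      change (if r = 0 then n else if r = 1 then es.length else 0) = 0
      rw [if_neg (by omega), if_neg (by omega)])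
    hmem rfl rfl
  obtain ⟨t₂, s₂, c₂, hex₂, ht₂, hrep₂, hmin⟩ := runs_mainStmt hpres hspec k0 k1 (k2 2 le_rfl)
    (k2 6 (by norm_num)) (by rw [kr]) ka s₁ hrep₁
  -- Registers of configurations are kept 12 places higher on the machine, so the result is copied
  -- from register 27 to register 0.
  have h27 : s₂.reg 27 = c₂.reg 15 := hrep₂.reg 15
  have hb27 : c₂.reg 15 ≤ (n + 2) ^ (c + 9) := by
    have := hmin.le_n
    omega
  have hex₃ := Exec.const (B := (n + 2) ^ (c + 9)) s₂ 1 0 (Nat.zero_le _)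
  set s₃ : State := { s₂ with reg := Function.update s₂.reg 1 0 } with hs₃
  have hv : WordOp.add.eval (s₃.reg 27) (s₃.reg 1) = c₂.reg 15 := by
    simp [hs₃, WordOp.eval, h27]
  have hex₄ := Exec.word (B := (n + 2) ^ (c + 9)) s₃ .add 0 27 1 (by rw [hv]; exact hb27)
  refine ⟨_, _, .seq hex₁ (.seq hex₂ (.seq hex₃ hex₄)), ?_, ?_⟩
  · change t₂ ≤ mainConstant * (n * (⌊Tgcd n⌋₊ + 1)) at ht₂
    have h5 : 13 + (t₂ + (1 + 1)) ≤ (2 * mainConstant + 15) * (n * ⌊Tgcd n⌋₊) := by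
      have h6 : n * (⌊Tgcd n⌋₊ + 1) ≤ 2 * (n * ⌊Tgcd n⌋₊) := by nlinarith
      have h7 := Nat.mul_le_mul_left mainConstant h6
      have h8 : 1 ≤ n * ⌊Tgcd n⌋₊ := Nat.mul_pos hn hG
      nlinarith
    have h9 : ((13 + (t₂ + (1 + 1)) : ℕ) : ℝ) ≤
        ((2 * mainConstant + 15) * (n * ⌊Tgcd n⌋₊) : ℕ) := by exact_mod_cast h5
    refine h9.trans ?_
    rw [Nat.cast_mul]
    have := Nat.floor_le (zero_le_one.trans hT)
    rw [Nat.cast_mul]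
    exact mul_le_mul_of_nonneg_left (mul_le_mul_of_nonneg_left this (Nat.cast_nonneg _))
      (Nat.cast_nonneg _)
  · simp only [Function.update_self, hv]
    exact hmin.eq_kResilience hn

end RAM

theorem mainTheorem6 :
    (∀ (gcdProgram : RAM.Program) (Tgcd : ℕ → ℝ), RAM.ComputesGcd gcdProgram Tgcd →
      ∃ (p : RAM.Program) (C : ℝ),
        RAM.ComputesOneResilience p (fun n => C * ((n : ℝ) * Tgcd n))) ∧
    (∃ (gcdProgram : RAM.Program) (C : ℝ) (k : ℕ),
      RAM.ComputesGcd gcdProgram (fun n => C * Real.log ((n : ℝ) + 2) ^ k)) ∧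
    (∃ (p : RAM.Program) (C : ℝ) (k : ℕ),
      RAM.ComputesOneResilience p (fun n => C * ((n : ℝ) * Real.log ((n : ℝ) + 2) ^ k))) := by
  refine ⟨fun gcdProgram Tgcd h => ⟨_, _, RAM.computesOneResilience h⟩,
    ⟨_, _, _, RAM.computesGcd_euclid⟩, RAM.resilienceProgram RAM.euclid,
    (2 * RAM.mainConstant + 15 : ℕ) * 32, 1, ?_⟩
  have h := RAM.computesOneResilience RAM.computesGcd_euclid
  convert h using 2 with n
  ring
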